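/- **Setting.** Let $S$ be a closed, connected, oriented surface of negative Euler characteristic, and let $\rho=(\rho_l,\rho_r):\pi_1(S)\to \mathrm{PSL}_2\mathbb R\times\mathrm{PSL}_2\mathbb R$ with $\rho_l,\rho_r$ Fuchsian, $\mathbb H^2/\rho_l(\pi_1(S))=(S,h_l)$ and $\mathbb H^2/\rho_r(\pi_1(S))=(S,h_r)$ as oriented surfaces. Let $\Omega_\rho=p_l^*\Omega_l-p_r^*\Omega_r$ on $S\times S$, where $\Omega_l,\Omega_r$ are the area forms of the hyperbolic metrics $h_l,h_r$ and $p_l,p_r$ are the two projections. *The bundle $P_\rho$.* Let $\widetilde{\mathbb{A}\mathrm{d}\mathbb S}{}^3$ be the universal cover $\widetilde{\mathrm{SL}_2\mathbb R}$ of $\mathrm{PSL}_2\mathbb R$ with $\tfrac18$ of the Killing metric, and let $T$ be its bundle of unit timelike vectors $(\gamma,u)$ that are future-directed, meaning that $\gamma^{-1}u\in\mathfrak{sl}_2\mathbb R$ generates counterclockwise rotations of $\mathbb H^2$. Let $\varphi_t$ be the geodesic flow on $T$, $\chi$ its generator, $g_S$ the Sasaki metric, and $\omega=-g_S(\chi,\cdot)$.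 Let $\pi:T\to\mathbb H^2\times\mathbb H^2$ send $(\gamma,u)$ to the pair $(x,y)$ such that the geodesic with initial datum $(\gamma,u)$ projects onto $\{g\in \mathrm{PSL}_2\mathbb R: g(y)=x\}$. The group $\mathrm{Isom}_0(\widetilde{\mathbb{A}\mathrm{d}\mathbb S}{}^3)=(\widetilde{\mathrm{SL}_2\mathbb R}\times\widetilde{\mathrm{SL}_2\mathbb R})/\Delta_{\mathcal Z}$ (with $\Delta_{\mathcal Z}$ the diagonal of the center) acts by $\gamma\mapsto\alpha\gamma\beta^{-1}$. Let $\widetilde\rho:\pi_1(S)\to\mathrm{Isom}_0(\widetilde{\mathbb{A}\mathrm{d}\mathbb S}{}^3)$ be the standard lift of $\rho$: the lift that preserves every component of the preimage in $\partial_\infty\widetilde{\mathbb{A}\mathrm{d}\mathbb S}{}^3$ of the graph in $\mathbb{RP}^1\times\mathbb{RP}^1$ of the orientation-preserving homeomorphism conjugating $\rho_l$ to $\rho_r$. Then $P_\rho=T/\widetilde\rho(\pi_1(S))$, with the $\mathbb R$-action by $\varphi_t$ and the connection form $\omega_\rho$ induced by $\omega$, is a principal $\mathbb R$-bundle over $(\mathbb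 H^2\times\mathbb H^2)/\rho(\pi_1(S))$, a covering of $S\times S$. *Lagrangian embeddings and holonomy.* Let $\mathcal M_\rho$ be the set of smooth embeddings $\Lambda:S\to S\times S$ that are isotopic to the diagonal and satisfy $\Lambda^*\Omega_\rho=0$. Each $\Lambda\in\mathcal M_\rho$ has a unique $\rho$-equivariant lift $\widetilde S\to\mathbb H^2\times\mathbb H^2$, that is, a canonical lift to $(\mathbb H^2\times\mathbb H^2)/\rho(\pi_1(S))$, and $\Lambda^*P_\rho\to S$ denotes the pull-back of $P_\rho$ by it, with the induced flat connection. Its holonomy $\mathrm{hol}_{\Lambda^*P_\rho}:\pi_1(S)\to\mathbb R$ is defined as follows: for a smooth loop $\ell$ and a section $p$ of $\Lambda^*P_\rho$ along $\ell$ with $\omega_\rho(p')=0$, $\mathrm{hol}_{\Lambda^*P_\rho}([\ell])$ is the unique $t_0\in\mathbb R$ with $p(0)=\varphi_{t_0}(p(1))$. *Flux.* For a smooth path $\Lambda_\bullet:[0,1]\to\mathcal M_\rho$, the homomorphism $\mathrm{Flux}([\Lambda_\bullet]):\pi_1(S)\to\mathbb R$ is $$\mathrm{Flux}([\Lambda_\bullet])([\ell])=\int_0^1\!\!\int_0^1\Omega_\rho\Big(\frac{\partial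 F_\ell}{\partial s},\frac{\partial F_\ell}{\partial t}\Big)\,ds\,dt,\qquad F_\ell(s,t)=\Lambda_t(\ell(s)),$$ for smooth loops $\ell:[0,1]\to S$. **Proposition.** Let $\Lambda_\bullet:[0,1]\to\mathcal M_\rho$ be a smooth path of Lagrangian embeddings. Then $\mathrm{hol}_{\Lambda_0^*P_\rho}$, $\mathrm{hol}_{\Lambda_1^*P_\rho}$ and $\mathrm{Flux}([\Lambda_\bullet])$ are well-defined homomorphisms $\pi_1(S)\to\mathbb R$, and $$\mathrm{hol}_{\Lambda_1^*P_\rho}=\mathrm{hol}_{\Lambda_0^*P_\rho}-\tfrac12\,\mathrm{Flux}([\Lambda_\bullet]).$$ -/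

import Mathlib

open scoped Manifold ContDiff MatrixGroups UpperHalfPlane unitInterval
open Set MeasureTheory

noncomputable section

namespace AdSFlux

/-! ## The hyperbolic plane and `PSL₂(ℝ)` -/

/-- The group `PSL₂(ℝ)`. -/
abbrev PSL2R : Type := Matrix.ProjectiveSpecialLinearGroup (Fin 2) ℝ

theorem center_smul (g : SL(2, ℝ)) (hg : g ∈ Subgroup.center SL(2, ℝ)) (z : ℍ) : g • z = z := by
  obtain ⟨r, hr, hg⟩ := Matrix.SpecialLinearGroup.mem_center_iff.mp hg
  have e : ∀ i j, g i j = if i = j then r else 0 := by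
    intro i j
    have : (g : Matrix (Fin 2) (Fin 2) ℝ) i j = (Matrix.scalar (Fin 2) r) i j := by rw [hg]
    simpa [Matrix.diagonal_apply] using this
  have hr0 : (r : ℂ) ≠ 0 := by
    intro h
    have : r = 0 := by exact_mod_cast h
    simp [this] at hr
  apply UpperHalfPlane.ext_re_im
  · have := UpperHalfPlane.specialLinearGroup_apply g z
    rw [this]
    simp [e, hr0]
  · have := UpperHalfPlane.specialLinearGroup_apply g z
    rw [this]
    simp [e, hr0]

/-- The action of `PSL₂(ℝ)` on the upper half-plane by Möbius transformations. -/
def pslAct : PSL2R →* Equiv.Perm ℍ :=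
  QuotientGroup.lift (Subgroup.center SL(2, ℝ)) (MulAction.toPermHom SL(2, ℝ) ℍ) (by
    intro g hg
    ext1 z
    exact center_smul g hg z)

/-- The area form `dx ∧ dy / y²` of the hyperbolic plane at `z`. -/
def hypArea (z : ℍ) (v w : ℂ) : ℝ := (v.re * w.im - v.im * w.re) / z.im ^ 2

/-! ## The universal cover of `SL₂(ℝ)` -/

/-- The universal cover of `SL₂(ℝ)` (and of `PSL₂(ℝ)`): pairs of `g ∈ SL₂(ℝ)` and a lift to `ℝ` of
the action of `g` on the circle of rays of `ℝ²`. Such a lift is an increasing homeomorphism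
commuting with the translation by `π`. -/
def liftSubgroup : Subgroup (SL(2, ℝ) × (ℝ ≃o ℝ)) where
  carrier := {a | (∀ θ, a.2 (θ + Real.pi) = a.2 θ + Real.pi) ∧
    ∀ θ, ∃ r : ℝ, 0 < r ∧ Matrix.mulVec (a.1 : Matrix (Fin 2) (Fin 2) ℝ)
      ![Real.cos θ, Real.sin θ] = r • ![Real.cos (a.2 θ), Real.sin (a.2 θ)]}
  one_mem' := ⟨fun _ => rfl, fun θ => ⟨1, one_pos, by simp⟩⟩
  mul_mem' := by
    rintro ⟨a, f⟩ ⟨b, g⟩ ⟨ha, ha'⟩ ⟨hb, hb'⟩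
    simp only at ha ha' hb hb'
    refine ⟨fun θ => ?_, fun θ => ?_⟩
    · change f (g (θ + Real.pi)) = f (g θ) + Real.pi
      rw [hb, ha]
    · obtain ⟨r, hr, h⟩ := hb' θ
      obtain ⟨r', hr', h'⟩ := ha' (g θ)
      refine ⟨r * r', mul_pos hr hr', ?_⟩
      change Matrix.mulVec ((a : Matrix (Fin 2) (Fin 2) ℝ) * (b : Matrix (Fin 2) (Fin 2) ℝ)) _ =
        (r * r') • ![Real.cos (f (g θ)), Real.sin (f (g θ))]
      rw [← Matrix.mulVec_mulVec, h, Matrix.mulVec_smul, h', smul_smul]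
  inv_mem' := by
    rintro ⟨a, f⟩ ⟨ha, ha'⟩
    simp only at ha ha'
    refine ⟨fun θ => ?_, fun θ => ?_⟩
    · change f.symm (θ + Real.pi) = f.symm θ + Real.pi
      rw [OrderIso.symm_apply_eq, ha, OrderIso.apply_symm_apply]
    · obtain ⟨r, hr, h⟩ := ha' (f.symm θ)
      rw [OrderIso.apply_symm_apply] at h
      refine ⟨r⁻¹, inv_pos.mpr hr, ?_⟩
      change Matrix.mulVec ((a⁻¹ : SL(2, ℝ)) : Matrix (Fin 2) (Fin 2) ℝ) _ =
        r⁻¹ • ![Real.cos (f.symm θ), Real.sin (f.symm θ)]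
      have h2 : ![Real.cos θ, Real.sin θ] = r⁻¹ • Matrix.mulVec (a : Matrix (Fin 2) (Fin 2) ℝ)
          ![Real.cos (f.symm θ), Real.sin (f.symm θ)] := by
        rw [h, smul_smul, inv_mul_cancel₀ hr.ne', one_smul]
      rw [h2, Matrix.mulVec_smul, Matrix.mulVec_mulVec,
        ← Matrix.SpecialLinearGroup.coe_mul, inv_mul_cancel, Matrix.SpecialLinearGroup.coe_one,
        Matrix.one_mulVec]

/-- The universal cover of `SL₂(ℝ)`. It carries the topology, and the smooth structure, for which
`(g, f) ↦ (g, f 0)` is an embedding into `SL₂(ℝ) × ℝ`. -/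
abbrev SL2Tilde : Type := liftSubgroup

/-- The underlying matrix group element. -/
def SL2Tilde.toSL (a : SL2Tilde) : SL(2, ℝ) := a.1.1

/-- The underlying matrix. -/
def SL2Tilde.mat (a : SL2Tilde) : Matrix (Fin 2) (Fin 2) ℝ := (a.toSL : Matrix (Fin 2) (Fin 2) ℝ)

/-- The inverse of the underlying matrix. -/
def SL2Tilde.invMat (a : SL2Tilde) : Matrix (Fin 2) (Fin 2) ℝ :=
  ((a.toSL)⁻¹ : SL(2, ℝ)).1

/-- The action of the universal cover on `ℝ`, the universal cover of `ℝP¹ = ℝ / πℤ`. -/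
def SL2Tilde.lift (a : SL2Tilde) : ℝ ≃o ℝ := a.1.2

/-- The universal covering homomorphism `p` onto `PSL₂(ℝ)`. -/
def toPSL (a : SL2Tilde) : PSL2R := QuotientGroup.mk a.toSL

/-! ## Anti-de Sitter space: metric, Levi-Civita connection, unit tangent bundle

The universal cover of Anti-de Sitter space is `SL2Tilde`. As the covering onto `SL₂(ℝ)` is a local
diffeomorphism, tangent vectors at `γ` are identified with matrices `w` such that `γ⁻¹ w` is
traceless. -/

/-- The metric at `γ`: one eighth of the Killing form `κ(X, Y) = 4 tr (X Y)` of `sl₂(ℝ)`,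
transported by left translation. -/
def adsMetric (γ : SL2Tilde) (w₁ w₂ : Matrix (Fin 2) (Fin 2) ℝ) : ℝ :=
  (1 / 8) * (4 * Matrix.trace ((γ.invMat * w₁) * (γ.invMat * w₂)))

/-- Levi-Civita covariant derivative at `γ` of a vector field `u` along a curve with velocity `w`,
where `u'` is the derivative of `u` as a matrix-valued function. The connection of a bi-invariant
metric is `∇_X Y = [X, Y] / 2` on left-invariant fields; so, with `X = γ⁻¹ w` and `Y = γ⁻¹ u`, the
covariant derivative is `γ (Y' + [X, Y] / 2)`, where `γ Y' = u' - w γ⁻¹ u`. -/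
def covDeriv (γ : SL2Tilde) (w u u' : Matrix (Fin 2) (Fin 2) ℝ) : Matrix (Fin 2) (Fin 2) ℝ :=
  (u' - w * (γ.invMat * u)) + (1 / 2 : ℝ) •
    (γ.mat * ((γ.invMat * w) * (γ.invMat * u) - (γ.invMat * u) * (γ.invMat * w)))

/-- The bundle of future unit timelike vectors `(γ, u)`. A unit timelike vector is future-directed
when `γ⁻¹ u` generates counterclockwise rotations of the hyperbolic plane; for a traceless matrix
of square `-1` this means that the lower left entry is negative. -/
@[ext]
structure UnitTangent where
  pt : SL2Tilde
  vec : Matrix (Fin 2) (Fin 2) ℝ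
  tangent : Matrix.trace (pt.invMat * vec) = 0
  unit : adsMetric pt vec vec = -1
  future : (pt.invMat * vec) 1 0 < 0

/-- A tangent vector to the unit tangent bundle: the derivatives of the two components. -/
abbrev TanVec : Type := Matrix (Fin 2) (Fin 2) ℝ × Matrix (Fin 2) (Fin 2) ℝ

/-- The vertical component of a tangent vector to the unit tangent bundle. -/
def vertPart (v : UnitTangent) (X : TanVec) : Matrix (Fin 2) (Fin 2) ℝ :=
  covDeriv v.pt X.1 v.vec X.2

/-- The Sasaki metric: horizontal and vertical subspaces are orthogonal, and each carries the
metric of Anti-de Sitter space. -/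
def sasaki (v : UnitTangent) (X Y : TanVec) : ℝ :=
  adsMetric v.pt X.1 Y.1 + adsMetric v.pt (vertPart v X) (vertPart v Y)

/-- The generator of the geodesic flow: the horizontal lift of `u` at `(γ, u)`. -/
def geodesicSpray (v : UnitTangent) : TanVec := (v.vec, v.vec * (v.pt.invMat * v.vec))

/-- The generator of the geodesic flow is horizontal. -/
theorem vertPart_geodesicSpray (v : UnitTangent) : vertPart v (geodesicSpray v) = 0 := by
  simp [vertPart, geodesicSpray, covDeriv]

/-- The connection form `ω = - g_S(χ, ·)`. -/
def connForm (v : UnitTangent) (X : TanVec) : ℝ := - sasaki v (geodesicSpray v) X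

/-- The connection form takes the value `1` on the generator of the geodesic flow. -/
theorem connForm_geodesicSpray (v : UnitTangent) : connForm v (geodesicSpray v) = 1 := by
  have h := v.unit
  have h0 : adsMetric v.pt 0 0 = 0 := by simp [adsMetric]
  unfold connForm sasaki
  rw [vertPart_geodesicSpray, h0]
  change -(adsMetric v.pt v.vec v.vec + 0) = 1
  rw [h]
  norm_num

/-- Smooth curves in the unit tangent bundle: smooth matrix entries, and continuity of the lift to
the universal cover. -/
def SmoothCurveOn (c : ℝ → UnitTangent) (J : Set ℝ) : Prop :=
  (∀ i j, ContDiffOn ℝ ∞ (fun s => (c s).pt.mat i j) J) ∧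
  (∀ i j, ContDiffOn ℝ ∞ (fun s => (c s).vec i j) J) ∧
  ContinuousOn (fun s => (c s).pt.lift 0) J

/-- The velocity of a curve in the unit tangent bundle. -/
def velocity (c : ℝ → UnitTangent) (J : Set ℝ) (s : ℝ) : TanVec :=
  (Matrix.of fun i j => derivWithin (fun s => (c s).pt.mat i j) J s,
   Matrix.of fun i j => derivWithin (fun s => (c s).vec i j) J s)

/-- `c(t) = (γ(t), γ'(t))` where `γ : ℝ → AdS` is a (future unit timelike) geodesic. -/
def IsGeodesic (c : ℝ → UnitTangent) : Prop :=
  SmoothCurveOn c univ ∧ ∀ t, (velocity c univ t).1 = (c t).vec ∧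
    vertPart (c t) (velocity c univ t) = 0

/-- The time `t` map of the geodesic flow sends `v` to `w`. -/
def GeodesicFlow (t : ℝ) (v w : UnitTangent) : Prop :=
  ∃ c : ℝ → UnitTangent, IsGeodesic c ∧ c 0 = v ∧ c t = w

/-- The timelike geodesic `L_{x,y}` of `PSL₂(ℝ)`. -/
def timelikeLine (x y : ℍ) : Set PSL2R := {g | pslAct g y = x}

/-- `π(v) = (x, y)`: the geodesic with initial datum `v` projects onto `L_{x,y}`. -/
def ProjectsTo (v : UnitTangent) (xy : ℍ × ℍ) : Prop :=
  ∃ c : ℝ → UnitTangent, IsGeodesic c ∧ c 0 = v ∧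
    range (fun t => toPSL (c t).pt) = timelikeLine xy.1 xy.2

theorem invMat_mul_mat (a : SL2Tilde) : a.invMat * a.mat = 1 := by
  have : ((a.toSL⁻¹ * a.toSL : SL(2, ℝ)) : Matrix (Fin 2) (Fin 2) ℝ) = 1 := by simp
  rw [Matrix.SpecialLinearGroup.coe_mul] at this
  exact this

theorem mat_mul (a b : SL2Tilde) : (a * b).mat = a.mat * b.mat := rfl

theorem mat_one : (1 : SL2Tilde).mat = 1 := rfl

theorem mat_inv (a : SL2Tilde) : (a⁻¹).mat = a.invMat := rfl

theorem invMat_eq (a : SL2Tilde) : a.invMat = (a⁻¹).mat := rfl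

theorem translate_aux (a b γ : SL2Tilde) (u : Matrix (Fin 2) (Fin 2) ℝ) :
    (a * γ * b⁻¹).invMat * (a.mat * u * b.invMat) = b.mat * (γ.invMat * u) * b.invMat := by
  have h1 : (a * γ * b⁻¹).invMat = b.mat * γ.invMat * a.invMat := by
    simp only [invMat_eq, ← mat_mul]
    congr 1
    group
  rw [h1]
  calc b.mat * γ.invMat * a.invMat * (a.mat * u * b.invMat)
      = b.mat * γ.invMat * (a.invMat * a.mat) * u * b.invMat := by simp only [Matrix.mul_assoc]
    _ = _ := by rw [invMat_mul_mat]; simp only [Matrix.mul_assoc, Matrix.one_mul]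

/-- The action of pairs `(α, β)` on the unit tangent bundle, induced by the isometries
`γ ↦ α γ β⁻¹` of (the universal cover of) Anti-de Sitter space. -/
def translate (a : SL2Tilde × SL2Tilde) (v : UnitTangent) : UnitTangent where
  pt := a.1 * v.pt * a.2⁻¹
  vec := a.1.mat * v.vec * a.2.invMat
  tangent := by
    rw [translate_aux, Matrix.trace_mul_comm, ← Matrix.mul_assoc, invMat_mul_mat, Matrix.one_mul]
    exact v.tangent
  unit := by
    have h := v.unit
    unfold adsMetric at h ⊢
    rw [translate_aux, ← h]
    congr 2
    set X := v.pt.invMat * v.vec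
    calc Matrix.trace (a.2.mat * X * a.2.invMat * (a.2.mat * X * a.2.invMat))
        = Matrix.trace (a.2.mat * (X * ((a.2.invMat * a.2.mat) * (X * a.2.invMat)))) := by
          simp only [Matrix.mul_assoc]
      _ = Matrix.trace ((X * (X * a.2.invMat)) * a.2.mat) := by
          rw [invMat_mul_mat, Matrix.one_mul, Matrix.trace_mul_comm]
      _ = Matrix.trace (X * (X * (a.2.invMat * a.2.mat))) := by simp only [Matrix.mul_assoc]
      _ = _ := by rw [invMat_mul_mat, Matrix.mul_one]
  future := by
    rw [translate_aux]
    have ht := v.tangent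
    have hu := v.unit
    have hf := v.future
    unfold adsMetric at hu
    set X := v.pt.invMat * v.vec
    have hd := a.2.toSL.det_coe
    have hB : a.2.invMat = Matrix.adjugate a.2.mat := Matrix.SpecialLinearGroup.coe_inv _
    change a.2.mat.det = 1 at hd
    rw [hB]
    set B := a.2.mat
    rw [Matrix.det_fin_two] at hd
    simp only [Matrix.trace_fin_two, Matrix.mul_apply, Fin.sum_univ_two] at ht hu
    rw [Matrix.adjugate_fin_two]
    simp only [Matrix.mul_apply, Fin.sum_univ_two, Matrix.of_apply, Matrix.cons_val', Matrix.cons_val_zero,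
      Matrix.cons_val_one, Matrix.cons_val_fin_one]
    have h11 : X 1 1 = - X 0 0 := by linarith
    rw [h11] at hu ⊢
    have hq : X 0 0 ^ 2 + X 0 1 * X 1 0 = -1 := by linarith
    generalize X 0 0 = p at *
    generalize X 0 1 = q at *
    generalize X 1 0 = r at *
    generalize B 1 0 = c at *
    generalize B 1 1 = d at *
    have key : ((c * p + d * r) * d + (c * q + d * -p) * -c) * r = (d * r + c * p) ^ 2 + c ^ 2 := by
      linear_combination (-c ^ 2) * hq
    have hcd : 0 < (d * r + c * p) ^ 2 + c ^ 2 := by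
      rcases eq_or_ne c 0 with h | h
      · have : d ≠ 0 := by
          rintro rfl
          rw [h] at hd
          simp at hd
        have h2 := mul_ne_zero this hf.ne
        rw [h]
        have h3 : 0 < (d * r) ^ 2 := by positivity
        linarith
      · positivity
    by_contra hcon
    push Not at hcon
    nlinarith [mul_nonneg hcon (neg_nonneg.mpr hf.le)]

instance : MulAction (SL2Tilde × SL2Tilde) UnitTangent where
  smul := translate
  one_smul v := by
    change translate 1 v = v
    ext1
    · simp [translate]
    · simp [translate, mat_one, invMat_eq]
  mul_smul a b v := by
    change translate (a * b) v = translate a (translate b v)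
    ext1
    · simp [translate, mul_assoc]
    · simp [translate, mat_mul, invMat_eq, Matrix.mul_assoc]

/-! ## The surface, its two hyperbolic structures, and the bundle -/

section Surface

variable {S : Type*} [TopologicalSpace S] [ChartedSpace (EuclideanSpace ℝ (Fin 2)) S]

/-- The class of a loop. -/
abbrev loopClass {x₀ : S} (ℓ : Path x₀ x₀) : FundamentalGroup S x₀ :=
  FundamentalGroup.fromPath (Path.Homotopic.Quotient.mk ℓ)

/-- An identification of `S` with the quotient of the hyperbolic plane by `ρ(π₁(S))`, that is, a
hyperbolic structure on `S` with holonomy representation `ρ`: a smooth universal covering `ℍ → S`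
whose deck group is `π₁(S)` acting through `ρ`. (In Mathlib's multiplication of the fundamental
group the product `[ℓ] * [ℓ']` runs first through `ℓ'`; so the lift of `ℓ` starting at the base
point ends at the image of the base point under the inverse of `ρ[ℓ]`.) -/
structure HypStructure (x₀ : S) (ρ : FundamentalGroup S x₀ →* PSL2R) where
  cov : ℍ → S
  isCoveringMap : IsCoveringMap cov
  surjective : Function.Surjective cov
  isLocalDiffeomorph : IsLocalDiffeomorph 𝓘(ℝ, ℂ) (𝓡 2) ∞ cov
  base : ℍ
  cov_base : cov base = x₀
  invariant : ∀ τ z, cov (pslAct (ρ τ) z) = cov z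
  monodromy : ∀ (ℓ : Path x₀ x₀) (z : ℍ) (c : Path base z),
    (∀ s, cov (c s) = ℓ s) → pslAct (ρ (loopClass ℓ)) z = base

/-- The differential of the covering at `z`. -/
def HypStructure.dcov {x₀ : S} {ρ : FundamentalGroup S x₀ →* PSL2R} (h : HypStructure x₀ ρ)
    (z : ℍ) : ℂ →L[ℝ] EuclideanSpace ℝ (Fin 2) :=
  mfderiv 𝓘(ℝ, ℂ) (𝓡 2) h.cov z

/-- The area form of the hyperbolic structure on `S`, induced by that of the hyperbolic plane. -/
def HypStructure.area {x₀ : S} {ρ : FundamentalGroup S x₀ →* PSL2R} (h : HypStructure x₀ ρ)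
    (x : S) (v w : EuclideanSpace ℝ (Fin 2)) : ℝ :=
  let z := Function.surjInv h.surjective x
  hypArea z ((h.dcov z).inverse v) ((h.dcov z).inverse w)

/-- A representation `ρ = (ρ_l, ρ_r)` with both components Fuchsian, the hyperbolic structures
`ℍ / ρ_l(π₁ S) = (S, h_l)` and `ℍ / ρ_r(π₁ S) = (S, h_r)`, which induce the same orientation of
`S`, and the orientation-preserving homeomorphism of `ℝP¹ = ℝ / πℤ` which conjugates `ρ_l` to
`ρ_r`, given through a lift to `ℝ`. -/
structure FuchsianPair (x₀ : S) where
  ρl : FundamentalGroup S x₀ →* PSL2R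
  ρr : FundamentalGroup S x₀ →* PSL2R
  left : HypStructure x₀ ρl
  right : HypStructure x₀ ρr
  sameOrientation : ∀ z w, left.cov z = right.cov w →
    0 < LinearMap.det (((right.dcov w).inverse ∘L left.dcov z : ℂ →L[ℝ] ℂ) : ℂ →ₗ[ℝ] ℂ)
  bdry : ℝ ≃o ℝ
  bdry_add_pi : ∀ θ, bdry (θ + Real.pi) = bdry θ + Real.pi
  bdry_conj : ∀ τ (α β : SL2Tilde), toPSL α = ρl τ → toPSL β = ρr τ →
    ∀ θ, ∃ k : ℤ, bdry (α.lift θ) = β.lift (bdry θ) + k * Real.pi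

variable {x₀ : S} (D : FuchsianPair x₀)

/-- The preimage in `SL2Tilde × SL2Tilde` of the image of the standard lift of `ρ`: pairs `(α, β)`
over some `ρ(τ)`, which preserve (each component of) the preimage in `∂AdS = (ℝ × ℝ) / ⟨(π, π)⟩` of
the graph of the boundary homeomorphism. Recall that the identity component of the isometry group
of the universal cover of Anti-de Sitter space is the quotient of `SL2Tilde × SL2Tilde` by the
diagonal of the center, which acts trivially. -/
def FuchsianPair.standardLift : Subgroup (SL2Tilde × SL2Tilde) where
  carrier := {a | (∃ τ, toPSL a.1 = D.ρl τ ∧ toPSL a.2 = D.ρr τ) ∧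
    ∀ θ, D.bdry (a.1.lift θ) = a.2.lift (D.bdry θ)}
  one_mem' := ⟨⟨1, by rw [map_one]; rfl, by rw [map_one]; rfl⟩, fun _ => rfl⟩
  mul_mem' := by
    rintro a b ⟨⟨τ, h1, h2⟩, h3⟩ ⟨⟨τ', k1, k2⟩, k3⟩
    refine ⟨⟨τ * τ', by rw [map_mul, ← h1, ← k1]; rfl, by rw [map_mul, ← h2, ← k2]; rfl⟩, ?_⟩
    intro θ
    change D.bdry (a.1.lift (b.1.lift θ)) = a.2.lift (b.2.lift (D.bdry θ))
    rw [h3, k3]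
  inv_mem' := by
    rintro a ⟨⟨τ, h1, h2⟩, h3⟩
    refine ⟨⟨τ⁻¹, by rw [map_inv, ← h1]; rfl, by rw [map_inv, ← h2]; rfl⟩, ?_⟩
    intro θ
    change D.bdry (a.1.lift.symm θ) = a.2.lift.symm (D.bdry θ)
    rw [OrderIso.eq_symm_apply, ← h3, OrderIso.apply_symm_apply]

/-- The total space of the principal `ℝ`-bundle `P_ρ`: the quotient of the unit tangent bundle by
the action of `π₁(S)` through the standard lift of `ρ`. -/
abbrev FuchsianPair.Bundle : Type := MulAction.orbitRel.Quotient D.standardLift UnitTangent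

/-- The class in `P_ρ` of a unit tangent vector. -/
def FuchsianPair.toBundle (v : UnitTangent) : D.Bundle := Quotient.mk'' v

/-- The `ℝ`-action on `P_ρ` induced by the geodesic flow: `Q = φ_t(P)`. -/
def FuchsianPair.Flow (t : ℝ) (P Q : D.Bundle) : Prop :=
  ∃ v w, D.toBundle v = P ∧ D.toBundle w = Q ∧ GeodesicFlow t v w

/-- The symplectic form `Ω_ρ = p_l^* Ω_l - p_r^* Ω_r` on `S × S`. -/
def FuchsianPair.Omega (xy : S × S)
    (V W : EuclideanSpace ℝ (Fin 2) × EuclideanSpace ℝ (Fin 2)) : ℝ :=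
  D.left.area xy.1 V.1 W.1 - D.right.area xy.2 V.2 W.2

/-- A map `S → S × S` is isotopic to the diagonal (through smooth embeddings). -/
def IsotopicToDiagonal (Λ : S → S × S) : Prop :=
  ∃ H : ℝ → S → S × S,
    ContMDiffOn (𝓘(ℝ, ℝ).prod (𝓡 2)) ((𝓡 2).prod (𝓡 2)) ∞ (Function.uncurry H)
      (Icc (0 : ℝ) 1 ×ˢ univ) ∧
    (∀ t ∈ Icc (0 : ℝ) 1, Manifold.IsSmoothEmbedding (𝓡 2) ((𝓡 2).prod (𝓡 2)) ∞ (H t)) ∧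
    (∀ x, H 0 x = (x, x)) ∧ ∀ x, H 1 x = Λ x

/-- The space `M_ρ` of Lagrangian embeddings `S → (S × S, Ω_ρ)` isotopic to the diagonal. -/
structure FuchsianPair.IsLagrangianEmbedding (Λ : S → S × S) : Prop where
  embedding : Manifold.IsSmoothEmbedding (𝓡 2) ((𝓡 2).prod (𝓡 2)) ∞ Λ
  lagrangian : ∀ (x : S) (v w : EuclideanSpace ℝ (Fin 2)), D.Omega (Λ x)
    (mfderiv (𝓡 2) ((𝓡 2).prod (𝓡 2)) Λ x v) (mfderiv (𝓡 2) ((𝓡 2).prod (𝓡 2)) Λ x w) = 0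
  isotopic : IsotopicToDiagonal Λ

/-- A smooth path `[0, 1] → M_ρ`. -/
structure FuchsianPair.IsSmoothPath (Λ : ℝ → S → S × S) : Prop where
  smooth : ContMDiffOn (𝓘(ℝ, ℝ).prod (𝓡 2)) ((𝓡 2).prod (𝓡 2)) ∞ (Function.uncurry Λ)
    (Icc (0 : ℝ) 1 ×ˢ univ)
  mem : ∀ t ∈ Icc (0 : ℝ) 1, D.IsLagrangianEmbedding (Λ t)

/-- The `ρ`-equivariant lift `ℍ → ℍ × ℍ` of a map `Λ : S → S × S` to universal covers. When `Λ` is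
isotopic to the diagonal it exists and is unique. -/
structure FuchsianPair.IsEquivariantLift (Λ : S → S × S) (L : ℍ → ℍ × ℍ) : Prop where
  continuous : Continuous L
  lifts : ∀ z, (D.left.cov (L z).1, D.right.cov (L z).2) = Λ (D.left.cov z)
  equivariant : ∀ τ z, L (pslAct (D.ρl τ) z) =
    (pslAct (D.ρl τ) (L z).1, pslAct (D.ρr τ) (L z).2)

/-- The fiber over `x` of `Λ^* P_ρ`, as a subset of `P_ρ`: the classes of the unit tangent vectors
over the point `L z`, where `L` is the equivariant lift of `Λ` and `z` lies over `x`. -/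
def FuchsianPair.pullbackFiber (Λ : S → S × S) (x : S) : Set D.Bundle :=
  {P | ∃ L, D.IsEquivariantLift Λ L ∧ ∃ z v, D.left.cov z = x ∧ ProjectsTo v (L z) ∧ D.toBundle v = P}

/-- A loop which is smooth as a map from `[0, 1]`. -/
def IsSmoothLoop (ℓ : Path x₀ x₀) : Prop :=
  ContMDiffOn 𝓘(ℝ, ℝ) (𝓡 2) ∞ ℓ.extend (Icc (0 : ℝ) 1)

/-- `p` is a smooth section of `Λ^* P_ρ` along the loop `ℓ` with `ω_ρ(p') = 0`. The connection form
`ω_ρ` is the one induced by `ω` on the quotient, so this is expressed by a lift of `p`. -/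
def FuchsianPair.IsParallelAlong (Λ : S → S × S) (ℓ : Path x₀ x₀) (p : I → D.Bundle) : Prop :=
  (∀ s, p s ∈ D.pullbackFiber Λ (ℓ s)) ∧
  ∃ c : ℝ → UnitTangent, SmoothCurveOn c (Icc 0 1) ∧
    (∀ s ∈ Icc (0 : ℝ) 1, connForm (c s) (velocity c (Icc 0 1) s) = 0) ∧
    ∀ s : I, D.toBundle (c s) = p s

/-- `h` is the holonomy of `Λ^* P_ρ`: for every loop `ℓ`, parallel sections `p` along `ℓ` exist,
and for all of them `h[ℓ]` is the unique `t` with `p(0) = φ_t(p(1))`. -/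
def FuchsianPair.IsHolonomy (Λ : S → S × S) (h : Additive (FundamentalGroup S x₀) →+ ℝ) : Prop :=
  ∀ ℓ : Path x₀ x₀, IsSmoothLoop ℓ →
    (∃ p, D.IsParallelAlong Λ ℓ p) ∧
    ∀ p, D.IsParallelAlong Λ ℓ p →
      ∀ t, D.Flow t (p 1) (p 0) ↔ t = h (Additive.ofMul (loopClass ℓ))

/-- The integral of `F_ℓ^* Ω_ρ = Ω_ρ(∂F_ℓ/∂s, ∂F_ℓ/∂t) ds dt`, where `F_ℓ(s, t) = Λ_t(ℓ(s))`. -/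
def FuchsianPair.fluxIntegral (Λ : ℝ → S → S × S) (ℓ : Path x₀ x₀) : ℝ :=
  ∫ t in (0 : ℝ)..1, ∫ s in (0 : ℝ)..1, D.Omega (Λ t (ℓ.extend s))
    (mfderivWithin 𝓘(ℝ, ℝ) ((𝓡 2).prod (𝓡 2)) (fun s' => Λ t (ℓ.extend s')) (Icc 0 1) s (1 : ℝ))
    (mfderivWithin 𝓘(ℝ, ℝ) ((𝓡 2).prod (𝓡 2)) (fun t' => Λ t' (ℓ.extend s)) (Icc 0 1) t (1 : ℝ))

/-- `f` is the flux of the path `Λ`. -/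
def FuchsianPair.IsFlux (Λ : ℝ → S → S × S) (f : Additive (FundamentalGroup S x₀) →+ ℝ) : Prop :=
  ∀ ℓ : Path x₀ x₀, IsSmoothLoop ℓ → f (Additive.ofMul (loopClass ℓ)) = D.fluxIntegral Λ ℓ

end Surface

end AdSFlux

end

open scoped Manifold ContDiff MatrixGroups UpperHalfPlane unitInterval
open Set MeasureTheory

noncomputable section

namespace AdSFlux

/-! ## Elements of the universal cover -/

/-! The bundle of future unit timelike vectors has global coordinates `(x, y, t)` in `ℍ × ℍ × ℝ`:
the vector `frame x y t` is based at `tri x * rot t * (tri y)⁻¹`, where `tri x` is an upper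
triangular element taking `i` to `x` and `rot t` is a lifted rotation about `i`. In these
coordinates the geodesic flow translates `t` (`geodesicFlow_iff`), the projection is `(x, y)`
(`projectsTo_iff`), and a pair `(α, β)` moves `x` and `y` by Möbius maps and adds to `t` a number
`shift` depending only on `(x, y)` (`smul_frame`). The connection form is `dt + η` with `η = (dx₁ /
x₂ - dy₁ / y₂) / 2` (`connForm_velocity`), and `dη` is half the symplectic form (`hasFDerivAt_eta`).
This is the source of the factor one half.

For a Lagrangian embedding with equivariant lift `L`, the form `L^* η` is closed on the half-plane,
so it is `df` (`exists_potential`), and a curve over `L ∘ γ` is parallel exactly when `t + f ∘ γ` is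
constant. The holonomy is therefore carried by `period`, the change of `t + f` under the standard
lift of `ρ(τ)`. It does not depend on the point, because isometries preserve the connection form,
and it is additive in `τ`. Up to sign it is the holonomy homomorphism (`isHolonomy`).

For the flux, lift the path to equivariant maps `M t` and the loop to `γ`, and apply Stokes to `η`
on the square `(t, s) ↦ M t (γ s)`. The sides `t = 0, 1` contribute increments of the two
potentials. The sides `s = 0, 1` are exchanged by one element of the standard lift, so their
contributions differ by a difference of values of `shift` (`IsPrimitive.sub_eq_of_smul`). The total
is the difference of the two periods (`fluxIntegral_eq`).

Two facts make the objects well defined. The equivariant lift is unique: a deck transformation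
relating two lifts commutes with a cocompact group, so it has bounded displacement and is trivial.
Moreover every class of loops contains a smooth loop, so a homomorphism is determined by its values
on smooth loops. -/

theorem eq_of_sub_mem_zmultiples {X : Type*} [TopologicalSpace X] {s : Set X}
    (hs : IsPreconnected s) {f : X → ℝ} (hf : ContinuousOn f s) (c : ℝ)
    (h : ∀ x ∈ s, ∃ k : ℤ, f x = k * c) {x y : X} (hx : x ∈ s) (hy : y ∈ s) : f x = f y := by
  refine hs.constant_of_mapsTo (T := (AddSubgroup.zmultiples c : Set ℝ)) 
    ⟨inferInstanceAs (DiscreteTopology (AddSubgroup.zmultiples c))⟩ hf (fun z hz => ?_) hx hy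
  obtain ⟨k, hk⟩ := h z hz
  exact ⟨k, by simp [hk]⟩

theorem exists_int_of_cos_sin_eq {a b : ℝ} (hc : Real.cos a = Real.cos b)
    (hs : Real.sin a = Real.sin b) : ∃ k : ℤ, a - b = k * (2 * Real.pi) := by
  obtain ⟨k, hk⟩ := Real.Angle.angle_eq_iff_two_pi_dvd_sub.mp (Real.Angle.cos_sin_inj hc hs)
  exact ⟨k, by rw [hk]; ring⟩

theorem cos_sin_eq_of_smul_eq {r r' a b : ℝ} (hr : 0 < r) (hr' : 0 < r')
    (h : r • ![Real.cos a, Real.sin a] = r' • ![Real.cos b, Real.sin b]) :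
    r = r' ∧ Real.cos a = Real.cos b ∧ Real.sin a = Real.sin b := by
  have h0 : r * Real.cos a = r' * Real.cos b := by simpa using congrFun h 0
  have h1 : r * Real.sin a = r' * Real.sin b := by simpa using congrFun h 1
  have hrr : r = r' := by
    have ha := Real.cos_sq_add_sin_sq a
    have hb := Real.cos_sq_add_sin_sq b
    have : r ^ 2 = r' ^ 2 := by
      calc r ^ 2 = (r * Real.cos a) ^ 2 + (r * Real.sin a) ^ 2 := by linear_combination (-r ^ 2) * ha
        _ = (r' * Real.cos b) ^ 2 + (r' * Real.sin b) ^ 2 := by rw [h0, h1]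
        _ = r' ^ 2 := by linear_combination (r' ^ 2) * hb
    nlinarith
  subst hrr
  exact ⟨rfl, mul_left_cancel₀ hr.ne' h0, mul_left_cancel₀ hr.ne' h1⟩

namespace SL2Tilde

theorem mem_ray (a : SL2Tilde) (θ : ℝ) : ∃ r : ℝ, 0 < r ∧
    Matrix.mulVec a.mat ![Real.cos θ, Real.sin θ] =
      r • ![Real.cos (a.lift θ), Real.sin (a.lift θ)] := a.2.2 θ

theorem lift_add_pi (a : SL2Tilde) (θ : ℝ) : a.lift (θ + Real.pi) = a.lift θ + Real.pi := a.2.1 θ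

theorem lift_mul (a b : SL2Tilde) (θ : ℝ) : (a * b).lift θ = a.lift (b.lift θ) := rfl

theorem toSL_mul (a b : SL2Tilde) : (a * b).toSL = a.toSL * b.toSL := rfl

theorem toSL_inv (a : SL2Tilde) : (a⁻¹).toSL = a.toSL⁻¹ := rfl

theorem toSL_one : (1 : SL2Tilde).toSL = 1 := rfl

theorem continuous_lift (a : SL2Tilde) : Continuous a.lift := a.lift.continuous

/-- Both lifts describe the same map of rays, so at each angle they agree modulo `2π`. -/
theorem lift_sub_int {a b : SL2Tilde} (h : a.mat = b.mat) (θ : ℝ) :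
    ∃ k : ℤ, a.lift θ - b.lift θ = k * (2 * Real.pi) := by
  obtain ⟨r, hr, ha⟩ := a.mem_ray θ
  obtain ⟨r', hr', hb⟩ := b.mem_ray θ
  rw [h, hb] at ha
  obtain ⟨-, hc, hs⟩ := cos_sin_eq_of_smul_eq hr' hr ha
  exact exists_int_of_cos_sin_eq hc.symm hs.symm

/-- The difference of the lifts is continuous with values in `2πℤ`, hence constant. Identities in
the universal cover thus reduce to matrices and one angle. -/
theorem ext_of_lift_zero {a b : SL2Tilde} (h : a.mat = b.mat) (h0 : a.lift 0 = b.lift 0) :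
    a = b := by
  have key : ∀ θ, a.lift θ = b.lift θ := by
    intro θ
    have := eq_of_sub_mem_zmultiples isPreconnected_univ
      (f := fun θ => a.lift θ - b.lift θ)
      ((a.continuous_lift.sub b.continuous_lift).continuousOn) (2 * Real.pi)
      (fun θ _ => lift_sub_int h θ) (mem_univ θ) (mem_univ 0)
    simp only [h0, sub_self] at this
    linarith
  apply Subtype.ext
  apply Prod.ext
  · exact Subtype.ext h
  · exact RelIso.ext key

end SL2Tilde

/-- The rotation by `-t` and its lift. -/
def rot (t : ℝ) : SL2Tilde :=
  ⟨(⟨!![Real.cos t, Real.sin t; -Real.sin t, Real.cos t], by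
      rw [Matrix.det_fin_two_of]; nlinarith [Real.cos_sq_add_sin_sq t]⟩, OrderIso.addRight (-t)),
    fun θ => by simp only [OrderIso.addRight_apply]; ring,
    fun θ => ⟨1, one_pos, by
      ext i
      fin_cases i
      · simp [Matrix.mulVec, dotProduct, Fin.sum_univ_two, Real.cos_add]; ring
      · simp [Matrix.mulVec, dotProduct, Fin.sum_univ_two, Real.sin_add]; ring⟩⟩

theorem rot_mat (t : ℝ) :
    (rot t).mat = !![Real.cos t, Real.sin t; -Real.sin t, Real.cos t] := rfl

theorem rot_lift (t θ : ℝ) : (rot t).lift θ = θ - t := rfl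

theorem rot_add (s t : ℝ) : rot (s + t) = rot s * rot t := by
  apply SL2Tilde.ext_of_lift_zero
  · rw [mat_mul, rot_mat, rot_mat, rot_mat]
    ext i j
    fin_cases i <;> fin_cases j <;>
      simp [Matrix.mul_apply, Fin.sum_univ_two, Real.cos_add, Real.sin_add] <;> ring
  · simp only [SL2Tilde.lift_mul, rot_lift]; ring

theorem rot_zero : rot 0 = 1 := by
  apply SL2Tilde.ext_of_lift_zero
  · rw [rot_mat, mat_one, Matrix.one_fin_two]; simp
  · rw [rot_lift]; simp [SL2Tilde.lift]

theorem rot_neg (t : ℝ) : rot (-t) = (rot t)⁻¹ := by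
  rw [eq_inv_iff_mul_eq_one, ← rot_add, neg_add_cancel, rot_zero]

/-! ### The stabilizer of `i`. -/

theorem exists_cos_sin {a b : ℝ} (h : a ^ 2 + b ^ 2 = 1) :
    ∃ t, Real.cos t = a ∧ Real.sin t = b := by
  have hn : ‖(⟨a, b⟩ : ℂ)‖ = 1 := by
    rw [Complex.norm_def, Complex.normSq_mk, ← sq, ← sq, h, Real.sqrt_one]
  refine ⟨Complex.arg ⟨a, b⟩, ?_, ?_⟩
  · rw [Complex.cos_arg (by intro h0; simp [h0] at hn), hn, div_one]
  · rw [Complex.sin_arg, hn, div_one]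

theorem sl_smul_eq_iff (g : SL(2, ℝ)) (z w : ℍ) :
    g • z = w ↔ (g 0 0 : ℂ) * z + g 0 1 = w * (g 1 0 * z + g 1 1) := by
  rw [UpperHalfPlane.ext_iff, UpperHalfPlane.coe_specialLinearGroup_apply]
  have := UpperHalfPlane.denom_ne_zero g z
  simp only [Algebra.algebraMap_self, RingHom.id_apply]
  rw [div_eq_iff (by simpa [UpperHalfPlane.denom] using this)]

theorem sl_smul_I {g : SL(2, ℝ)} (h : g • UpperHalfPlane.I = UpperHalfPlane.I) :
    ∃ t, g.1 = !![Real.cos t, Real.sin t; -Real.sin t, Real.cos t] := by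
  rw [sl_smul_eq_iff] at h
  have hre := congrArg Complex.re h
  have him := congrArg Complex.im h
  simp at hre him
  have hd := g.det_coe
  rw [Matrix.det_fin_two] at hd
  obtain ⟨t, hc, hs⟩ := exists_cos_sin (a := g 0 0) (b := g 0 1) (by
    rw [him, hre] at *; nlinarith)
  refine ⟨t, ?_⟩
  ext i j
  fin_cases i <;> fin_cases j <;> simp [hc, hs] <;> linarith

theorem rot_smul_I (t : ℝ) : (rot t).toSL • UpperHalfPlane.I = UpperHalfPlane.I := by
  rw [sl_smul_eq_iff]
  have : ∀ i j, (rot t).toSL i j = !![Real.cos t, Real.sin t; -Real.sin t, Real.cos t] i j :=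
    fun i j => rfl
  simp only [this]
  apply Complex.ext <;> simp

/-- A matrix fixing `i` is a rotation whose angle is known modulo `2π`; the value of the lift at `0`
selects the angle. -/
theorem eq_rot_of_smul_I {a : SL2Tilde} (h : a.toSL • UpperHalfPlane.I = UpperHalfPlane.I) :
    a = rot (-a.lift 0) := by
  obtain ⟨t, ht⟩ := sl_smul_I h
  obtain ⟨k, hk⟩ := SL2Tilde.lift_sub_int (a := a) (b := rot t) ht 0
  apply SL2Tilde.ext_of_lift_zero
  · change a.mat = _ at ht
    rw [ht, rot_mat]
    have : -a.lift 0 = t - k * (2 * Real.pi) := by rw [rot_lift] at hk; linarith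
    rw [this, Real.cos_sub_int_mul_two_pi, Real.sin_sub_int_mul_two_pi]
  · rw [rot_lift]; ring

/-- The complex number whose argument is the angle by which `toSL2R x` turns the ray at `θ`. -/
def turn (x : ℍ) (θ : ℝ) : ℂ :=
  ⟨(√x.im * Real.cos θ + x.re / √x.im * Real.sin θ) * Real.cos θ +
      1 / √x.im * Real.sin θ * Real.sin θ,
    1 / √x.im * Real.sin θ * Real.cos θ -
      (√x.im * Real.cos θ + x.re / √x.im * Real.sin θ) * Real.sin θ⟩

/-- `turn x θ` is `e^{-iθ}` times the image of `e^{iθ}` under the matrix. Were it real and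
nonpositive, `e^{iθ}` would be an eigenvector with eigenvalue at most `0`, but the diagonal entries
of this triangular matrix are positive. -/
theorem turn_mem_slitPlane (x : ℍ) (θ : ℝ) : turn x θ ∈ Complex.slitPlane := by
  have ha : 0 < √x.im := Real.sqrt_pos.mpr x.im_pos
  have hcs := Real.cos_sq_add_sin_sq θ
  rw [Complex.mem_slitPlane_iff]
  by_contra hcon
  push Not at hcon
  obtain ⟨h1, h2⟩ := hcon
  simp only [turn] at h1 h2
  set a := √x.im
  set b := x.re / a
  set c := Real.cos θ
  set s := Real.sin θ
  rcases eq_or_ne s 0 with hs | hs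
  · rw [hs] at h1 hcs
    have : c ^ 2 = 1 := by linarith
    have h3 : a * c ^ 2 ≤ 0 := by linarith
    rw [this] at h3
    linarith
  · have h3 : a * c + b * s = 1 / a * c := by
      have : (a * c + b * s) * s = (1 / a * c) * s := by linarith
      exact mul_right_cancel₀ hs this
    rw [h3] at h1
    have h4 : 0 < 1 / a := by positivity
    have h5 : 1 / a * (c ^ 2 + s ^ 2) ≤ 0 := by linarith
    rw [hcs] at h5
    linarith

/-- The lift of the action of `toSL2R x` on rays which fixes `0`. -/
def triFun (x : ℍ) (θ : ℝ) : ℝ := θ + Complex.arg (turn x θ)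

/-- The argument never meets its branch cut. Continuity jointly in `x` is what later makes `tCoord`
continuous along curves whose base point varies. -/
theorem continuous_triFun : Continuous fun p : ℍ × ℝ => triFun p.1 p.2 := by
  refine continuous_snd.add (continuous_iff_continuousAt.mpr fun p => ?_)
  refine ContinuousAt.comp (f := fun p : ℍ × ℝ => turn p.1 p.2)
    (Complex.continuousAt_arg (turn_mem_slitPlane p.1 p.2)) ?_
  have h1 : Continuous fun p : ℍ × ℝ => √p.1.im :=
    (UpperHalfPlane.continuous_im.comp continuous_fst).sqrt
  have h2 : Continuous fun p : ℍ × ℝ => p.1.re := UpperHalfPlane.continuous_re.comp continuous_fst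
  have h3 : ∀ p : ℍ × ℝ, √p.1.im ≠ 0 := fun p => (Real.sqrt_pos.mpr p.1.im_pos).ne'
  have h4 : Continuous fun p : ℍ × ℝ => p.1.re / √p.1.im := h2.div h1 h3
  have h5 : Continuous fun p : ℍ × ℝ => 1 / √p.1.im := continuous_const.div h1 h3
  have : Continuous fun p : ℍ × ℝ => turn p.1 p.2 := by
    have := Complex.equivRealProdCLM.symm.continuous.comp
      (f := fun p : ℍ × ℝ => ((turn p.1 p.2).re, (turn p.1 p.2).im)) (by
        simp only [turn]
        fun_prop)
    convert! this using 1
  exact this.continuousAt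

theorem triFun_zero (x : ℍ) : triFun x 0 = 0 := by
  have : turn x 0 = (√x.im : ℝ) := by
    apply Complex.ext <;> simp [turn]
  rw [triFun, this, Complex.arg_ofReal_of_nonneg (Real.sqrt_nonneg _), add_zero]

theorem triFun_add_pi (x : ℍ) (θ : ℝ) : triFun x (θ + Real.pi) = triFun x θ + Real.pi := by
  have : turn x (θ + Real.pi) = turn x θ := by
    apply Complex.ext <;> simp [turn] <;> ring
  rw [triFun, triFun, this]; ring

theorem triFun_ray (x : ℍ) (θ : ℝ) : ∃ r : ℝ, 0 < r ∧
    Matrix.mulVec (x.toSL2R : Matrix (Fin 2) (Fin 2) ℝ) ![Real.cos θ, Real.sin θ] =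
      r • ![Real.cos (triFun x θ), Real.sin (triFun x θ)] := by
  refine ⟨‖turn x θ‖, norm_pos_iff.mpr (Complex.slitPlane_ne_zero (turn_mem_slitPlane x θ)), ?_⟩
  have h1 := Complex.norm_mul_cos_arg (turn x θ)
  have h2 := Complex.norm_mul_sin_arg (turn x θ)
  have hcs := Real.cos_sq_add_sin_sq θ
  ext i
  fin_cases i
  · simp [Matrix.mulVec, dotProduct, Fin.sum_univ_two, triFun, Real.cos_add]
    rw [mul_sub, mul_left_comm, h1, mul_left_comm, h2]
    simp only [turn]
    linear_combination (-(√x.im * Real.cos θ + x.re / √x.im * Real.sin θ)) * hcs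
  · simp [Matrix.mulVec, dotProduct, Fin.sum_univ_two, triFun, Real.sin_add]
    rw [mul_add, mul_left_comm, h1, mul_left_comm, h2]
    simp only [turn]
    linear_combination (-(√x.im)⁻¹ * Real.sin θ) * hcs

/-- The point whose upper triangular matrix is inverse to that of `x`. -/
def triInv (x : ℍ) : ℍ := ⟨⟨-x.re / x.im, 1 / x.im⟩, by simpa using x.im_pos⟩

theorem triInv_re (x : ℍ) : (triInv x).re = -x.re / x.im := rfl

theorem triInv_im (x : ℍ) : (triInv x).im = 1 / x.im := rfl

theorem continuous_triInv : Continuous triInv := by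
  rw [UpperHalfPlane.isEmbedding_coe.continuous_iff]
  have := Complex.equivRealProdCLM.symm.continuous.comp
      (f := fun x : ℍ => (-x.re / x.im, 1 / x.im))
      (((UpperHalfPlane.continuous_re.neg).div UpperHalfPlane.continuous_im
        (fun x => x.im_pos.ne')).prodMk
        (continuous_const.div UpperHalfPlane.continuous_im (fun x => x.im_pos.ne')))
  convert! this using 1

theorem triInv_triInv (x : ℍ) : triInv (triInv x) = x := by
  have := x.im_pos.ne'
  apply UpperHalfPlane.ext_re_im
  · rw [triInv_re, triInv_re, triInv_im]; field_simp
  · rw [triInv_im, triInv_im]; field_simp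

theorem toSL2R_triInv_mul (x : ℍ) : ((triInv x).toSL2R : Matrix (Fin 2) (Fin 2) ℝ) * x.toSL2R = 1 := by
  have hx := x.im_pos
  have ha : √x.im ≠ 0 := (Real.sqrt_pos.mpr hx).ne'
  have h2 : √x.im ^ 2 = x.im := Real.sq_sqrt hx.le
  rw [UpperHalfPlane.coe_toSL2R, UpperHalfPlane.coe_toSL2R, triInv_im, triInv_re,
    Real.sqrt_div zero_le_one, Real.sqrt_one, Matrix.one_fin_two, Matrix.mul_fin_two]
  ext i j
  fin_cases i <;> fin_cases j <;> simp <;> field_simp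
  rw [h2]; ring

/-- The composite lifts the identity matrix, so it differs from the identity by a continuous
function with values in `2πℤ`, which vanishes at `0`. -/
theorem triFun_triInv (x : ℍ) (θ : ℝ) : triFun (triInv x) (triFun x θ) = θ := by
  have hint : ∀ θ, ∃ k : ℤ, triFun (triInv x) (triFun x θ) - θ = k * (2 * Real.pi) := by
    intro θ
    obtain ⟨r, hr, h⟩ := triFun_ray x θ
    obtain ⟨r', hr', h'⟩ := triFun_ray (triInv x) (triFun x θ)
    have h3 := congrArg (Matrix.mulVec ((triInv x).toSL2R : Matrix (Fin 2) (Fin 2) ℝ)) h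
    rw [Matrix.mulVec_mulVec, toSL2R_triInv_mul, Matrix.one_mulVec, Matrix.mulVec_smul, h',
      smul_smul] at h3
    have h4 : (1 : ℝ) • ![Real.cos θ, Real.sin θ] = (r * r') •
      ![Real.cos (triFun (triInv x) (triFun x θ)), Real.sin (triFun (triInv x) (triFun x θ))] := by
      rw [one_smul, h3]
    obtain ⟨-, hc, hs⟩ := cos_sin_eq_of_smul_eq one_pos (mul_pos hr hr') h4
    exact exists_int_of_cos_sin_eq hc.symm hs.symm
  have hc : Continuous fun θ => triFun (triInv x) (triFun x θ) - θ := by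
    have h1 : ∀ y : ℍ, Continuous (triFun y) := fun y =>
      continuous_triFun.comp (continuous_const.prodMk continuous_id)
    exact ((h1 _).comp (h1 _)).sub continuous_id
  have := eq_of_sub_mem_zmultiples isPreconnected_univ hc.continuousOn (2 * Real.pi)
      (fun θ _ => hint θ) (mem_univ θ) (mem_univ 0)
  rw [triFun_zero, triFun_zero] at this
  linarith

/-- A continuous injection of the line is strictly monotone or antitone, and commuting with
translation by `π` excludes the second case. -/
theorem strictMono_triFun (x : ℍ) : StrictMono (triFun x) := by
  have hinj : Function.Injective (triFun x) := fun a b h => by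
    rw [← triFun_triInv x a, h, triFun_triInv]
  have h1 : Continuous (triFun x) := continuous_triFun.comp (continuous_const.prodMk continuous_id)
  rcases h1.strictMono_of_inj hinj with h | h
  · exact h
  · have h2 := h Real.pi_pos
    have h3 := triFun_add_pi x 0
    rw [zero_add] at h3
    rw [h3] at h2
    linarith [Real.pi_pos]

/-- The lift of `toSL2R x` to the universal cover which fixes the ray at `0`. -/
def tri (x : ℍ) : SL2Tilde :=
  ⟨(x.toSL2R, (strictMono_triFun x).orderIsoOfRightInverse (triFun x) (triFun (triInv x))
    (fun θ => by
      have := triFun_triInv (triInv x) θ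
      rwa [triInv_triInv] at this)), triFun_add_pi x, triFun_ray x⟩

theorem tri_lift (x : ℍ) (θ : ℝ) : (tri x).lift θ = triFun x θ := rfl

theorem tri_inv_lift (x : ℍ) (θ : ℝ) : ((tri x)⁻¹).lift θ = triFun (triInv x) θ := rfl

theorem tri_toSL (x : ℍ) : (tri x).toSL = x.toSL2R := rfl

theorem tri_mat (x : ℍ) : (tri x).mat = !![√x.im, x.re / √x.im; 0, 1 / √x.im] := rfl

theorem tri_invMat (x : ℍ) : (tri x).invMat = !![1 / √x.im, -(x.re / √x.im); 0, √x.im] := by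
  have : (tri x).invMat = Matrix.adjugate (tri x).mat := Matrix.SpecialLinearGroup.coe_inv _
  rw [this, tri_mat, Matrix.adjugate_fin_two_of, neg_zero]

theorem tri_smul_I (x : ℍ) : (tri x).toSL • UpperHalfPlane.I = x := UpperHalfPlane.toSL2R_smul_I x

theorem tri_inv_smul (x : ℍ) : ((tri x)⁻¹).toSL • x = UpperHalfPlane.I := by
  rw [SL2Tilde.toSL_inv, inv_smul_eq_iff, tri_smul_I]

/-- This is the Iwasawa decomposition: every matrix is a triangular factor times a rotation, and
both factors have explicit lifts. -/
theorem toSL_surjective : Function.Surjective SL2Tilde.toSL := by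
  intro g
  have h1 : ((g • UpperHalfPlane.I).toSL2R⁻¹ * g) • UpperHalfPlane.I = UpperHalfPlane.I := by
    rw [mul_smul, inv_smul_eq_iff, UpperHalfPlane.toSL2R_smul_I]
  obtain ⟨t, ht⟩ := sl_smul_I h1
  refine ⟨tri (g • UpperHalfPlane.I) * rot t, ?_⟩
  rw [SL2Tilde.toSL_mul, tri_toSL]
  have : (rot t).toSL = (g • UpperHalfPlane.I).toSL2R⁻¹ * g := Subtype.ext ht.symm
  rw [this, mul_inv_cancel_left]

theorem toPSL_surjective : Function.Surjective toPSL := by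
  intro g
  obtain ⟨g, rfl⟩ := QuotientGroup.mk_surjective g
  obtain ⟨a, rfl⟩ := toSL_surjective g
  exact ⟨a, rfl⟩

theorem pslAct_toPSL (a : SL2Tilde) (z : ℍ) : pslAct (toPSL a) z = a.toSL • z := rfl

/-! ## Coordinates on the unit tangent bundle -/

theorem pairSMul_pt (a : SL2Tilde × SL2Tilde) (v : UnitTangent) :
    (a • v).pt = a.1 * v.pt * a.2⁻¹ := rfl

theorem pairSMul_vec (a : SL2Tilde × SL2Tilde) (v : UnitTangent) :
    (a • v).vec = a.1.mat * v.vec * a.2.invMat := rfl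

theorem mat_mul_invMat (a : SL2Tilde) : a.mat * a.invMat = 1 := by
  rw [invMat_eq, ← mat_mul, mul_inv_cancel, mat_one]

/-- The left-translated direction `γ⁻¹ u` of a unit tangent vector `(γ, u)`. -/
def UnitTangent.dir (v : UnitTangent) : Matrix (Fin 2) (Fin 2) ℝ := v.pt.invMat * v.vec

theorem UnitTangent.mat_mul_dir (v : UnitTangent) : v.pt.mat * v.dir = v.vec := by
  rw [UnitTangent.dir, ← Matrix.mul_assoc, mat_mul_invMat, Matrix.one_mul]

theorem dir_smul (a : SL2Tilde × SL2Tilde) (v : UnitTangent) :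
    (a • v).dir = a.2.mat * v.dir * a.2.invMat := translate_aux a.1 a.2 v.pt v.vec

theorem UnitTangent.dir_one_one (v : UnitTangent) : v.dir 1 1 = -v.dir 0 0 := by
  have := v.tangent
  rw [Matrix.trace_fin_two] at this
  change v.dir 0 0 + v.dir 1 1 = 0 at this
  linarith

theorem UnitTangent.dir_sq_add (v : UnitTangent) :
    v.dir 0 0 ^ 2 + v.dir 0 1 * v.dir 1 0 = -1 := by
  have h := v.unit
  change 1 / 8 * (4 * Matrix.trace (v.dir * v.dir)) = -1 at h
  rw [Matrix.trace_fin_two, Matrix.mul_apply, Matrix.mul_apply, Fin.sum_univ_two,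
    Fin.sum_univ_two, v.dir_one_one] at h
  linarith

theorem UnitTangent.dir_mul_dir (v : UnitTangent) : v.dir * v.dir = -1 := by
  have h := v.dir_sq_add
  have h1 := v.dir_one_one
  ext i j
  fin_cases i <;> fin_cases j <;> simp [Matrix.mul_apply, Fin.sum_univ_two, h1] <;> linarith

theorem UnitTangent.dir_neg (v : UnitTangent) : v.dir 1 0 < 0 := v.future

/-- The generator of the rotations about `i`. -/
def rotGen : Matrix (Fin 2) (Fin 2) ℝ := !![0, 1; -1, 0]

/-- The unit tangent vector of the geodesic `t ↦ rot t`. -/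
def fiberVec (t : ℝ) : UnitTangent where
  pt := rot t
  vec := (rot t).mat * rotGen
  tangent := by
    rw [← Matrix.mul_assoc, invMat_mul_mat, Matrix.one_mul]; simp [rotGen]
  unit := by
    have h : (rot t).invMat * ((rot t).mat * rotGen) = rotGen := by
      rw [← Matrix.mul_assoc, invMat_mul_mat, Matrix.one_mul]
    rw [adsMetric, h]; simp [rotGen]; norm_num
  future := by
    rw [← Matrix.mul_assoc, invMat_mul_mat, Matrix.one_mul]; simp [rotGen]

theorem fiberVec_dir (t : ℝ) : (fiberVec t).dir = rotGen := by
  change (rot t).invMat * ((rot t).mat * rotGen) = rotGen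
  rw [← Matrix.mul_assoc, invMat_mul_mat, Matrix.one_mul]

theorem UnitTangent.ext_of_dir {v w : UnitTangent} (h : v.pt = w.pt) (h' : v.dir = w.dir) :
    v = w := by
  ext1
  · exact h
  · rw [← v.mat_mul_dir, h, h', w.mat_mul_dir]

theorem rotGen_comm (k : ℝ) : (rot k).mat * rotGen * (rot k).invMat = rotGen := by
  have h : (rot k).mat * rotGen = rotGen * (rot k).mat := by
    rw [rot_mat, rotGen, Matrix.mul_fin_two, Matrix.mul_fin_two]; simp
  rw [h, Matrix.mul_assoc, mat_mul_invMat, Matrix.mul_one]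

theorem rot_smul_fiberVec (k l t : ℝ) :
    ((rot k, rot l) : SL2Tilde × SL2Tilde) • fiberVec t = fiberVec (t + k - l) := by
  apply UnitTangent.ext_of_dir
  · rw [pairSMul_pt]
    change rot k * rot t * (rot l)⁻¹ = rot (t + k - l)
    rw [← rot_neg, ← rot_add, ← rot_add]
    congr 1; ring
  · rw [dir_smul, fiberVec_dir, fiberVec_dir]; exact rotGen_comm l

/-- The unit tangent vector with coordinates `(x, y, t)`. -/
def frame (x y : ℍ) (t : ℝ) : UnitTangent := ((tri x, tri y) : SL2Tilde × SL2Tilde) • fiberVec t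

theorem frame_dir (x y : ℍ) (t : ℝ) :
    (frame x y t).dir = !![-(y.re / y.im), y.re ^ 2 / y.im + y.im; -(1 / y.im), y.re / y.im] := by
  have hy := y.im_pos
  have h0 : √y.im ≠ 0 := (Real.sqrt_pos.mpr hy).ne'
  have h2 : √y.im ^ 2 = y.im := Real.sq_sqrt hy.le
  have h3 : √y.im * √y.im = y.im := Real.mul_self_sqrt hy.le
  rw [frame, dir_smul, fiberVec_dir, tri_mat, tri_invMat, rotGen, Matrix.mul_fin_two,
    Matrix.mul_fin_two]
  ext i j
  fin_cases i <;> fin_cases j <;> simp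
  · rw [div_eq_mul_inv, mul_assoc, ← mul_inv, h3]; rfl
  · rw [h3]; congr 1; field_simp; rw [h2]
  · rw [← mul_inv, h3]
  · rw [div_eq_mul_inv, mul_left_comm, ← mul_inv, h3]; rfl

/-- The fixed point of the rotations generated by the direction. -/
def yCoord (v : UnitTangent) : ℍ :=
  ⟨⟨v.dir 0 0 / v.dir 1 0, -1 / v.dir 1 0⟩, div_pos_of_neg_of_neg (by norm_num) v.dir_neg⟩

/-- The image of the fixed point of the rotations generated by the direction. -/
def xCoord (v : UnitTangent) : ℍ := v.pt.toSL • yCoord v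

/-- The position on the fiber. -/
def tCoord (v : UnitTangent) : ℝ := -((tri (xCoord v))⁻¹ * v.pt * tri (yCoord v)).lift 0

theorem yCoord_frame (x y : ℍ) (t : ℝ) : yCoord (frame x y t) = y := by
  have hy := y.im_pos.ne'
  apply UpperHalfPlane.ext_re_im
  · change (frame x y t).dir 0 0 / (frame x y t).dir 1 0 = _
    rw [frame_dir]; simp; field_simp
  · change -1 / (frame x y t).dir 1 0 = _
    rw [frame_dir]; simp

theorem frame_pt (x y : ℍ) (t : ℝ) : (frame x y t).pt = tri x * rot t * (tri y)⁻¹ := rfl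

theorem xCoord_frame (x y : ℍ) (t : ℝ) : xCoord (frame x y t) = x := by
  rw [xCoord, yCoord_frame, frame_pt, SL2Tilde.toSL_mul, SL2Tilde.toSL_mul, mul_smul,
    tri_inv_smul, mul_smul, rot_smul_I, tri_smul_I]

theorem tCoord_frame (x y : ℍ) (t : ℝ) : tCoord (frame x y t) = t := by
  rw [tCoord, yCoord_frame, xCoord_frame, frame_pt]
  have : (tri x)⁻¹ * (tri x * rot t * (tri y)⁻¹) * tri y = rot t := by group
  rw [this, rot_lift]; ring

/-- The imaginary part gives the lower left entry, the real part then gives the diagonal, and the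
relation expressing that the square is `-1` gives the remaining entry. -/
theorem dir_eq_of_yCoord_eq {v w : UnitTangent} (h : yCoord v = yCoord w) : v.dir = w.dir := by
  have h1 : v.dir 0 0 / v.dir 1 0 = w.dir 0 0 / w.dir 1 0 := congrArg UpperHalfPlane.re h
  have h2 : -1 / v.dir 1 0 = -1 / w.dir 1 0 := congrArg UpperHalfPlane.im h
  have hv := v.dir_neg.ne
  have hw := w.dir_neg.ne
  have e10 : v.dir 1 0 = w.dir 1 0 := by
    rw [div_eq_div_iff hv hw] at h2; linarith
  have e00 : v.dir 0 0 = w.dir 0 0 := by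
    rw [e10] at h1; exact (div_left_inj' hw).mp h1
  have e01 : v.dir 0 1 = w.dir 0 1 := by
    have h3 := v.dir_sq_add
    have h4 := w.dir_sq_add
    rw [e10, e00] at h3
    exact mul_right_cancel₀ hw (by linarith)
  have e11 : v.dir 1 1 = w.dir 1 1 := by rw [v.dir_one_one, w.dir_one_one, e00]
  ext i j
  fin_cases i <;> fin_cases j <;> assumption

/-- The element `(tri x)⁻¹ * γ * tri y` fixes `i`, so it is a rotation, and `tCoord` is by
definition its angle. -/
theorem frame_coords (v : UnitTangent) : frame (xCoord v) (yCoord v) (tCoord v) = v := by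
  apply UnitTangent.ext_of_dir
  · have : (tri (xCoord v))⁻¹ * v.pt * tri (yCoord v) = rot (tCoord v) := by
      apply eq_rot_of_smul_I
      rw [SL2Tilde.toSL_mul, SL2Tilde.toSL_mul, mul_smul, tri_smul_I, mul_smul]
      exact tri_inv_smul (xCoord v)
    rw [frame_pt, ← this]; group
  · exact dir_eq_of_yCoord_eq (yCoord_frame _ _ _)

/-- Both `α * tri z` and `tri (α z)` take `i` to `α z`, so they differ by a rotation on the right.
The two rotations so obtained act on the fiber through the difference of their angles, independently
of `t`. -/
theorem exists_frame_smul (a : SL2Tilde × SL2Tilde) (x y : ℍ) : ∃ κ : ℝ, ∀ t,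
    a • frame x y t = frame (a.1.toSL • x) (a.2.toSL • y) (t + κ) := by
  have key : ∀ (α : SL2Tilde) (z : ℍ), ∃ k, α * tri z = tri (α.toSL • z) * rot k := by
    intro α z
    have h := eq_rot_of_smul_I (a := (tri (α.toSL • z))⁻¹ * α * tri z) (by
      rw [SL2Tilde.toSL_mul, SL2Tilde.toSL_mul, mul_smul, tri_smul_I, mul_smul]
      exact tri_inv_smul _)
    exact ⟨_, by rw [← h]; group⟩
  obtain ⟨k, hk⟩ := key a.1 x
  obtain ⟨l, hl⟩ := key a.2 y
  refine ⟨k - l, fun t => ?_⟩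
  rw [← add_sub_assoc, frame, frame, ← rot_smul_fiberVec, smul_smul, smul_smul]
  congr 1
  exact Prod.ext hk hl

/-- The translation of the fiber coordinate by an isometry, at the fiber over `(x, y)`. -/
def shift (a : SL2Tilde × SL2Tilde) (x y : ℍ) : ℝ := (exists_frame_smul a x y).choose

theorem smul_frame (a : SL2Tilde × SL2Tilde) (x y : ℍ) (t : ℝ) :
    a • frame x y t = frame (a.1.toSL • x) (a.2.toSL • y) (t + shift a x y) :=
  (exists_frame_smul a x y).choose_spec t

theorem xCoord_smul (a : SL2Tilde × SL2Tilde) (v : UnitTangent) :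
    xCoord (a • v) = a.1.toSL • xCoord v := by
  conv_lhs => rw [← frame_coords v, smul_frame, xCoord_frame]

theorem yCoord_smul (a : SL2Tilde × SL2Tilde) (v : UnitTangent) :
    yCoord (a • v) = a.2.toSL • yCoord v := by
  conv_lhs => rw [← frame_coords v, smul_frame, yCoord_frame]

theorem tCoord_smul (a : SL2Tilde × SL2Tilde) (v : UnitTangent) :
    tCoord (a • v) = tCoord v + shift a (xCoord v) (yCoord v) := by
  conv_lhs => rw [← frame_coords v, smul_frame, tCoord_frame]

/-! ## The geodesic flow in coordinates -/

theorem frame_mat (x y : ℍ) (t : ℝ) :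
    (frame x y t).pt.mat = (tri x).mat * (rot t).mat * (tri y).invMat := rfl

theorem frame_vec (x y : ℍ) (t : ℝ) :
    (frame x y t).vec = (tri x).mat * ((rot t).mat * rotGen) * (tri y).invMat := rfl

theorem hasDerivAt_conj_rot (A B : Matrix (Fin 2) (Fin 2) ℝ) (t s : ℝ) (i j : Fin 2) :
    HasDerivAt (fun s => (A * (rot (t + s)).mat * B) i j)
      ((A * ((rot (t + s)).mat * rotGen) * B) i j) s := by
  have hc : HasDerivAt (fun s => Real.cos (t + s)) (-Real.sin (t + s)) s := by
    simpa using (Real.hasDerivAt_cos (t + s)).comp_const_add t s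
  have hs : HasDerivAt (fun s => Real.sin (t + s)) (Real.cos (t + s)) s := by
    simpa using (Real.hasDerivAt_sin (t + s)).comp_const_add t s
  simp only [Matrix.mul_apply, Fin.sum_univ_two, rot_mat, rotGen]
  simp only [Matrix.of_apply, Matrix.cons_val', Matrix.cons_val_zero, Matrix.cons_val_one,
    Matrix.cons_val_fin_one]
  convert! (((hc.const_mul (A i 0)).add ((hs.neg).const_mul (A i 1))).mul_const (B 0 j)).add
    (((hs.const_mul (A i 0)).add (hc.const_mul (A i 1))).mul_const (B 1 j)) using 1
  ring

theorem contDiff_conj_rot (A B : Matrix (Fin 2) (Fin 2) ℝ) (t : ℝ) (i j : Fin 2) :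
    ContDiff ℝ ∞ fun s => (A * (rot (t + s)).mat * B) i j := by
  have hc : ContDiff ℝ ∞ fun s => Real.cos (t + s) := Real.contDiff_cos.comp (contDiff_const.add contDiff_id)
  have hs : ContDiff ℝ ∞ fun s => Real.sin (t + s) := Real.contDiff_sin.comp (contDiff_const.add contDiff_id)
  simp only [Matrix.mul_apply, Fin.sum_univ_two, rot_mat]
  simp only [Matrix.of_apply, Matrix.cons_val', Matrix.cons_val_zero, Matrix.cons_val_one,
    Matrix.cons_val_fin_one]
  fun_prop

theorem conj_rot_rotGen (A B : Matrix (Fin 2) (Fin 2) ℝ) (t : ℝ) :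
    A * ((rot t).mat * rotGen) * B = A * (rot t).mat * (rotGen * B) := by
  simp only [Matrix.mul_assoc]

theorem rotGen_mul_rotGen : rotGen * rotGen = -1 := by
  rw [rotGen, Matrix.mul_fin_two]
  ext i j
  fin_cases i <;> fin_cases j <;> simp

/-- Since `γ⁻¹ u` squares to `-1`, the geodesic equation `u' = u γ⁻¹ u` reads `u' = -γ`, and
rotations solve it. -/
theorem isGeodesic_frame (x y : ℍ) (t : ℝ) : IsGeodesic fun s => frame x y (t + s) := by
  have hd1 := fun s i j => hasDerivAt_conj_rot (tri x).mat (tri y).invMat t s i j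
  have hd2 := fun s i j => hasDerivAt_conj_rot (tri x).mat (rotGen * (tri y).invMat) t s i j
  refine ⟨⟨fun i j => ?_, fun i j => ?_, ?_⟩, fun s => ?_⟩
  · simp only [frame_mat]
    exact (contDiff_conj_rot _ _ t i j).contDiffOn
  · simp only [frame_vec, conj_rot_rotGen]
    exact (contDiff_conj_rot _ _ t i j).contDiffOn
  · have : (fun s => (frame x y (t + s)).pt.lift 0) =
        fun s => triFun x (((tri y)⁻¹).lift 0 - (t + s)) := by
      funext s
      rw [frame_pt, SL2Tilde.lift_mul, SL2Tilde.lift_mul, rot_lift, tri_lift]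
    rw [this]
    exact (continuous_triFun.comp (by fun_prop : Continuous fun s : ℝ =>
      (x, ((tri y)⁻¹).lift 0 - (t + s)))).continuousOn
  · have h1 : (velocity (fun s => frame x y (t + s)) univ s).1 = (frame x y (t + s)).vec := by
      ext i j
      change derivWithin (fun s => (frame x y (t + s)).pt.mat i j) univ s = _
      rw [derivWithin_univ]
      exact (hd1 s i j).deriv
    have h2 : (velocity (fun s => frame x y (t + s)) univ s).2 = -(frame x y (t + s)).pt.mat := by
      ext i j
      change derivWithin (fun s => (frame x y (t + s)).vec i j) univ s = _
      simp only [frame_vec, conj_rot_rotGen]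
      rw [derivWithin_univ, (hd2 s i j).deriv, frame_mat]
      have : (tri x).mat * ((rot (t + s)).mat * rotGen) * (rotGen * (tri y).invMat) =
          -((tri x).mat * (rot (t + s)).mat * (tri y).invMat) := by
        calc _ = (tri x).mat * (rot (t + s)).mat * (rotGen * rotGen) * (tri y).invMat := by
              simp only [Matrix.mul_assoc]
          _ = _ := by rw [rotGen_mul_rotGen]; simp
      rw [this]
    refine ⟨h1, ?_⟩
    set v := frame x y (t + s)
    rw [vertPart, h1, h2, covDeriv]
    change -v.pt.mat - v.vec * v.dir + (1 / 2 : ℝ) • (v.pt.mat * (v.dir * v.dir - v.dir * v.dir)) = 0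
    rw [sub_self, Matrix.mul_zero, smul_zero, add_zero, ← v.mat_mul_dir, Matrix.mul_assoc,
      v.dir_mul_dir]
    simp

/-- When the velocity is `u` itself, the bracket in `covDeriv` vanishes, and the geodesic equation
becomes the linear system `γ' = u`, `u' = -γ` for each matrix entry. -/
theorem IsGeodesic.hasDerivAt {c : ℝ → UnitTangent} (hc : IsGeodesic c) (s : ℝ) (i j : Fin 2) :
    HasDerivAt (fun s => (c s).pt.mat i j) ((c s).vec i j) s ∧
    HasDerivAt (fun s => (c s).vec i j) (-(c s).pt.mat i j) s := by
  obtain ⟨⟨h1, h2, -⟩, h⟩ := hc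
  obtain ⟨hv, hv'⟩ := h s
  have d1 : DifferentiableAt ℝ (fun s => (c s).pt.mat i j) s :=
    ((contDiffOn_univ.mp (h1 i j)).differentiable (by simp)).differentiableAt
  have d2 : DifferentiableAt ℝ (fun s => (c s).vec i j) s :=
    ((contDiffOn_univ.mp (h2 i j)).differentiable (by simp)).differentiableAt
  have e2 : (velocity c univ s).2 = -(c s).pt.mat := by
    rw [vertPart, covDeriv, hv] at hv'
    change (velocity c univ s).2 - (c s).vec * (c s).dir +
      (1 / 2 : ℝ) • ((c s).pt.mat * ((c s).dir * (c s).dir - (c s).dir * (c s).dir)) = 0 at hv'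
    rw [sub_self, Matrix.mul_zero, smul_zero, add_zero, ← (c s).mat_mul_dir, Matrix.mul_assoc,
      (c s).dir_mul_dir, sub_eq_zero] at hv'
    rw [hv']; simp
  constructor
  · have e : deriv (fun s => (c s).pt.mat i j) s = (c s).vec i j := by
      rw [← hv, ← derivWithin_univ]; rfl
    exact e ▸ d1.hasDerivAt
  · have e : deriv (fun s => (c s).vec i j) s = -(c s).pt.mat i j := by
      rw [← derivWithin_univ]
      exact congrFun (congrFun e2 i) j
    exact e ▸ d2.hasDerivAt

theorem eq_cos_sin_of_hasDerivAt {g u : ℝ → ℝ} (hg : ∀ s, HasDerivAt g (u s) s)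
    (hu : ∀ s, HasDerivAt u (-g s) s) (s : ℝ) :
    g s = g 0 * Real.cos s + u 0 * Real.sin s ∧ u s = u 0 * Real.cos s - g 0 * Real.sin s := by
  -- Rotating `(g, u)` back by the angle `s` gives two first integrals, from which `g` and `u` are
  -- recovered.
  have h1 : ∀ s, HasDerivAt (fun s => g s * Real.cos s - u s * Real.sin s) 0 s := fun s => by
    convert! ((hg s).mul (Real.hasDerivAt_cos s)).sub ((hu s).mul (Real.hasDerivAt_sin s)) using 1
    ring
  have h2 : ∀ s, HasDerivAt (fun s => g s * Real.sin s + u s * Real.cos s) 0 s := fun s => by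
    convert! ((hg s).mul (Real.hasDerivAt_sin s)).add ((hu s).mul (Real.hasDerivAt_cos s)) using 1
    ring
  have e1 := is_const_of_deriv_eq_zero (fun s => (h1 s).differentiableAt) (fun s => (h1 s).deriv) s 0
  have e2 := is_const_of_deriv_eq_zero (fun s => (h2 s).differentiableAt) (fun s => (h2 s).deriv) s 0
  simp only [Real.cos_zero, Real.sin_zero, mul_one, mul_zero, sub_zero, zero_add] at e1 e2
  have hcs := Real.cos_sq_add_sin_sq s
  constructor
  · linear_combination Real.cos s * e1 + Real.sin s * e2 - g s * hcs
  · linear_combination -Real.sin s * e1 + Real.cos s * e2 - u s * hcs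

theorem IsGeodesic.unique {c c' : ℝ → UnitTangent} (hc : IsGeodesic c) (hc' : IsGeodesic c')
    (h0 : c 0 = c' 0) : c = c' := by
  have hm : ∀ s, (c s).pt.mat = (c' s).pt.mat := fun s => by
    ext i j
    rw [(eq_cos_sin_of_hasDerivAt (fun s => (hc.hasDerivAt s i j).1)
      (fun s => (hc.hasDerivAt s i j).2) s).1, (eq_cos_sin_of_hasDerivAt
      (fun s => (hc'.hasDerivAt s i j).1) (fun s => (hc'.hasDerivAt s i j).2) s).1, h0]
  have hv : ∀ s, (c s).vec = (c' s).vec := fun s => by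
    ext i j
    rw [(eq_cos_sin_of_hasDerivAt (fun s => (hc.hasDerivAt s i j).1)
      (fun s => (hc.hasDerivAt s i j).2) s).2, (eq_cos_sin_of_hasDerivAt
      (fun s => (hc'.hasDerivAt s i j).1) (fun s => (hc'.hasDerivAt s i j).2) s).2, h0]
  funext s
  ext1
  · apply SL2Tilde.ext_of_lift_zero (hm s)
    -- Equal matrices leave an ambiguity of `2πℤ` in the lift at `0`, removed by continuity and the
    -- common initial vector.
    have := eq_of_sub_mem_zmultiples isPreconnected_univ (hc.1.2.2.sub hc'.1.2.2) (2 * Real.pi)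
      (fun s _ => SL2Tilde.lift_sub_int (hm s) 0) (mem_univ s) (mem_univ 0)
    simp only [Pi.sub_apply, h0, sub_self] at this
    linarith
  · exact hv s

theorem isGeodesic_iff {c : ℝ → UnitTangent} {v : UnitTangent} :
    IsGeodesic c ∧ c 0 = v ↔ c = fun s => frame (xCoord v) (yCoord v) (tCoord v + s) := by
  constructor
  · rintro ⟨hc, h0⟩
    refine hc.unique (isGeodesic_frame _ _ _) ?_
    rw [add_zero, frame_coords, h0]
  · rintro rfl
    exact ⟨isGeodesic_frame _ _ _, by simp only [add_zero, frame_coords]⟩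

theorem geodesicFlow_iff {s : ℝ} {v w : UnitTangent} :
    GeodesicFlow s v w ↔ w = frame (xCoord v) (yCoord v) (tCoord v + s) := by
  constructor
  · rintro ⟨c, hc, h0, rfl⟩
    exact congrFun (isGeodesic_iff.mp ⟨hc, h0⟩) s
  · rintro rfl
    obtain ⟨h, h0⟩ := isGeodesic_iff.mpr (Eq.refl fun s => frame (xCoord v) (yCoord v) (tCoord v + s))
    exact ⟨_, h, h0, rfl⟩

theorem projectsTo_iff {v : UnitTangent} {p : ℍ × ℍ} :
    ProjectsTo v p ↔ xCoord v = p.1 ∧ yCoord v = p.2 := by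
  obtain ⟨x, y⟩ := p
  constructor
  · rintro ⟨c, hc, h0, hr⟩
    rw [isGeodesic_iff.mp ⟨hc, h0⟩] at hr
    have hmem : ∀ s, (tri (xCoord v) * rot s * (tri (yCoord v))⁻¹).toSL • y = x := by
      intro s
      have : toPSL (frame (xCoord v) (yCoord v) (tCoord v + (s - tCoord v))).pt ∈ timelikeLine x y :=
        hr ▸ mem_range_self (s - tCoord v)
      rw [add_sub_cancel] at this
      exact this
    have hrot : ∀ s, (rot s).toSL • ((tri (yCoord v))⁻¹).toSL • y = ((tri (xCoord v))⁻¹).toSL • x := by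
      intro s
      have := hmem s
      rw [SL2Tilde.toSL_mul, SL2Tilde.toSL_mul, mul_smul, mul_smul] at this
      rw [SL2Tilde.toSL_inv (tri (xCoord v)), eq_inv_smul_iff]
      exact this
    have h1 := hrot 0
    -- The parameters `0` and `π / 2` suffice: the quarter turn acts as `z ↦ -1 / z`, whose only
    -- fixed point in `ℍ` is `i`.
    have h2 := hrot (Real.pi / 2)
    rw [rot_zero, SL2Tilde.toSL_one, one_smul] at h1
    rw [← h1] at h2
    set z := ((tri (yCoord v))⁻¹).toSL • y with hz
    have hzI : z = UpperHalfPlane.I := by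
      rw [sl_smul_eq_iff] at h2
      have he : ∀ i j, (rot (Real.pi / 2)).toSL i j = !![Real.cos (Real.pi / 2), Real.sin (Real.pi / 2);
        -Real.sin (Real.pi / 2), Real.cos (Real.pi / 2)] i j := fun i j => rfl
      simp only [he] at h2
      have hre := congrArg Complex.re h2
      have him := congrArg Complex.im h2
      simp at hre him
      have hp := z.im_pos
      have hr0 : z.re = 0 := by
        have : z.re * z.im = 0 := by linarith
        rcases mul_eq_zero.mp this with h | h
        · exact h
        · exact absurd h hp.ne'
      apply UpperHalfPlane.ext_re_im
      · simpa using hr0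
      · rw [hr0] at hre
        rw [UpperHalfPlane.I_im]
        nlinarith
    constructor
    · rw [hzI, SL2Tilde.toSL_inv, eq_inv_smul_iff, tri_smul_I] at h1
      exact h1
    · rw [hzI, SL2Tilde.toSL_inv, eq_comm, inv_smul_eq_iff, tri_smul_I] at hz
      exact hz.symm
  · rintro ⟨rfl, rfl⟩
    obtain ⟨h, h0⟩ := isGeodesic_iff.mpr (Eq.refl fun s => frame (xCoord v) (yCoord v) (tCoord v + s))
    refine ⟨_, h, h0, Subset.antisymm ?_ ?_⟩
    · rintro _ ⟨s, rfl⟩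
      change (tri (xCoord v) * rot _ * (tri (yCoord v))⁻¹).toSL • yCoord v = xCoord v
      rw [SL2Tilde.toSL_mul, SL2Tilde.toSL_mul, mul_smul, tri_inv_smul, mul_smul, rot_smul_I,
        tri_smul_I]
    · intro g hg
      obtain ⟨a, rfl⟩ := toPSL_surjective g
      change a.toSL • yCoord v = xCoord v at hg
      -- Once both points are moved to `i`, an element taking `y` to `x` is a rotation, hence lies
      -- on the geodesic.
      have := eq_rot_of_smul_I (a := (tri (xCoord v))⁻¹ * a * tri (yCoord v)) (by
        rw [SL2Tilde.toSL_mul, SL2Tilde.toSL_mul, mul_smul, tri_smul_I, mul_smul, hg]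
        exact tri_inv_smul _)
      generalize -((tri (xCoord v))⁻¹ * a * tri (yCoord v)).lift 0 = k at this
      refine ⟨k - tCoord v, ?_⟩
      simp only [add_sub_cancel]
      rw [frame_pt, ← this]
      congr 1; group

/-! ## The connection form in coordinates -/

/-- The base point of a unit tangent vector. -/
def proj (v : UnitTangent) : ℍ × ℍ := (xCoord v, yCoord v)

/-- The inclusion of `ℍ × ℍ` in `ℂ × ℂ`. -/
def toC (p : ℍ × ℍ) : ℂ × ℂ := ((p.1 : ℂ), (p.2 : ℂ))

/-- The primitive `(dx₁ / x₂ - dy₁ / y₂) / 2` of the curvature. -/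
def eta (p : ℂ × ℂ) : ℂ × ℂ →L[ℝ] ℝ :=
  (1 / 2 : ℝ) • ((p.1.im)⁻¹ • (Complex.reCLM ∘L ContinuousLinearMap.fst ℝ ℂ ℂ) -
    (p.2.im)⁻¹ • (Complex.reCLM ∘L ContinuousLinearMap.snd ℝ ℂ ℂ))

theorem eta_apply (p v : ℂ × ℂ) :
    eta p v = 1 / 2 * (v.1.re / p.1.im - v.2.re / p.2.im) := by
  simp [eta]; ring

/-- The generator of the flow is horizontal, so the vertical term of the Sasaki product drops out
and only the velocity of the base point matters. -/
theorem connForm_eq (v : UnitTangent) (X : TanVec) :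
    connForm v X = -(1 / 2) * Matrix.trace (v.dir * (v.pt.invMat * X.1)) := by
  rw [connForm, sasaki, vertPart_geodesicSpray]
  change -(1 / 8 * (4 * Matrix.trace (v.dir * (v.pt.invMat * X.1))) + adsMetric v.pt 0 _) = _
  simp only [adsMetric, Matrix.zero_mul, Matrix.trace_zero, mul_zero]
  ring

/-- Entrywise derivative of a curve of matrices. -/
def HasMatDeriv (F : ℝ → Matrix (Fin 2) (Fin 2) ℝ) (F' : Matrix (Fin 2) (Fin 2) ℝ) (J : Set ℝ)
    (s : ℝ) : Prop := ∀ i j, HasDerivWithinAt (fun s => F s i j) (F' i j) J s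

theorem HasMatDeriv.mul {F G : ℝ → Matrix (Fin 2) (Fin 2) ℝ} {F' G' : Matrix (Fin 2) (Fin 2) ℝ}
    {J : Set ℝ} {s : ℝ} (hF : HasMatDeriv F F' J s) (hG : HasMatDeriv G G' J s) :
    HasMatDeriv (fun s => F s * G s) (F' * G s + F s * G') J s := by
  intro i j
  simp only [Matrix.mul_apply, Fin.sum_univ_two, Matrix.add_apply]
  convert! ((hF i 0).mul (hG 0 j)).add ((hF i 1).mul (hG 1 j)) using 1
  ring

theorem HasMatDeriv.const (A : Matrix (Fin 2) (Fin 2) ℝ) (J : Set ℝ) (s : ℝ) :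
    HasMatDeriv (fun _ => A) 0 J s := fun _ _ => hasDerivWithinAt_const _ _ _

theorem HasMatDeriv.of_entries {F : ℝ → Matrix (Fin 2) (Fin 2) ℝ} {J : Set ℝ} {s : ℝ}
    {f00 f01 f10 f11 : ℝ → ℝ} {a b c d : ℝ} (hF : ∀ s, F s = !![f00 s, f01 s; f10 s, f11 s])
    (h00 : HasDerivWithinAt f00 a J s) (h01 : HasDerivWithinAt f01 b J s)
    (h10 : HasDerivWithinAt f10 c J s) (h11 : HasDerivWithinAt f11 d J s) :
    HasMatDeriv F !![a, b; c, d] J s := by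
  intro i j
  simp only [hF]
  fin_cases i <;> fin_cases j <;> assumption

section Tri

variable {X : ℝ → ℍ} {x' : ℂ} {J : Set ℝ} {s : ℝ}

theorem hasDerivWithinAt_re_im (h : HasDerivWithinAt (fun s => (X s : ℂ)) x' J s) :
    HasDerivWithinAt (fun s => (X s).re) x'.re J s ∧
    HasDerivWithinAt (fun s => (X s).im) x'.im J s :=
  ⟨Complex.reCLM.hasFDerivAt.comp_hasDerivWithinAt s h,
    Complex.imCLM.hasFDerivAt.comp_hasDerivWithinAt s h⟩

/-- The two traces are the contributions of the outer factors of `tri x * rot t * (tri y)⁻¹` to the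
connection form. The derivative of the imaginary part cancels, which leaves the terms of `eta`. -/
theorem hasMatDeriv_tri (h : HasDerivWithinAt (fun s => (X s : ℂ)) x' J s) :
    ∃ G' K', HasMatDeriv (fun s => (tri (X s)).mat) G' J s ∧
      HasMatDeriv (fun s => (tri (X s)).invMat) K' J s ∧
      Matrix.trace (rotGen * ((tri (X s)).invMat * G')) = -(x'.re / (X s).im) ∧
      Matrix.trace (rotGen * (K' * (tri (X s)).mat)) = x'.re / (X s).im := by
  obtain ⟨hr, hi⟩ := hasDerivWithinAt_re_im h
  have hp := (X s).im_pos
  have ha : √(X s).im ≠ 0 := (Real.sqrt_pos.mpr hp).ne'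
  have h2 : √(X s).im ^ 2 = (X s).im := Real.sq_sqrt hp.le
  have hs := hi.sqrt hp.ne'
  have hb := hr.div hs ha
  have hinv := (hasDerivWithinAt_const s J (1 : ℝ)).div hs ha
  refine ⟨_, _, HasMatDeriv.of_entries (fun s => tri_mat (X s)) hs hb (hasDerivWithinAt_const s J 0) hinv,
    HasMatDeriv.of_entries (fun s => tri_invMat (X s)) hinv hb.neg (hasDerivWithinAt_const s J 0) hs,
    ?_, ?_⟩
  · rw [tri_invMat, rotGen, Matrix.mul_fin_two, Matrix.mul_fin_two, Matrix.trace_fin_two]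
    generalize √(X s).im = a at ha h2 ⊢
    simp only [← h2]
    simp
    field_simp
    ring
  · rw [tri_mat, rotGen, Matrix.mul_fin_two, Matrix.mul_fin_two, Matrix.trace_fin_two]
    generalize √(X s).im = a at ha h2 ⊢
    simp only [← h2]
    simp
    field_simp
    ring

end Tri

section Curve

variable {c : ℝ → UnitTangent} {J : Set ℝ} {s : ℝ} {x' y' : ℂ}

theorem frame_mat_coords (v : UnitTangent) :
    v.pt.mat = (tri (xCoord v)).mat * (rot (tCoord v)).mat * (tri (yCoord v)).invMat := by
  conv_lhs => rw [← frame_coords v, frame_mat]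

theorem dir_coords (v : UnitTangent) :
    v.dir = (tri (yCoord v)).mat * rotGen * (tri (yCoord v)).invMat := by
  conv_lhs => rw [← frame_coords v, frame, dir_smul, fiberVec_dir]

theorem rot_mat_coords (v : UnitTangent) :
    (rot (tCoord v)).mat = (tri (xCoord v)).invMat * v.pt.mat * (tri (yCoord v)).mat := by
  rw [frame_mat_coords v]
  calc _ = ((tri (xCoord v)).invMat * (tri (xCoord v)).mat) * (rot (tCoord v)).mat *
      ((tri (yCoord v)).invMat * (tri (yCoord v)).mat) := by
        rw [invMat_mul_mat, invMat_mul_mat, Matrix.one_mul, Matrix.mul_one]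
    _ = _ := by simp only [Matrix.mul_assoc]

/-- The formula says that the connection form is `dt + η`. Differentiability of `t` is not part of
the data of a smooth curve, so its derivative `ν` enters through the sine and cosine. The product
rule splits the trace into three terms; the middle one is `ν` times the trace of `rotGen * rotGen`,
that is `-2 ν`. -/
theorem connForm_velocity {ν : ℝ} (hJ : UniqueDiffWithinAt ℝ J s)
    (hx : HasDerivWithinAt (fun s => (xCoord (c s) : ℂ)) x' J s)
    (hy : HasDerivWithinAt (fun s => (yCoord (c s) : ℂ)) y' J s)
    (hc : HasDerivWithinAt (fun s => Real.cos (tCoord (c s))) (-(ν * Real.sin (tCoord (c s)))) J s)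
    (hs : HasDerivWithinAt (fun s => Real.sin (tCoord (c s))) (ν * Real.cos (tCoord (c s))) J s) :
    connForm (c s) (velocity c J s) = ν + eta (toC (proj (c s))) (x', y') := by
  obtain ⟨G', -, hG, -, hG', -⟩ := hasMatDeriv_tri hx
  obtain ⟨-, K', -, hK, -, hK'⟩ := hasMatDeriv_tri hy
  have hE : HasMatDeriv (fun s => (rot (tCoord (c s))).mat)
      (ν • ((rot (tCoord (c s))).mat * rotGen)) J s := by
    have := HasMatDeriv.of_entries (fun s => rot_mat (tCoord (c s))) hc hs hs.neg hc
    convert this using 1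
    rw [rot_mat, rotGen, Matrix.mul_fin_two]
    ext i j
    fin_cases i <;> fin_cases j <;> simp
  have hM := (hG.mul hE).mul hK
  have hvel : (velocity c J s).1 =
      (G' * (rot (tCoord (c s))).mat +
        (tri (xCoord (c s))).mat * ν • ((rot (tCoord (c s))).mat * rotGen)) *
        (tri (yCoord (c s))).invMat +
      (tri (xCoord (c s))).mat * (rot (tCoord (c s))).mat * K' := by
    ext i j
    change derivWithin (fun s => (c s).pt.mat i j) J s = _
    simp only [frame_mat_coords]
    exact (hM i j).derivWithin hJ
  rw [connForm_eq, hvel, dir_coords]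
  have hinv : (c s).pt.invMat = (tri (yCoord (c s))).mat * (rot (tCoord (c s))).invMat *
      (tri (xCoord (c s))).invMat := by
    have : (c s).pt = (frame (xCoord (c s)) (yCoord (c s)) (tCoord (c s))).pt := by
      rw [frame_coords]
    rw [this, frame_pt, invMat_eq, mul_inv_rev, mul_inv_rev, inv_inv, mat_mul, mat_mul,
      ← invMat_eq, ← invMat_eq, Matrix.mul_assoc]
  have hRJ := rotGen_comm (tCoord (c s))
  rw [hinv]
  set G := (tri (xCoord (c s))).mat
  set Gi := (tri (xCoord (c s))).invMat
  set K := (tri (yCoord (c s))).invMat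
  set Ki := (tri (yCoord (c s))).mat
  set E := (rot (tCoord (c s))).mat
  set Ei := (rot (tCoord (c s))).invMat
  have hGG : Gi * G = 1 := invMat_mul_mat _
  have hKK : K * Ki = 1 := invMat_mul_mat _
  have hEE : Ei * E = 1 := invMat_mul_mat _
  have e1 : ∀ A : Matrix (Fin 2) (Fin 2) ℝ, Matrix.trace (Ki * rotGen * K * (Ki * Ei * Gi * A)) =
      Matrix.trace (rotGen * (Ei * (Gi * (A * Ki)))) := by
    intro A
    calc _ = Matrix.trace (Ki * (rotGen * (K * Ki) * (Ei * (Gi * A)))) := by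
          simp only [Matrix.mul_assoc]
      _ = Matrix.trace (rotGen * (Ei * (Gi * A)) * Ki) := by
          rw [hKK, Matrix.mul_one, Matrix.trace_mul_comm]
      _ = _ := by simp only [Matrix.mul_assoc]
  rw [e1]
  have e2 : rotGen * (Ei * (Gi * (((G' * E + G * (ν • (E * rotGen))) * K + G * E * K') * Ki))) =
      rotGen * (Ei * (Gi * G' * E)) + ν • (rotGen * rotGen) + rotGen * (K' * Ki) := by
    calc _ = rotGen * (Ei * (Gi * G' * E * (K * Ki))) +
        ν • (rotGen * ((Ei * ((Gi * G) * E)) * rotGen * (K * Ki))) +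
        rotGen * ((Ei * ((Gi * G) * E)) * (K' * Ki)) := by
          simp only [Matrix.mul_assoc, Matrix.mul_add, Matrix.add_mul, Matrix.mul_smul,
            Matrix.smul_mul]
      _ = _ := by
          rw [hKK, hGG, Matrix.one_mul, hEE]
          simp only [Matrix.mul_one, Matrix.one_mul]
  have e3 : Matrix.trace (rotGen * (Ei * (Gi * G' * E))) = Matrix.trace (rotGen * (Gi * G')) := by
    calc _ = Matrix.trace ((rotGen * Ei * (Gi * G')) * E) := by simp only [Matrix.mul_assoc]
      _ = Matrix.trace (E * rotGen * Ei * (Gi * G')) := by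
          rw [Matrix.trace_mul_comm]; simp only [Matrix.mul_assoc]
      _ = _ := by rw [hRJ]
  rw [e2, Matrix.trace_add, Matrix.trace_add, e3, hG', hK', rotGen_mul_rotGen, eta_apply,
    Matrix.trace_smul, Matrix.trace_neg, Matrix.trace_one]
  simp [toC, proj]
  ring

/-- The sine and cosine of `t` are entries of `(tri x)⁻¹ γ (tri y)`, hence differentiable.
Differentiating `cos² + sin² = 1` shows that the derivative of `(cos, sin)` is a multiple `ν` of
`(-sin, cos)`. -/
theorem SmoothCurveOn.exists_hasDerivWithinAt_cos_sin (h : SmoothCurveOn c J) (hsJ : s ∈ J)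
    (hx : HasDerivWithinAt (fun s => (xCoord (c s) : ℂ)) x' J s)
    (hy : HasDerivWithinAt (fun s => (yCoord (c s) : ℂ)) y' J s) (hJ : UniqueDiffWithinAt ℝ J s) :
    ∃ ν : ℝ,
    HasDerivWithinAt (fun s => Real.cos (tCoord (c s))) (-(ν * Real.sin (tCoord (c s)))) J s ∧
    HasDerivWithinAt (fun s => Real.sin (tCoord (c s))) (ν * Real.cos (tCoord (c s))) J s := by
  obtain ⟨-, G', -, hG, -, -⟩ := hasMatDeriv_tri hx
  obtain ⟨K', -, hK, -, -, -⟩ := hasMatDeriv_tri hy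
  have hM : HasMatDeriv (fun s => (c s).pt.mat)
      (Matrix.of fun i j => derivWithin (fun s => (c s).pt.mat i j) J s) J s := fun i j =>
    (((h.1 i j).differentiableOn (by simp)) s hsJ).hasDerivWithinAt
  have hE := (hG.mul hM).mul hK
  simp only [← rot_mat_coords] at hE
  obtain ⟨E', hE⟩ : ∃ E', HasMatDeriv (fun s => (rot (tCoord (c s))).mat) E' J s := ⟨_, hE⟩
  have hc : HasDerivWithinAt (fun s => Real.cos (tCoord (c s))) (E' 0 0) J s := hE 0 0
  have hs : HasDerivWithinAt (fun s => Real.sin (tCoord (c s))) (E' 0 1) J s := hE 0 1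
  have h1 := Real.cos_sq_add_sin_sq (tCoord (c s))
  have h0 : Real.cos (tCoord (c s)) * E' 0 0 + Real.sin (tCoord (c s)) * E' 0 1 = 0 := by
    have := (hc.mul hc).add (hs.mul hs)
    have h2 := (hasDerivWithinAt_const s J (1 : ℝ)).congr_of_mem
      (f₁ := (fun s => Real.cos (tCoord (c s))) * (fun s => Real.cos (tCoord (c s))) +
        (fun s => Real.sin (tCoord (c s))) * (fun s => Real.sin (tCoord (c s)))) (fun s _ => by
        simp only [Pi.add_apply, Pi.mul_apply]
        nlinarith [Real.cos_sq_add_sin_sq (tCoord (c s))]) hsJ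
    have := hJ.eq_deriv _ this h2
    linarith
  refine ⟨Real.cos (tCoord (c s)) * E' 0 1 - Real.sin (tCoord (c s)) * E' 0 0, ?_, ?_⟩
  · convert hc using 1
    linear_combination E' 0 0 * h1 - Real.cos (tCoord (c s)) * h0
  · convert hs using 1
    linear_combination E' 0 1 * h1 - Real.sin (tCoord (c s)) * h0

/-! ### Continuity of the coordinates along smooth curves. -/

theorem SmoothCurveOn.continuousOn_mat (h : SmoothCurveOn c J) :
    ContinuousOn (fun s => (c s).pt.mat) J :=
  continuousOn_pi.mpr fun i => continuousOn_pi.mpr fun j => (h.1 i j).continuousOn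

theorem SmoothCurveOn.continuousOn_dir (h : SmoothCurveOn c J) :
    ContinuousOn (fun s => (c s).dir) J := by
  have h2 : ContinuousOn (fun s => (c s).vec) J :=
    continuousOn_pi.mpr fun i => continuousOn_pi.mpr fun j => (h.2.1 i j).continuousOn
  have h3 : (fun s => (c s).dir) = fun s => (c s).pt.mat.adjugate * (c s).vec := by
    funext s
    have : (c s).pt.invMat = (c s).pt.mat.adjugate := Matrix.SpecialLinearGroup.coe_inv _
    rw [UnitTangent.dir, this]
  rw [h3]
  have h4 : Continuous fun A : Matrix (Fin 2) (Fin 2) ℝ => A.adjugate := continuous_id.matrix_adjugate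
  exact (continuous_fst.matrix_mul continuous_snd).comp_continuousOn
    ((h4.comp_continuousOn h.continuousOn_mat).prodMk h2)

theorem SmoothCurveOn.continuousOn_yCoord (h : SmoothCurveOn c J) :
    ContinuousOn (fun s => yCoord (c s)) J := by
  have hd : ∀ i j, ContinuousOn (fun s => (c s).dir i j) J := fun i j =>
    (continuous_apply_apply i j).comp_continuousOn h.continuousOn_dir
  rw [UpperHalfPlane.isEmbedding_coe.continuousOn_iff]
  have := Complex.equivRealProdCLM.symm.continuous.comp_continuousOn
    ((((hd 0 0).div (hd 1 0) (fun s _ => (c s).dir_neg.ne))).prodMk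
      (continuousOn_const (c := (-1 : ℝ)).div (hd 1 0) (fun s _ => (c s).dir_neg.ne)))
  exact this

theorem SmoothCurveOn.continuousOn_xCoord (h : SmoothCurveOn c J) :
    ContinuousOn (fun s => xCoord (c s)) J := by
  have hm : ∀ i j, ContinuousOn (fun s => ((c s).pt.mat i j : ℂ)) J := fun i j =>
    Complex.continuous_ofReal.comp_continuousOn
      ((continuous_apply_apply i j).comp_continuousOn h.continuousOn_mat)
  have hy : ContinuousOn (fun s => (yCoord (c s) : ℂ)) J :=
    UpperHalfPlane.continuous_coe.comp_continuousOn h.continuousOn_yCoord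
  rw [UpperHalfPlane.isEmbedding_coe.continuousOn_iff]
  have h1 : ∀ s, ((xCoord (c s) : ℍ) : ℂ) = ((c s).pt.mat 0 0 * (yCoord (c s) : ℂ) + (c s).pt.mat 0 1) /
      ((c s).pt.mat 1 0 * (yCoord (c s) : ℂ) + (c s).pt.mat 1 1) := fun s =>
    UpperHalfPlane.coe_specialLinearGroup_apply _ _
  have h2 : ∀ s, ((c s).pt.mat 1 0 * (yCoord (c s) : ℂ) + (c s).pt.mat 1 1 : ℂ) ≠ 0 := fun s =>
    UpperHalfPlane.denom_ne_zero (c s).pt.toSL (yCoord (c s))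
  have := (((hm 0 0).mul hy).add (hm 0 1)).div (((hm 1 0).mul hy).add (hm 1 1)) (fun s _ => h2 s)
  exact this.congr (fun s _ => h1 s)

theorem tCoord_eq (v : UnitTangent) : tCoord v = -triFun (triInv (xCoord v)) (v.pt.lift 0) := by
  rw [tCoord, SL2Tilde.lift_mul, SL2Tilde.lift_mul, tri_lift, triFun_zero, tri_inv_lift]

theorem SmoothCurveOn.continuousOn_tCoord (h : SmoothCurveOn c J) :
    ContinuousOn (fun s => tCoord (c s)) J := by
  simp only [tCoord_eq]
  exact (continuous_triFun.comp_continuousOn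
    ((continuous_triInv.comp_continuousOn h.continuousOn_xCoord).prodMk h.2.2)).neg

end Curve

/-- Along a curve on which the connection form vanishes, the fiber coordinate changes by the
integral of `-eta`. -/
theorem SmoothCurveOn.tCoord_add_eq {c : ℝ → UnitTangent} (h : SmoothCurveOn c (Icc 0 1))
    (h0 : ∀ s ∈ Icc (0 : ℝ) 1, connForm (c s) (velocity c (Icc 0 1) s) = 0) {p' : ℝ → ℂ × ℂ}
    (hp : ∀ s ∈ Icc (0 : ℝ) 1, HasDerivWithinAt (fun s => toC (proj (c s))) (p' s) (Icc 0 1) s)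
    {F : ℝ → ℝ} (hF : ∀ s ∈ Icc (0 : ℝ) 1,
      HasDerivWithinAt F (eta (toC (proj (c s))) (p' s)) (Icc 0 1) s) {s : ℝ}
    (hs : s ∈ Icc (0 : ℝ) 1) : tCoord (c s) + F s = tCoord (c 0) + F 0 := by
  have hu := uniqueDiffOn_Icc (zero_lt_one (α := ℝ))
  -- As `t` is only known to be continuous, constancy is first shown for the cosine and sine of `t +
  -- F`. It then holds modulo `2π`, and continuity removes the ambiguity.
  have key : ∀ s ∈ Icc (0 : ℝ) 1,
      HasDerivWithinAt (fun s => Real.cos (tCoord (c s) + F s)) 0 (Icc 0 1) s ∧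
      HasDerivWithinAt (fun s => Real.sin (tCoord (c s) + F s)) 0 (Icc 0 1) s := by
    intro s hs
    have hx : HasDerivWithinAt (fun s => (xCoord (c s) : ℂ)) (p' s).1 (Icc 0 1) s :=
      (ContinuousLinearMap.fst ℝ ℂ ℂ).hasFDerivAt.comp_hasDerivWithinAt s (hp s hs)
    have hy : HasDerivWithinAt (fun s => (yCoord (c s) : ℂ)) (p' s).2 (Icc 0 1) s :=
      (ContinuousLinearMap.snd ℝ ℂ ℂ).hasFDerivAt.comp_hasDerivWithinAt s (hp s hs)
    obtain ⟨ν, hcos, hsin⟩ := h.exists_hasDerivWithinAt_cos_sin hs hx hy (hu s hs)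
    have hν := h0 s hs
    rw [connForm_velocity (hu s hs) hx hy hcos hsin] at hν
    have hcF := (hF s hs).cos
    have hsF := (hF s hs).sin
    have e : eta (toC (proj (c s))) ((p' s).1, (p' s).2) = -ν := by linarith
    rw [show p' s = ((p' s).1, (p' s).2) from rfl, e] at hcF hsF
    constructor
    · simp only [Real.cos_add]
      convert! (hcos.mul hcF).sub (hsin.mul hsF) using 1
      ring
    · simp only [Real.sin_add]
      convert! (hsin.mul hcF).add (hcos.mul hsF) using 1
      ring
  have hcont : ContinuousOn (fun s => tCoord (c s) + F s - (tCoord (c 0) + F 0)) (Icc 0 1) :=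
    (h.continuousOn_tCoord.add fun s hs => (hF s hs).continuousWithinAt).sub continuousOn_const
  have h1 := constant_of_derivWithin_zero (fun s hs => (key s hs).1.differentiableWithinAt)
    (fun s hs => (key s (Ico_subset_Icc_self hs)).1.derivWithin (hu s (Ico_subset_Icc_self hs)))
  have h2 := constant_of_derivWithin_zero (fun s hs => (key s hs).2.differentiableWithinAt)
    (fun s hs => (key s (Ico_subset_Icc_self hs)).2.derivWithin (hu s (Ico_subset_Icc_self hs)))
  have := eq_of_sub_mem_zmultiples isPreconnected_Icc hcont (2 * Real.pi)
    (fun s hs => exists_int_of_cos_sin_eq (h1 s hs) (h2 s hs)) hs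
    (left_mem_Icc.mpr zero_le_one)
  simp only [sub_self] at this
  linarith

/-! ### Smooth curves given in coordinates, and their images under isometries. -/

theorem contDiffOn_mul_apply {n : WithTop ℕ∞} {F G : ℝ → Matrix (Fin 2) (Fin 2) ℝ} {J : Set ℝ}
    (hF : ∀ i j, ContDiffOn ℝ n (fun s => F s i j) J)
    (hG : ∀ i j, ContDiffOn ℝ n (fun s => G s i j) J) (i j : Fin 2) :
    ContDiffOn ℝ n (fun s => (F s * G s) i j) J := by
  simp only [Matrix.mul_apply, Fin.sum_univ_two]
  exact ((hF i 0).mul (hG 0 j)).add ((hF i 1).mul (hG 1 j))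

theorem contDiffOn_tri {X : ℝ → ℍ} {J : Set ℝ} (h : ContDiffOn ℝ ∞ (fun s => (X s : ℂ)) J)
    (i j : Fin 2) : ContDiffOn ℝ ∞ (fun s => (tri (X s)).mat i j) J ∧
      ContDiffOn ℝ ∞ (fun s => (tri (X s)).invMat i j) J := by
  have hr : ContDiffOn ℝ ∞ (fun s => (X s).re) J := Complex.reCLM.contDiff.comp_contDiffOn h
  have hi : ContDiffOn ℝ ∞ (fun s => (X s).im) J := Complex.imCLM.contDiff.comp_contDiffOn h
  have hs : ContDiffOn ℝ ∞ (fun s => √(X s).im) J := hi.sqrt (fun s _ => (X s).im_pos.ne')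
  have h0 : ∀ s ∈ J, √(X s).im ≠ 0 := fun s _ => (Real.sqrt_pos.mpr (X s).im_pos).ne'
  have hb : ContDiffOn ℝ ∞ (fun s => (X s).re / √(X s).im) J := hr.div hs h0
  have hv : ContDiffOn ℝ ∞ (fun s => 1 / √(X s).im) J := contDiffOn_const.div hs h0
  simp only [tri_mat, tri_invMat]
  fin_cases i <;> fin_cases j
  exacts [⟨hs, hv⟩, ⟨hb, hb.neg⟩, ⟨contDiffOn_const, contDiffOn_const⟩, ⟨hv, hs⟩]

theorem smoothCurveOn_frame {P : ℝ → ℍ × ℍ} {t : ℝ → ℝ} {J : Set ℝ}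
    (hP : ContDiffOn ℝ ∞ (fun s => toC (P s)) J) (ht : ContDiffOn ℝ ∞ t J) :
    SmoothCurveOn (fun s => frame (P s).1 (P s).2 (t s)) J := by
  have hx : ContDiffOn ℝ ∞ (fun s => ((P s).1 : ℂ)) J := contDiff_fst.comp_contDiffOn hP
  have hy : ContDiffOn ℝ ∞ (fun s => ((P s).2 : ℂ)) J := contDiff_snd.comp_contDiffOn hP
  have hR : ∀ i j, ContDiffOn ℝ ∞ (fun s => (rot (t s)).mat i j) J := by
    intro i j
    have hc : ContDiffOn ℝ ∞ (fun s => Real.cos (t s)) J := ht.cos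
    have hs : ContDiffOn ℝ ∞ (fun s => Real.sin (t s)) J := ht.sin
    simp only [rot_mat]
    fin_cases i <;> fin_cases j
    exacts [hc, hs, hs.neg, hc]
  have hx' := fun i j => (contDiffOn_tri hx i j).1
  have hy' := fun i j => (contDiffOn_tri hy i j).2
  refine ⟨fun i j => ?_, fun i j => ?_, ?_⟩
  · simp only [frame_mat]
    exact contDiffOn_mul_apply (contDiffOn_mul_apply hx' hR) hy' i j
  · simp only [frame_vec]
    exact contDiffOn_mul_apply (contDiffOn_mul_apply hx'
      (contDiffOn_mul_apply (G := fun _ => rotGen) hR fun _ _ => contDiffOn_const)) hy' i j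
  · have : ∀ s, (frame (P s).1 (P s).2 (t s)).pt.lift 0 =
        triFun (P s).1 (triFun (triInv (P s).2) 0 - t s) := fun s => by
      rw [frame_pt, SL2Tilde.lift_mul, SL2Tilde.lift_mul, rot_lift, tri_lift, tri_inv_lift]
    simp only [this]
    have hxc : ContinuousOn (fun s => (P s).1) J :=
      UpperHalfPlane.isEmbedding_coe.continuousOn_iff.mpr hx.continuousOn
    have hyc : ContinuousOn (fun s => (P s).2) J :=
      UpperHalfPlane.isEmbedding_coe.continuousOn_iff.mpr hy.continuousOn
    exact continuous_triFun.comp_continuousOn (hxc.prodMk ((continuous_triFun.comp_continuousOn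
      ((continuous_triInv.comp_continuousOn hyc).prodMk continuousOn_const)).sub ht.continuousOn))

/-- Parallel lifts of smooth curves in `ℍ × ℍ`. -/
theorem connForm_frame {P : ℝ → ℍ × ℍ} {F : ℝ → ℝ} {J : Set ℝ} {s : ℝ} {p' : ℂ × ℂ}
    (hJ : UniqueDiffWithinAt ℝ J s) (hP : HasDerivWithinAt (fun s => toC (P s)) p' J s)
    (hF : HasDerivWithinAt F (eta (toC (P s)) p') J s) (t₀ : ℝ) :
    connForm (frame (P s).1 (P s).2 (t₀ - F s))
      (velocity (fun s => frame (P s).1 (P s).2 (t₀ - F s)) J s) = 0 := by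
  have ht : HasDerivWithinAt (fun s => t₀ - F s) (-eta (toC (P s)) p') J s := hF.const_sub t₀
  have hx : HasDerivWithinAt (fun s => ((P s).1 : ℂ)) p'.1 J s :=
    (ContinuousLinearMap.fst ℝ ℂ ℂ).hasFDerivAt.comp_hasDerivWithinAt s hP
  have hy : HasDerivWithinAt (fun s => ((P s).2 : ℂ)) p'.2 J s :=
    (ContinuousLinearMap.snd ℝ ℂ ℂ).hasFDerivAt.comp_hasDerivWithinAt s hP
  have hc : HasDerivWithinAt (fun s => Real.cos (t₀ - F s))
      (-(-eta (toC (P s)) p' * Real.sin (t₀ - F s))) J s := by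
    rw [← neg_mul, neg_neg, mul_comm, ← neg_mul_neg]
    exact ht.cos
  have hs : HasDerivWithinAt (fun s => Real.sin (t₀ - F s))
      (-eta (toC (P s)) p' * Real.cos (t₀ - F s)) J s := by
    rw [mul_comm]
    exact ht.sin
  obtain ⟨c, hcdef⟩ : ∃ c : ℝ → UnitTangent, ∀ s, c s = frame (P s).1 (P s).2 (t₀ - F s) :=
    ⟨_, fun _ => rfl⟩
  have ex : ∀ s, xCoord (c s) = (P s).1 := fun s => by rw [hcdef, xCoord_frame]
  have ey : ∀ s, yCoord (c s) = (P s).2 := fun s => by rw [hcdef, yCoord_frame]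
  have et : ∀ s, tCoord (c s) = t₀ - F s := fun s => by rw [hcdef, tCoord_frame]
  have := connForm_velocity (c := c) (x' := p'.1) (y' := p'.2) (ν := -eta (toC (P s)) p') hJ
    (by simpa only [ex] using hx) (by simpa only [ey] using hy) (by simpa only [et] using hc)
    (by simpa only [et] using hs)
  simp only [← hcdef]
  rw [this, proj, ex, ey]
  simp

/-- `SmoothCurveOn` controls the lift at the angle `0` only, whereas the translated curve evaluates
it at `(a.2⁻¹).lift 0`. Continuity there is read off from the coordinates. -/
theorem SmoothCurveOn.smul {c : ℝ → UnitTangent} {J : Set ℝ} (h : SmoothCurveOn c J)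
    (a : SL2Tilde × SL2Tilde) : SmoothCurveOn (fun s => a • c s) J := by
  refine ⟨fun i j => ?_, fun i j => ?_, ?_⟩
  · simp only [pairSMul_pt, mat_mul]
    exact contDiffOn_mul_apply (G := fun _ => (a.2⁻¹).mat)
      (contDiffOn_mul_apply (F := fun _ => a.1.mat) (fun _ _ => contDiffOn_const) h.1)
      (fun _ _ => contDiffOn_const) i j
  · simp only [pairSMul_vec]
    exact contDiffOn_mul_apply (G := fun _ => a.2.invMat)
      (contDiffOn_mul_apply (F := fun _ => a.1.mat) (fun _ _ => contDiffOn_const) h.2.1)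
      (fun _ _ => contDiffOn_const) i j
  · have : ∀ s, (a • c s).pt.lift 0 = a.1.lift (triFun (xCoord (c s))
        (triFun (triInv (yCoord (c s))) ((a.2⁻¹).lift 0) - tCoord (c s))) := fun s => by
      rw [pairSMul_pt, SL2Tilde.lift_mul, SL2Tilde.lift_mul]
      conv_lhs => rw [← frame_coords (c s), frame_pt]
      rw [SL2Tilde.lift_mul, SL2Tilde.lift_mul, rot_lift, tri_lift, tri_inv_lift]
    simp only [this]
    exact a.1.continuous_lift.comp_continuousOn (continuous_triFun.comp_continuousOn
      (h.continuousOn_xCoord.prodMk ((continuous_triFun.comp_continuousOn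
      ((continuous_triInv.comp_continuousOn h.continuousOn_yCoord).prodMk
        continuousOn_const)).sub h.continuousOn_tCoord)))

/-- The left factor cancels in `γ⁻¹ w`, the right factor conjugates it, and the trace is invariant
under conjugation. -/
theorem connForm_smul {c : ℝ → UnitTangent} {J : Set ℝ} (h : SmoothCurveOn c J)
    (a : SL2Tilde × SL2Tilde) {s : ℝ} (hs : s ∈ J) (hJ : UniqueDiffWithinAt ℝ J s) :
    connForm (a • c s) (velocity (fun s => a • c s) J s) = connForm (c s) (velocity c J s) := by
  have hM : HasMatDeriv (fun s => (c s).pt.mat) (velocity c J s).1 J s := fun i j =>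
    (((h.1 i j).differentiableOn (by simp)) s hs).hasDerivWithinAt
  have hM' := ((HasMatDeriv.const a.1.mat J s).mul hM).mul (HasMatDeriv.const a.2.invMat J s)
  have hv : (velocity (fun s => a • c s) J s).1 = a.1.mat * (velocity c J s).1 * a.2.invMat := by
    ext i j
    change derivWithin (fun s => (a.1.mat * (c s).pt.mat * a.2.invMat) i j) J s = _
    rw [(hM' i j).derivWithin hJ]
    simp
  rw [connForm_eq, connForm_eq, hv, dir_smul, pairSMul_pt, translate_aux]
  congr 1
  set A := (c s).dir
  set B := (c s).pt.invMat * (velocity c J s).1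
  calc Matrix.trace (a.2.mat * A * a.2.invMat * (a.2.mat * B * a.2.invMat))
      = Matrix.trace (a.2.mat * (A * ((a.2.invMat * a.2.mat) * (B * a.2.invMat)))) := by
        simp only [Matrix.mul_assoc]
    _ = Matrix.trace ((A * (B * a.2.invMat)) * a.2.mat) := by
        rw [invMat_mul_mat, Matrix.one_mul, Matrix.trace_mul_comm]
    _ = Matrix.trace (A * (B * (a.2.invMat * a.2.mat))) := by simp only [Matrix.mul_assoc]
    _ = _ := by rw [invMat_mul_mat, Matrix.mul_one]

/-! ## Isometries of bounded displacement -/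

/-- Near the real axis a bounded hyperbolic displacement is negligible in the Euclidean metric.
Hence `a x + b = x (c x + d)` for every real `x`, which leaves only scalar matrices. -/
theorem mem_center_of_dist_le {g : SL(2, ℝ)} {C : ℝ} (h : ∀ z : ℍ, dist z (g • z) ≤ C) :
    g ∈ Subgroup.center SL(2, ℝ) := by
  set a := g 0 0 with ha
  set b := g 0 1 with hb
  set c := g 1 0 with hc
  set d := g 1 1 with hd
  have hdet : a * d - b * c = 1 := by
    have := g.det_coe
    rwa [Matrix.det_fin_two] at this
  set K := Real.cosh C - 1 with hK
  -- The left side is the square of the real part of `(w - z) (c z + d)`, with `z = x + i ε` and `w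
  -- = g z`. The formula for `cosh` of the distance bounds `|w - z|²` by `2 K ε Im w`, and `Im w |c
  -- z + d|² = ε`.
  have key : ∀ x ε : ℝ, 0 < ε →
      (a * x + b - c * (x ^ 2 - ε ^ 2) - d * x) ^ 2 ≤ 2 * K * ε ^ 2 := by
    intro x ε hε
    set z : ℍ := ⟨⟨x, ε⟩, hε⟩ with hz
    set w := g • z with hw
    have e := (sl_smul_eq_iff g z w).mp rfl
    have hre := congrArg Complex.re e
    have him := congrArg Complex.im e
    rw [← ha, ← hb, ← hc, ← hd] at hre him
    have hzre : z.re = x := rfl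
    have hzim : z.im = ε := rfl
    simp at hre him
    rw [hzre, hzim] at hre him
    set u := w.re
    set v := w.im
    have hv : 0 < v := w.im_pos
    have h1 : dist (z : ℂ) w ^ 2 = (u - x) ^ 2 + (v - ε) ^ 2 := by
      rw [Complex.dist_eq, ← Complex.normSq_eq_norm_sq, Complex.normSq_apply]
      simp [hzre, hzim]
      ring
    have h2 : Real.cosh (dist z w) ≤ Real.cosh C := by
      rw [Real.cosh_le_cosh, abs_of_nonneg dist_nonneg]
      exact (h z).trans (le_abs_self C)
    rw [UpperHalfPlane.cosh_dist, h1, hzim] at h2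
    change 1 + ((u - x) ^ 2 + (v - ε) ^ 2) / (2 * ε * v) ≤ Real.cosh C at h2
    have h3 : (u - x) ^ 2 + (v - ε) ^ 2 ≤ K * (2 * ε * v) := by
      have : ((u - x) ^ 2 + (v - ε) ^ 2) / (2 * ε * v) ≤ K := by linarith
      rwa [div_le_iff₀ (by positivity)] at this
    have h4 : v * ((c * x + d) ^ 2 + (c * ε) ^ 2) = ε := by
      have h5 : (u * (c * x + d) - v * (c * ε)) * (c * ε) = (a * x + b) * (c * ε) := by rw [hre]
      have h6 : (u * (c * ε) + v * (c * x + d)) * (c * x + d) = (a * ε) * (c * x + d) := by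
        rw [him]
      linear_combination h6 - h5 + ε * hdet
    have h7 : ((u - x) ^ 2 + (v - ε) ^ 2) * ((c * x + d) ^ 2 + (c * ε) ^ 2) ≤ K * (2 * ε * ε) := by
      calc _ ≤ K * (2 * ε * v) * ((c * x + d) ^ 2 + (c * ε) ^ 2) :=
            mul_le_mul_of_nonneg_right h3 (by positivity)
        _ = _ := by linear_combination K * 2 * ε * h4
    have h8 : a * x + b - c * (x ^ 2 - ε ^ 2) - d * x =
        (u - x) * (c * x + d) - (v - ε) * (c * ε) := by linear_combination hre
    have h9 : 0 ≤ ((u - x) * (c * ε) + (v - ε) * (c * x + d)) ^ 2 := sq_nonneg _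
    rw [h8]
    nlinarith
  have lim : ∀ x : ℝ, a * x + b - c * x ^ 2 - d * x = 0 := by
    intro x
    have h1 : Filter.Tendsto (fun ε : ℝ => (a * x + b - c * (x ^ 2 - ε ^ 2) - d * x) ^ 2)
        (nhdsWithin 0 (Ioi 0)) (nhds ((a * x + b - c * (x ^ 2 - 0 ^ 2) - d * x) ^ 2)) :=
      ((by fun_prop : Continuous fun ε : ℝ =>
        (a * x + b - c * (x ^ 2 - ε ^ 2) - d * x) ^ 2).tendsto 0).mono_left nhdsWithin_le_nhds
    have h2 : Filter.Tendsto (fun ε : ℝ => 2 * K * ε ^ 2)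
        (nhdsWithin 0 (Ioi 0)) (nhds (2 * K * 0 ^ 2)) :=
      ((by fun_prop : Continuous fun ε : ℝ => 2 * K * ε ^ 2).tendsto 0).mono_left nhdsWithin_le_nhds
    have h3 := le_of_tendsto_of_tendsto h1 h2
      (by filter_upwards [self_mem_nhdsWithin] with ε hε using key x ε hε)
    have h4 : (a * x + b - c * (x ^ 2 - 0 ^ 2) - d * x) ^ 2 = 0 :=
      le_antisymm (h3.trans (by simp)) (sq_nonneg _)
    have := pow_eq_zero_iff (two_ne_zero) |>.mp h4
    linarith
  have l0 := lim 0
  have l1 := lim 1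
  have l2 := lim (-1)
  have hb0 : b = 0 := by linarith
  have hc0 : c = 0 := by linarith
  have hda : d = a := by linarith
  rw [Matrix.SpecialLinearGroup.mem_center_iff]
  refine ⟨a, ?_, ?_⟩
  · rw [hb0, hda] at hdet
    rw [Fintype.card_fin]
    linear_combination hdet
  · ext i j
    fin_cases i <;> fin_cases j <;> simp
    exacts [ha, hb0.symm.trans hb, hc0.symm.trans hc, hda.symm.trans hd]

theorem psl_eq_one_of_dist_le {g : PSL2R} {C : ℝ} (h : ∀ z : ℍ, dist z (pslAct g z) ≤ C) :
    g = 1 := by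
  obtain ⟨g, rfl⟩ := QuotientGroup.mk_surjective g
  exact (QuotientGroup.eq_one_iff g).mpr (mem_center_of_dist_le h)

theorem pslAct_mul (g h : PSL2R) (z : ℍ) : pslAct (g * h) z = pslAct g (pslAct h z) := by
  rw [map_mul]; rfl

theorem pslAct_one (z : ℍ) : pslAct 1 z = z := by
  rw [map_one]; rfl

theorem pslAct_inv_eq_iff {g : PSL2R} {z w : ℍ} : pslAct g⁻¹ z = w ↔ z = pslAct g w := by
  rw [map_inv, Equiv.Perm.inv_eq_iff_eq]

theorem continuous_pslAct (g : PSL2R) : Continuous (pslAct g) := by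
  obtain ⟨g, rfl⟩ := QuotientGroup.mk_surjective g
  exact continuous_const_smul g

theorem dist_pslAct (g : PSL2R) (z w : ℍ) : dist (pslAct g z) (pslAct g w) = dist z w := by
  obtain ⟨g, rfl⟩ := QuotientGroup.mk_surjective g
  exact dist_smul g z w

theorem psl_eq_one_of_forall_fixed {g : PSL2R} (h : ∀ z, pslAct g z = z) : g = 1 :=
  psl_eq_one_of_dist_le (C := 0) fun z => by rw [h, dist_self]

/-! ## Deck transformations -/

section Deck

variable {S : Type*} [TopologicalSpace S] [ChartedSpace (EuclideanSpace ℝ (Fin 2)) S]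
  {x₀ : S} {ρ : FundamentalGroup S x₀ →* PSL2R} (h : HypStructure x₀ ρ)

namespace HypStructure

theorem eq_of_lifts {A : Type*} [TopologicalSpace A] [PreconnectedSpace A] {f g : A → ℍ}
    (hf : Continuous f) (hg : Continuous g) (hfg : ∀ a, h.cov (f a) = h.cov (g a)) {a : A}
    (ha : f a = g a) (b : A) : f b = g b :=
  congrFun (h.isCoveringMap.eq_of_comp_eq hf hg (funext hfg) a ha) b

/-- The covering lifts through itself to a map taking `z` to `w`. A path from the base point to its
image projects to a loop, and `monodromy` identifies this map with the action of the inverse of the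
class of that loop. -/
theorem exists_deck {z w : ℍ} (hzw : h.cov z = h.cov w) : ∃ τ, pslAct (ρ τ) z = w := by
  obtain ⟨g, ⟨hg, hg'⟩, -⟩ := h.isCoveringMap.existsUnique_continuousMap_lifts
    (A := ℍ) ⟨h.cov, h.isCoveringMap.continuous⟩ z w hzw.symm
  have hcov : ∀ u, h.cov (g u) = h.cov u := fun u => congrFun hg' u
  let c : Path h.base (g h.base) := PathConnectedSpace.somePath _ _
  let ℓ : Path x₀ x₀ := (c.map h.isCoveringMap.continuous).cast h.cov_base.symm
    (by rw [hcov, h.cov_base])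
  have hm := h.monodromy ℓ (g h.base) c (fun s => rfl)
  refine ⟨(loopClass ℓ)⁻¹, ?_⟩
  rw [map_inv, ← hg]
  refine h.eq_of_lifts (continuous_pslAct _) g.continuous (fun u => ?_) (a := h.base) ?_ z
  · rw [← map_inv, h.invariant, hcov]
  · rw [pslAct_inv_eq_iff, hm]

theorem eq_one_of_fixed (h : HypStructure x₀ ρ) {τ : FundamentalGroup S x₀} {z : ℍ} (hz : pslAct (ρ τ) z = z) :
    ρ τ = 1 :=
  psl_eq_one_of_forall_fixed fun w => h.eq_of_lifts (continuous_pslAct _) continuous_id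
    (fun u => h.invariant τ u) hz w

theorem rep_eq_of_apply_eq (h : HypStructure x₀ ρ) {τ υ : FundamentalGroup S x₀} {z : ℍ}
    (hz : pslAct (ρ τ) z = pslAct (ρ υ) z) : ρ τ = ρ υ := by
  have : ρ (υ⁻¹ * τ) = 1 := h.eq_one_of_fixed (z := z) (by
    rw [map_mul, pslAct_mul, hz, map_inv, pslAct_inv_eq_iff])
  rw [map_mul, map_inv, inv_mul_eq_one] at this
  exact this.symm

/-- The displacement of `g` is invariant under the deck group, so it descends to the compact surface
and is bounded. -/
theorem eq_one_of_commute (h : HypStructure x₀ ρ) [CompactSpace S] {g : PSL2R} (hg : ∀ τ, ρ τ * g = g * ρ τ) : g = 1 := by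
  let δ : C(ℍ, ℝ) := ⟨fun z => dist z (pslAct g z),
    continuous_id.dist (continuous_pslAct g)⟩
  have hq : Topology.IsQuotientMap (⟨h.cov, h.isCoveringMap.continuous⟩ : C(ℍ, S)) :=
    h.isCoveringMap.isQuotientMap h.surjective
  have hf : Function.FactorsThrough δ (⟨h.cov, h.isCoveringMap.continuous⟩ : C(ℍ, S)) := by
    intro z w hzw
    obtain ⟨τ, rfl⟩ := h.exists_deck hzw
    change dist z (pslAct g z) = dist (pslAct (ρ τ) z) (pslAct g (pslAct (ρ τ) z))
    rw [← pslAct_mul, ← hg, pslAct_mul, dist_pslAct]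
  obtain ⟨C, hC⟩ := (isCompact_univ (X := S)).bddAbove_image (hq.lift δ hf).continuous.continuousOn
  refine psl_eq_one_of_dist_le (C := C) fun z => hC ⟨h.cov z, mem_univ _, ?_⟩
  exact congrFun (congrArg DFunLike.coe (hq.lift_comp δ hf)) z

/-- Two lifts of one map differ by a deck transformation, which equivariance forces to commute with
the image of `ρ`. The action `A` on the source is kept general because the left action is used on
the source for both factors. -/
theorem equivariant_unique [CompactSpace S] {f f' : ℍ → ℍ} (hf : Continuous f)
    (hf' : Continuous f') (hff' : ∀ z, h.cov (f z) = h.cov (f' z))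
    {A : FundamentalGroup S x₀ → ℍ → ℍ} (hA : ∀ τ z, f (A τ z) = pslAct (ρ τ) (f z))
    (hA' : ∀ τ z, f' (A τ z) = pslAct (ρ τ) (f' z)) : f = f' := by
  obtain ⟨υ, hυ⟩ := h.exists_deck (hff' h.base)
  have hall : ∀ z, pslAct (ρ υ) (f z) = f' z :=
    h.eq_of_lifts ((continuous_pslAct _).comp hf) hf'
      (fun z => by simp only [h.invariant, hff']) hυ
  have : ρ υ = 1 := h.eq_one_of_commute fun τ => by
    rw [← map_mul, ← map_mul]
    refine h.rep_eq_of_apply_eq (z := f h.base) ?_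
    rw [map_mul ρ, map_mul ρ, pslAct_mul, pslAct_mul, hall, ← hA, hall, hA']
  funext z
  rw [← hall, this, pslAct_one]

/-- For fixed `τ` and `z` both sides of the equivariance relation lift the same path in `t` and
agree at `t = 0`, so equivariance propagates from time `0`. -/
theorem exists_lift_homotopy {A : FundamentalGroup S x₀ → ℍ → ℍ}
    (G : C(I × ℍ, S)) (f₀ : C(ℍ, ℍ)) (hG : ∀ z, G (0, z) = h.cov (f₀ z))
    (hGA : ∀ t τ z, G (t, A τ z) = G (t, z)) (hf₀ : ∀ τ z, f₀ (A τ z) = pslAct (ρ τ) (f₀ z)) :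
    ∃ F : C(I × ℍ, ℍ), (∀ t z, h.cov (F (t, z)) = G (t, z)) ∧ (∀ z, F (0, z) = f₀ z) ∧
      ∀ t τ z, F (t, A τ z) = pslAct (ρ τ) (F (t, z)) := by
  have hl := h.isCoveringMap.liftHomotopy_lifts G f₀ hG
  set F := h.isCoveringMap.liftHomotopy G f₀ hG
  have hl' : ∀ t z, h.cov (F (t, z)) = G (t, z) := fun t z => congrFun hl (t, z)
  have h0 : ∀ z, F (0, z) = f₀ z := h.isCoveringMap.liftHomotopy_zero G f₀ hG
  refine ⟨F, hl', h0, fun t τ z => ?_⟩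
  refine h.eq_of_lifts (f := fun t => F (t, A τ z)) (g := fun t => pslAct (ρ τ) (F (t, z)))
    (by fun_prop) ((continuous_pslAct _).comp (by fun_prop)) (fun t => ?_) (a := 0) ?_ t
  · rw [h.invariant, hl', hl', hGA]
  · rw [h0, h0, hf₀]

/-- The end point of a lift of a loop. -/
theorem exists_end_of_lift {ℓ : Path x₀ x₀} {c : C(I, ℍ)} (hc : ∀ s, h.cov (c s) = ℓ s) :
    ∃ υ, pslAct (ρ (υ * (loopClass ℓ)⁻¹ * υ⁻¹)) (c 0) = c 1 := by
  -- The lift may start anywhere over `x₀`; `υ` carries the base point to its start and so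
  -- conjugates the monodromy. The inverse appears because in `monodromy` the class of the loop
  -- brings the end point back.
  obtain ⟨υ, hυ⟩ := h.exists_deck (z := h.base) (w := c 0) (by rw [hc, h.cov_base, ℓ.source])
  refine ⟨υ, ?_⟩
  have h0 : pslAct (ρ υ⁻¹) (c 0) = h.base := by rw [map_inv, pslAct_inv_eq_iff, hυ]
  let p : Path h.base (pslAct (ρ υ⁻¹) (c 1)) :=
    ⟨⟨fun s => pslAct (ρ υ⁻¹) (c s), (continuous_pslAct _).comp c.continuous⟩, h0, rfl⟩
  have hm := h.monodromy ℓ _ p (fun s => by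
    change h.cov (pslAct (ρ υ⁻¹) (c s)) = ℓ s
    rw [h.invariant, hc])
  rw [map_mul, pslAct_mul, h0, ← hm, ← pslAct_mul, ← pslAct_mul, ← map_mul, ← map_mul]
  have : υ * (loopClass ℓ)⁻¹ * loopClass ℓ * υ⁻¹ = 1 := by group
  rw [this, map_one, pslAct_one]

end HypStructure

end Deck

/-! ## The standard lift -/

theorem exists_rot_pi_of_toPSL_eq_one {a : SL2Tilde} (ha : toPSL a = 1) :
    ∃ k : ℤ, a = rot (k * Real.pi) := by
  have hc := (QuotientGroup.eq_one_iff a.toSL).mp ha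
  have h1 := eq_rot_of_smul_I (a := a) (center_smul _ hc _)
  obtain ⟨r, -, hr⟩ := Matrix.SpecialLinearGroup.mem_center_iff.mp hc
  have h2 : a.mat 0 1 = 0 := by
    change (a.toSL : Matrix (Fin 2) (Fin 2) ℝ) 0 1 = 0
    rw [← hr]; simp
  rw [h1, rot_mat] at h2
  have h3 : Real.sin (-a.lift 0) = 0 := h2
  obtain ⟨k, hk⟩ := Real.sin_eq_zero_iff.mp h3
  exact ⟨k, by rw [hk, ← h1]⟩

theorem add_int_mul_pi {f : ℝ → ℝ} (hf : ∀ θ, f (θ + Real.pi) = f θ + Real.pi) (θ : ℝ) (k : ℤ) :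
    f (θ + k * Real.pi) = f θ + k * Real.pi := by
  induction k using Int.induction_on with
  | zero => simp
  | succ n ih =>
    push_cast at ih ⊢
    rw [add_mul, one_mul, ← add_assoc, hf, ih]; ring
  | pred n ih =>
    push_cast at ih ⊢
    have := hf (θ + (-(n : ℝ) - 1) * Real.pi)
    rw [show θ + (-(n : ℝ) - 1) * Real.pi + Real.pi = θ + -(n : ℝ) * Real.pi by ring, ih] at this
    linarith

theorem rot_int_mul_pi_mat (k : ℤ) :
    (rot (k * Real.pi)).mat = Real.cos (k * Real.pi) • (1 : Matrix (Fin 2) (Fin 2) ℝ) := by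
  rw [rot_mat, Real.sin_int_mul_pi]
  ext i j
  fin_cases i <;> fin_cases j <;> simp

theorem rot_int_mul_pi_comm (k : ℤ) (a : SL2Tilde) :
    rot (k * Real.pi) * a = a * rot (k * Real.pi) := by
  apply SL2Tilde.ext_of_lift_zero
  · rw [mat_mul, mat_mul, rot_int_mul_pi_mat]; simp
  · rw [SL2Tilde.lift_mul, SL2Tilde.lift_mul, rot_lift, rot_lift]
    have := add_int_mul_pi a.lift_add_pi (0 - k * Real.pi) k
    rw [sub_add_cancel] at this
    linarith

theorem rot_int_mul_pi_smul (k : ℤ) (v : UnitTangent) :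
    ((rot (k * Real.pi), rot (k * Real.pi)) : SL2Tilde × SL2Tilde) • v = v := by
  apply UnitTangent.ext_of_dir
  · rw [pairSMul_pt]
    change rot (k * Real.pi) * v.pt * (rot (k * Real.pi))⁻¹ = v.pt
    rw [rot_int_mul_pi_comm, mul_inv_cancel_right]
  · rw [dir_smul]
    change (rot (k * Real.pi)).mat * v.dir * (rot (k * Real.pi)).invMat = v.dir
    have : (rot (k * Real.pi)).mat * v.dir = v.dir * (rot (k * Real.pi)).mat := by
      rw [rot_int_mul_pi_mat]; simp
    rw [this, Matrix.mul_assoc, mat_mul_invMat, Matrix.mul_one]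

section Bundle

variable {S : Type*} [TopologicalSpace S] [ChartedSpace (EuclideanSpace ℝ (Fin 2)) S]
  {x₀ : S} (D : FuchsianPair x₀)

namespace FuchsianPair

/-- For arbitrary lifts of `ρ(τ)`, the failure to commute with the boundary map is a multiple `kπ`,
constant in `θ` by continuity. The central element `rot (-kπ)`, which adds `kπ` to angles, absorbs
it into the second component. -/
theorem exists_mem_standardLift (τ : FundamentalGroup S x₀) :
    ∃ a ∈ D.standardLift, toPSL a.1 = D.ρl τ ∧ toPSL a.2 = D.ρr τ := by
  obtain ⟨α, hα⟩ := toPSL_surjective (D.ρl τ)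
  obtain ⟨β, hβ⟩ := toPSL_surjective (D.ρr τ)
  have hint := D.bdry_conj τ α β hα hβ
  have hint' : ∀ θ ∈ (univ : Set ℝ), ∃ k : ℤ, D.bdry (α.lift θ) - β.lift (D.bdry θ) = k * Real.pi := by
    intro θ _
    obtain ⟨k, hk⟩ := hint θ
    exact ⟨k, by rw [hk]; ring⟩
  obtain ⟨k, hk⟩ := hint 0
  have hconst : ∀ θ, D.bdry (α.lift θ) = β.lift (D.bdry θ) + k * Real.pi := by
    intro θ
    have := eq_of_sub_mem_zmultiples isPreconnected_univ
      ((D.bdry.continuous.comp α.continuous_lift).sub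
        (β.continuous_lift.comp D.bdry.continuous)).continuousOn Real.pi hint'
        (mem_univ θ) (mem_univ 0)
    simp only [Pi.sub_apply, Function.comp_apply, hk] at this
    linarith
  have hrot : toPSL (rot ((-k : ℤ) * Real.pi)) = 1 := by
    refine (QuotientGroup.eq_one_iff _).mpr (Matrix.SpecialLinearGroup.mem_center_iff.mpr
      ⟨Real.cos ((-k : ℤ) * Real.pi), ?_, ?_⟩)
    · rw [Fintype.card_fin, Real.cos_sq', Real.sin_int_mul_pi]; simp
    · change _ = (rot ((-k : ℤ) * Real.pi)).mat
      rw [rot_int_mul_pi_mat, Matrix.scalar_apply, Matrix.smul_one_eq_diagonal]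
  have hβ' : toPSL (rot ((-k : ℤ) * Real.pi) * β) = D.ρr τ := by
    change toPSL (rot ((-k : ℤ) * Real.pi)) * toPSL β = _
    rw [hrot, one_mul, hβ]
  refine ⟨(α, rot ((-k : ℤ) * Real.pi) * β), ⟨⟨τ, hα, hβ'⟩, fun θ => ?_⟩, hα, hβ'⟩
  change D.bdry (α.lift θ) = (rot ((-k : ℤ) * Real.pi)).lift (β.lift (D.bdry θ))
  rw [hconst, rot_lift]
  push_cast
  ring

/-- An element of the standard lift over `ρ(τ)`. -/
def liftElt (τ : FundamentalGroup S x₀) : SL2Tilde × SL2Tilde :=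
  (D.exists_mem_standardLift τ).choose

theorem liftElt_mem (τ : FundamentalGroup S x₀) : D.liftElt τ ∈ D.standardLift :=
  (D.exists_mem_standardLift τ).choose_spec.1

theorem toPSL_liftElt (τ : FundamentalGroup S x₀) :
    toPSL (D.liftElt τ).1 = D.ρl τ ∧ toPSL (D.liftElt τ).2 = D.ρr τ :=
  (D.exists_mem_standardLift τ).choose_spec.2

/-- The two elements differ by a central pair `(rot (kπ), rot (lπ))`. Preserving the boundary graph
forces `k = l`, and the diagonal of the center acts trivially. Thus the choice made in `liftElt`
does not affect its action. -/
theorem smul_eq_smul_of_mem_standardLift {a b : SL2Tilde × SL2Tilde} (ha : a ∈ D.standardLift)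
    (hb : b ∈ D.standardLift) (h1 : toPSL a.1 = toPSL b.1) (h2 : toPSL a.2 = toPSL b.2)
    (v : UnitTangent) : a • v = b • v := by
  have hg := D.standardLift.mul_mem (D.standardLift.inv_mem hb) ha
  obtain ⟨k, hk⟩ := exists_rot_pi_of_toPSL_eq_one (a := (b⁻¹ * a).1) (by
    change (toPSL b.1)⁻¹ * toPSL a.1 = 1
    rw [h1, inv_mul_cancel])
  obtain ⟨l, hl⟩ := exists_rot_pi_of_toPSL_eq_one (a := (b⁻¹ * a).2) (by
    change (toPSL b.2)⁻¹ * toPSL a.2 = 1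
    rw [h2, inv_mul_cancel])
  have h0 := hg.2 0
  rw [hk, hl, rot_lift, rot_lift] at h0
  have h3 := add_int_mul_pi D.bdry_add_pi (0 - k * Real.pi) k
  rw [sub_add_cancel, h0] at h3
  have hkl : (k : ℝ) * Real.pi = l * Real.pi := by linarith
  have hba : b⁻¹ * a = (rot (k * Real.pi), rot (k * Real.pi)) := Prod.ext hk (by rw [hl, hkl])
  have : (b⁻¹ * a) • v = v := by rw [hba, rot_int_mul_pi_smul]
  rwa [mul_smul, inv_smul_eq_iff] at this

theorem toBundle_eq_iff {v w : UnitTangent} :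
    D.toBundle v = D.toBundle w ↔ ∃ a ∈ D.standardLift, a • w = v := by
  rw [toBundle, toBundle, Quotient.eq'', MulAction.orbitRel_apply]
  constructor
  · rintro ⟨a, ha⟩
    exact ⟨a.1, a.2, ha⟩
  · rintro ⟨a, ha, h⟩
    exact ⟨⟨a, ha⟩, h⟩

theorem proj_smul {τ : FundamentalGroup S x₀} {a : SL2Tilde × SL2Tilde}
    (h1 : toPSL a.1 = D.ρl τ) (h2 : toPSL a.2 = D.ρr τ) (v : UnitTangent) :
    proj (a • v) = (pslAct (D.ρl τ) (proj v).1, pslAct (D.ρr τ) (proj v).2) := by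
  rw [← h1, ← h2, pslAct_toPSL, pslAct_toPSL, proj, xCoord_smul, yCoord_smul]; rfl

/-! ## Equivariant lifts -/

variable {D} {Λ : S → S × S} {L : ℍ → ℍ × ℍ}

theorem IsEquivariantLift.unique [CompactSpace S] {L' : ℍ → ℍ × ℍ} (h : D.IsEquivariantLift Λ L)
    (h' : D.IsEquivariantLift Λ L') : L = L' := by
  have h1 := D.left.equivariant_unique (f := fun z => (L z).1) (f' := fun z => (L' z).1)
    (A := fun τ => pslAct (D.ρl τ)) (continuous_fst.comp h.continuous)
    (continuous_fst.comp h'.continuous)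
    (fun z => congrArg Prod.fst ((h.lifts z).trans (h'.lifts z).symm))
    (fun τ z => by rw [h.equivariant]) (fun τ z => by rw [h'.equivariant])
  have h2 := D.right.equivariant_unique (f := fun z => (L z).2) (f' := fun z => (L' z).2)
    (A := fun τ => pslAct (D.ρl τ)) (continuous_snd.comp h.continuous)
    (continuous_snd.comp h'.continuous)
    (fun z => congrArg Prod.snd ((h.lifts z).trans (h'.lifts z).symm))
    (fun τ z => by rw [h.equivariant]) (fun τ z => by rw [h'.equivariant])
  funext z
  exact Prod.ext (congrFun h1 z) (congrFun h2 z)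

theorem exists_equivariantLift_family {H : ℝ → S → S × S}
    (hH : ContinuousOn (Function.uncurry H) (Icc (0 : ℝ) 1 ×ˢ univ))
    (hL : D.IsEquivariantLift (H 0) L) :
    ∃ M : ℝ → ℍ → ℍ × ℍ, Continuous (Function.uncurry M) ∧ M 0 = L ∧
      ∀ t ∈ Icc (0 : ℝ) 1, D.IsEquivariantLift (H t) (M t) := by
  have hc : Continuous fun p : I × ℍ => H p.1 (D.left.cov p.2) := by
    refine hH.comp_continuous (f := fun p : I × ℍ => ((p.1 : ℝ), D.left.cov p.2)) ?_ ?_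
    · exact (continuous_subtype_val.comp continuous_fst).prodMk
        (D.left.isCoveringMap.continuous.comp continuous_snd)
    · exact fun p => ⟨p.1.2, mem_univ _⟩
  have hinv : ∀ (t : I) τ z, H t (D.left.cov (pslAct (D.ρl τ) z)) = H t (D.left.cov z) :=
    fun t τ z => by rw [D.left.invariant]
  obtain ⟨F, hF, hF0, hFe⟩ := D.left.exists_lift_homotopy (A := fun τ => pslAct (D.ρl τ))
    ⟨_, continuous_fst.comp hc⟩ ⟨_, continuous_fst.comp hL.continuous⟩
    (fun z => congrArg Prod.fst (hL.lifts z).symm)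
    (fun t τ z => congrArg Prod.fst (hinv t τ z))
    (fun τ z => congrArg Prod.fst (hL.equivariant τ z))
  obtain ⟨G, hG, hG0, hGe⟩ := D.right.exists_lift_homotopy (A := fun τ => pslAct (D.ρl τ))
    ⟨_, continuous_snd.comp hc⟩ ⟨_, continuous_snd.comp hL.continuous⟩
    (fun z => congrArg Prod.snd (hL.lifts z).symm)
    (fun t τ z => congrArg Prod.snd (hinv t τ z))
    (fun τ z => congrArg Prod.snd (hL.equivariant τ z))
  -- The lifted homotopy is continued as a constant outside `[0, 1]`, so that it is continuous in
  -- all real `t`.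
  refine ⟨fun t z => (F (projIcc 0 1 zero_le_one t, z), G (projIcc 0 1 zero_le_one t, z)),
    ?_, ?_, fun t ht => ⟨?_, fun z => ?_, fun τ z => ?_⟩⟩
  · have : Continuous fun p : ℝ × ℍ => (projIcc 0 1 (zero_le_one (α := ℝ)) p.1, p.2) :=
      (continuous_projIcc.comp continuous_fst).prodMk continuous_snd
    exact (F.continuous.comp this).prodMk (G.continuous.comp this)
  · funext z
    have h0 : projIcc 0 1 (zero_le_one (α := ℝ)) 0 = 0 := projIcc_left _
    simp only [h0]
    exact Prod.ext (hF0 z) (hG0 z)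
  · exact (F.continuous.comp (by fun_prop)).prodMk (G.continuous.comp (by fun_prop))
  · refine Prod.ext ((hF _ z).trans ?_) ((hG _ z).trans ?_) <;>
      simp only [ContinuousMap.coe_mk, Function.comp_apply, projIcc_of_mem zero_le_one ht]
  · exact Prod.ext (hFe _ τ z) (hGe _ τ z)

/-- The second component lifts the left covering through the right one, matching base points. For
the class of a loop, equivariance is tested at the end of the lifted loop, where both monodromies
return to their base points. -/
theorem exists_equivariantLift_diagonal :
    ∃ L, D.IsEquivariantLift (fun x => (x, x)) L := by
  obtain ⟨f, ⟨hf, hf'⟩, -⟩ := D.right.isCoveringMap.existsUnique_continuousMap_lifts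
    (A := ℍ) ⟨D.left.cov, D.left.isCoveringMap.continuous⟩ D.left.base D.right.base
    (D.right.cov_base.trans D.left.cov_base.symm)
  have hcov : ∀ z, D.right.cov (f z) = D.left.cov z := fun z => congrFun hf' z
  refine ⟨fun z => (z, f z), continuous_id.prodMk f.continuous, fun z => by rw [hcov],
    fun τ z => Prod.ext rfl ?_⟩
  obtain ⟨ℓ, rfl⟩ : ∃ ℓ : Path x₀ x₀, loopClass ℓ = τ :=
    ⟨_, (Quotient.exists_rep τ).choose_spec⟩
  let c := D.left.isCoveringMap.liftPath ℓ.toContinuousMap D.left.base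
    (ℓ.source.trans D.left.cov_base.symm)
  have hc : ∀ s, D.left.cov (c s) = ℓ s := fun s =>
    congrFun (D.left.isCoveringMap.liftPath_lifts ℓ.toContinuousMap D.left.base
    (ℓ.source.trans D.left.cov_base.symm)) s
  have hc0 : c 0 = D.left.base := D.left.isCoveringMap.liftPath_zero _ _ _
  have h1 := D.left.monodromy ℓ (c 1) ⟨c, hc0, rfl⟩ hc
  have h2 := D.right.monodromy ℓ (f (c 1))
    ⟨f.comp c, by change f (c 0) = _; rw [hc0, hf], rfl⟩ (fun s => by
      change D.right.cov (f (c s)) = ℓ s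
      rw [hcov, hc])
  refine D.right.eq_of_lifts (f.continuous.comp (continuous_pslAct _))
    ((continuous_pslAct _).comp f.continuous) (fun z => ?_) (a := c 1) ?_ z
  · simp only [Function.comp_apply, hcov, D.left.invariant, D.right.invariant]
  · simp only [Function.comp_apply, h1, h2, hf]

theorem exists_equivariantLift (hΛ : IsotopicToDiagonal Λ) : ∃ L, D.IsEquivariantLift Λ L := by
  obtain ⟨H, hH, -, h0, h1⟩ := hΛ
  obtain ⟨L, hL⟩ := exists_equivariantLift_diagonal (D := D)
  have h0' : H 0 = fun x => (x, x) := funext h0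
  obtain ⟨M, -, -, hM⟩ := exists_equivariantLift_family (D := D) hH.continuousOn (h0'.symm ▸ hL)
  exact ⟨M 1, funext h1 ▸ hM 1 (right_mem_Icc.mpr zero_le_one)⟩

end FuchsianPair

end Bundle

/-! ## Smooth maps to the upper half-plane and their projections -/

section UpperHalfPlane

variable {E : Type*} [NormedAddCommGroup E] [NormedSpace ℝ E]

theorem contMDiff_coe_real : ContMDiff 𝓘(ℝ, ℂ) 𝓘(ℝ, ℂ) ∞ ((↑) : ℍ → ℂ) :=
  fun _ => contMDiffAt_extChartAt

theorem hasMFDerivWithinAt_of_coe {g : E → ℍ} {g' : E →L[ℝ] ℂ} {s : Set E} {e : E}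
    (h : HasFDerivWithinAt (fun e => (g e : ℂ)) g' s e) :
    HasMFDerivWithinAt 𝓘(ℝ, E) 𝓘(ℝ, ℂ) g s e g' := by
  refine ⟨?_, ?_⟩
  · exact UpperHalfPlane.isEmbedding_coe.continuousWithinAt_iff.mpr h.continuousWithinAt
  · simpa using! h

theorem contDiffOn_ofComplex {s : Set E} {g : E → ℂ} (hg : ContDiffOn ℝ ∞ g s)
    (h : ∀ e ∈ s, 0 < (g e).im) :
    ContDiffOn ℝ ∞ (fun e => (UpperHalfPlane.ofComplex (g e) : ℂ)) s :=
  hg.congr fun e he => by rw [UpperHalfPlane.ofComplex_apply_of_im_pos (h e he)]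

theorem contMDiffOn_of_coe {g : E → ℍ} {s : Set E}
    (h : ContDiffOn ℝ ∞ (fun e => (g e : ℂ)) s) : ContMDiffOn 𝓘(ℝ, E) 𝓘(ℝ, ℂ) ∞ g s := by
  intro e he
  rw [contMDiffWithinAt_iff]
  refine ⟨UpperHalfPlane.isEmbedding_coe.continuousWithinAt_iff.mpr (h e he).continuousWithinAt, ?_⟩
  simpa using! h e he

end UpperHalfPlane

/-- The symplectic form in the coordinates of `ℂ × ℂ`. -/
def omegaC (p u v : ℂ × ℂ) : ℝ :=
  (u.1.re * v.1.im - u.1.im * v.1.re) / p.1.im ^ 2 - (u.2.re * v.2.im - u.2.im * v.2.re) / p.2.im ^ 2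

section Cov

variable {S : Type*} [TopologicalSpace S] [ChartedSpace (EuclideanSpace ℝ (Fin 2)) S]
  {x₀ : S} {ρ : FundamentalGroup S x₀ →* PSL2R}
  {E : Type*} [NormedAddCommGroup E] [NormedSpace ℝ E]

namespace HypStructure

variable (h : HypStructure x₀ ρ)

theorem hasMFDerivAt_cov (z : ℍ) : HasMFDerivAt 𝓘(ℝ, ℂ) (𝓡 2) h.cov z (h.dcov z) :=
  (h.isLocalDiffeomorph.mdifferentiable (by simp) z).hasMFDerivAt

theorem hasMFDerivWithinAt_cov_comp {g : E → ℍ} {g' : E →L[ℝ] ℂ} {s : Set E} {e : E}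
    (hg : HasFDerivWithinAt (fun e => (g e : ℂ)) g' s e) :
    HasMFDerivWithinAt 𝓘(ℝ, E) (𝓡 2) (fun e => h.cov (g e)) s e ((h.dcov (g e)).comp g') :=
  (h.hasMFDerivAt_cov (g e)).comp_hasMFDerivWithinAt e (hasMFDerivWithinAt_of_coe hg)

theorem contMDiffOn_cov_comp {g : E → ℍ} {s : Set E}
    (hg : ContDiffOn ℝ ∞ (fun e => (g e : ℂ)) s) :
    ContMDiffOn 𝓘(ℝ, E) (𝓡 2) ∞ (fun e => h.cov (g e)) s :=
  h.isLocalDiffeomorph.contMDiff.comp_contMDiffOn (contMDiffOn_of_coe hg)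

/-- Continuous lifts of smooth maps are smooth. -/
theorem contDiffOn_of_cov_comp {g : E → ℍ} {s : Set E} (hg : ContinuousOn g s)
    (hs : ContMDiffOn 𝓘(ℝ, E) (𝓡 2) ∞ (fun e => h.cov (g e)) s) :
    ContDiffOn ℝ ∞ (fun e => (g e : ℂ)) s := by
  rw [← contMDiffOn_iff_contDiffOn]
  intro e he
  have hl := h.isLocalDiffeomorph (g e)
  have h1 : ContMDiffWithinAt 𝓘(ℝ, E) 𝓘(ℝ, ℂ) ∞ (fun e => hl.localInverse (h.cov (g e))) s e :=
    ContMDiffAt.comp_contMDiffWithinAt e hl.localInverse_contMDiffAt (hs e he)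
  have h2 : ∀ᶠ e' in nhdsWithin e s, g e' = hl.localInverse (h.cov (g e')) := by
    filter_upwards [hg e he (hl.localInverse.open_target.mem_nhds hl.localInverse_mem_target)]
      with e' he'
    exact (hl.localInverse_left_inv he').symm
  have h3 : ContMDiffWithinAt 𝓘(ℝ, E) 𝓘(ℝ, ℂ) ∞ g s e :=
    h1.congr_of_eventuallyEq h2 (hl.localInverse_left_inv hl.localInverse_mem_target).symm
  exact contMDiff_coe_real.contMDiffAt.comp_contMDiffWithinAt e h3

theorem exists_dcov_eq (z : ℍ) : ∃ A : ℂ ≃L[ℝ] EuclideanSpace ℝ (Fin 2), h.dcov z = A :=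
  ⟨h.isLocalDiffeomorph.mfderivToContinuousLinearEquiv (by simp) z, rfl⟩

theorem dcov_eq_of_cov_comp_eq {g₁ g₂ : E → ℍ} {g₁' g₂' : E →L[ℝ] ℂ} {e : E}
    (h₁ : HasFDerivAt (fun e => (g₁ e : ℂ)) g₁' e) (h₂ : HasFDerivAt (fun e => (g₂ e : ℂ)) g₂' e)
    (hg : ∀ e, h.cov (g₁ e) = h.cov (g₂ e)) (a : E) :
    h.dcov (g₁ e) (g₁' a) = h.dcov (g₂ e) (g₂' a) := by
  have m₁ := (h.hasMFDerivWithinAt_cov_comp h₁.hasFDerivWithinAt).hasMFDerivAt Filter.univ_mem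
  have m₂ := (h.hasMFDerivWithinAt_cov_comp h₂.hasFDerivWithinAt).hasMFDerivAt Filter.univ_mem
  have m₁' := m₁.congr_of_eventuallyEq (Filter.Eventually.of_forall fun e => (hg e).symm)
  exact congrArg (fun A : E →L[ℝ] EuclideanSpace ℝ (Fin 2) => A a) (hasMFDerivAt_unique m₁' m₂)

/-- The definition of `area` uses an arbitrary preimage of the point. Another preimage is reached by
a Möbius map with derivative `κ = (c z + d)⁻²`, and the scaling of the imaginary part by `|κ|`
compensates the factor `|κ|²`. -/
theorem area_dcov (z : ℍ) (a b : ℂ) :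
    h.area (h.cov z) (h.dcov z a) (h.dcov z b) = hypArea z a b := by
  have hw : h.cov (Function.surjInv h.surjective (h.cov z)) = h.cov z := Function.surjInv_eq _ _
  rw [area]
  set w := Function.surjInv h.surjective (h.cov z)
  obtain ⟨τ, hτ⟩ := h.exists_deck hw.symm
  obtain ⟨g, hg⟩ := QuotientGroup.mk_surjective (ρ τ)
  rw [← hg] at hτ
  change g • z = w at hτ
  have hinv : ∀ u, h.cov (g • u) = h.cov u := fun u => by
    have := h.invariant τ u
    rwa [← hg] at this
  set G : GL (Fin 2) ℝ := Matrix.SpecialLinearGroup.toGL g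
  have hG : 0 < G.val.det := by
    have : G.val.det = 1 := g.det_coe
    rw [this]; exact one_pos
  have hd := (UpperHalfPlane.hasStrictDerivAt_smul hG z).hasDerivAt.hasFDerivAt.restrictScalars ℝ
  set κ : ℂ := G.val.det / UpperHalfPlane.denom G z ^ 2 with hκ
  have e1 : ∀ u : ℍ, G • u = g • u := fun u => rfl
  have hz : UpperHalfPlane.ofComplex (z : ℂ) = z := UpperHalfPlane.ofComplex_apply z
  have h4 : ∀ a : ℂ, h.dcov z a = h.dcov w (κ * a) := fun a => by
    have := h.dcov_eq_of_cov_comp_eq hd ((hasFDerivAt_id (𝕜 := ℝ) (z : ℂ)).congr_of_eventuallyEq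
      (UpperHalfPlane.eventuallyEq_coe_comp_ofComplex z.im_pos)) (fun e => hinv _) a
    rw [hz, e1, hτ] at this
    refine Eq.trans this.symm ?_
    simp [mul_comm]
  obtain ⟨A, hA⟩ := h.exists_dcov_eq w
  rw [h4, h4, hA, ContinuousLinearMap.inverse_equiv]
  simp only [ContinuousLinearEquiv.coe_coe, ContinuousLinearEquiv.symm_apply_apply]
  have him : w.im = z.im / Complex.normSq (UpperHalfPlane.denom G z) := by
    have hdet : G.det.val = 1 := g.det_coe
    rw [← hτ, ← e1, UpperHalfPlane.im_smul_eq_div_normSq, hdet, abs_one, one_mul]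
  have hn : Complex.normSq κ = 1 / Complex.normSq (UpperHalfPlane.denom G z) ^ 2 := by
    have : G.val.det = 1 := g.det_coe
    rw [hκ, this]; simp
  have hn0 : Complex.normSq (UpperHalfPlane.denom G z) ≠ 0 :=
    (UpperHalfPlane.normSq_denom_pos G z.im_ne_zero).ne'
  have key : ((κ * a).re * (κ * b).im - (κ * a).im * (κ * b).re) =
      Complex.normSq κ * (a.re * b.im - a.im * b.re) := by
    simp [Complex.normSq_apply]; ring
  rw [hypArea, hypArea, key, hn, him]
  have := z.im_ne_zero
  field_simp

end HypStructure

variable (D : FuchsianPair x₀)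

theorem FuchsianPair.Omega_dcov (P : ℍ × ℍ) (a b : ℂ × ℂ) :
    D.Omega (D.left.cov P.1, D.right.cov P.2) (D.left.dcov P.1 a.1, D.right.dcov P.2 a.2)
      (D.left.dcov P.1 b.1, D.right.dcov P.2 b.2) = omegaC (toC P) a b := by
  rw [Omega, HypStructure.area_dcov, HypStructure.area_dcov]; rfl

theorem FuchsianPair.hasMFDerivWithinAt_cov_comp {P : E → ℍ × ℍ} {P' : E →L[ℝ] ℂ × ℂ} {s : Set E}
    {e : E} (hP : HasFDerivWithinAt (fun e => toC (P e)) P' s e) :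
    HasMFDerivWithinAt 𝓘(ℝ, E) ((𝓡 2).prod (𝓡 2))
      (fun e => (D.left.cov (P e).1, D.right.cov (P e).2)) s e
      (((D.left.dcov (P e).1).comp ((ContinuousLinearMap.fst ℝ ℂ ℂ).comp P')).prod
        ((D.right.dcov (P e).2).comp ((ContinuousLinearMap.snd ℝ ℂ ℂ).comp P'))) :=
  (D.left.hasMFDerivWithinAt_cov_comp (g := fun e => (P e).1)
    ((ContinuousLinearMap.fst ℝ ℂ ℂ).hasFDerivAt.comp_hasFDerivWithinAt e hP)).prodMk
  (D.right.hasMFDerivWithinAt_cov_comp (g := fun e => (P e).2)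
    ((ContinuousLinearMap.snd ℝ ℂ ℂ).hasFDerivAt.comp_hasFDerivWithinAt e hP))

theorem FuchsianPair.contDiffOn_of_cov_comp {P : E → ℍ × ℍ} {s : Set E} (hP : ContinuousOn P s)
    (hs : ContMDiffOn 𝓘(ℝ, E) ((𝓡 2).prod (𝓡 2)) ∞
      (fun e => (D.left.cov (P e).1, D.right.cov (P e).2)) s) :
    ContDiffOn ℝ ∞ (fun e => toC (P e)) s :=
  (D.left.contDiffOn_of_cov_comp (continuous_fst.comp_continuousOn hP)
    (contMDiff_fst.comp_contMDiffOn hs)).prodMk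
  (D.right.contDiffOn_of_cov_comp (continuous_snd.comp_continuousOn hP)
    (contMDiff_snd.comp_contMDiffOn hs))

end Cov

/-! ## The curvature of the connection form -/

/-- On each factor `d(dx₁ / x₂) = dx₁ ∧ dx₂ / x₂²`, the hyperbolic area form. -/
theorem hasFDerivAt_eta {p : ℂ × ℂ} (h1 : p.1.im ≠ 0) (h2 : p.2.im ≠ 0) :
    ∃ η' : ℂ × ℂ →L[ℝ] ℂ × ℂ →L[ℝ] ℝ, HasFDerivAt eta η' p ∧
      ∀ u v, η' u v - η' v u = 1 / 2 * omegaC p u v := by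
  have d1 : HasFDerivAt (fun p : ℂ × ℂ => p.1.im) (Complex.imCLM ∘L ContinuousLinearMap.fst ℝ ℂ ℂ) p :=
    (Complex.imCLM ∘L ContinuousLinearMap.fst ℝ ℂ ℂ).hasFDerivAt
  have d2 : HasFDerivAt (fun p : ℂ × ℂ => p.2.im) (Complex.imCLM ∘L ContinuousLinearMap.snd ℝ ℂ ℂ) p :=
    (Complex.imCLM ∘L ContinuousLinearMap.snd ℝ ℂ ℂ).hasFDerivAt
  have i1 := (hasDerivAt_inv h1).comp_hasFDerivAt p d1
  have i2 := (hasDerivAt_inv h2).comp_hasFDerivAt p d2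
  refine ⟨_, ((i1.smul_const (Complex.reCLM ∘L ContinuousLinearMap.fst ℝ ℂ ℂ)).sub
    (i2.smul_const (Complex.reCLM ∘L ContinuousLinearMap.snd ℝ ℂ ℂ))).const_smul (1 / 2 : ℝ), ?_⟩
  intro u v
  simp [omegaC]
  field_simp
  ring

section Pullback

variable {E : Type*} [NormedAddCommGroup E] [NormedSpace ℝ E]

/-- The exterior derivative of the pull-back of `eta` is half the pull-back of the symplectic
form. -/
theorem hasFDerivWithinAt_eta_comp {ψ : E → ℂ × ℂ} {s : Set E} (hψ : ContDiffOn ℝ ∞ ψ s)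
    (hs : UniqueDiffOn ℝ s) (hcl : s ⊆ closure (interior s))
    (h1 : ∀ x ∈ s, (ψ x).1.im ≠ 0) (h2 : ∀ x ∈ s, (ψ x).2.im ≠ 0) :
    ∃ Θ' : E → E →L[ℝ] E →L[ℝ] ℝ, ∀ x ∈ s,
      HasFDerivWithinAt (fun y => eta (ψ y) ∘L fderivWithin ℝ ψ s y) (Θ' x) s x ∧
      ∀ u v, Θ' x u v - Θ' x v u =
        1 / 2 * omegaC (ψ x) (fderivWithin ℝ ψ s x u) (fderivWithin ℝ ψ s x v) := by
  have key : ∀ x ∈ s, ∃ Θ' : E →L[ℝ] E →L[ℝ] ℝ,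
      HasFDerivWithinAt (fun y => eta (ψ y) ∘L fderivWithin ℝ ψ s y) Θ' s x ∧
      ∀ u v, Θ' u v - Θ' v u =
        1 / 2 * omegaC (ψ x) (fderivWithin ℝ ψ s x u) (fderivWithin ℝ ψ s x v) := by
    intro x hx
    obtain ⟨η', hη, hη'⟩ := hasFDerivAt_eta (h1 x hx) (h2 x hx)
    have hd : HasFDerivWithinAt ψ (fderivWithin ℝ ψ s x) s x :=
      (hψ.differentiableOn (by simp) x hx).hasFDerivWithinAt
    have hd2 : HasFDerivWithinAt (fderivWithin ℝ ψ s) (fderivWithin ℝ (fderivWithin ℝ ψ s) s x) s x :=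
      ((hψ.fderivWithin (m := ∞) hs (by simp)).differentiableOn (by simp) x hx).hasFDerivWithinAt
    -- The term containing the second derivative of `ψ` is symmetric and disappears on
    -- antisymmetrizing.
    have hsymm := (hψ x hx).isSymmSndFDerivWithinAt
      (by rw [minSmoothness_of_isRCLikeNormedField]; exact WithTop.coe_le_coe.mpr le_top) hs (hcl hx) hx
    refine ⟨_, (hη.comp_hasFDerivWithinAt x hd).clm_comp hd2, fun u v => ?_⟩
    rw [← hη']
    simp [hsymm u v]
  choose! Θ' hΘ using key
  exact ⟨Θ', hΘ⟩

end Pullback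

/-! ## Potentials of Lagrangian lifts -/

section Holonomy

variable {S : Type*} [TopologicalSpace S] [ChartedSpace (EuclideanSpace ℝ (Fin 2)) S]
  {x₀ : S} {D : FuchsianPair x₀} {Λ : S → S × S} {L : ℍ → ℍ × ℍ} {f : ℍ → ℝ}

/-- `f` is a smooth primitive of the pull-back of `eta` by the smooth map `L`. -/
structure IsPotential (L : ℍ → ℍ × ℍ) (f : ℍ → ℝ) : Prop where
  contDiffOn_lift : ∀ {γ : ℝ → ℍ} {J : Set ℝ}, ContDiffOn ℝ ∞ (fun s => (γ s : ℂ)) J →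
    ContDiffOn ℝ ∞ (fun s => toC (L (γ s))) J
  contDiffOn : ∀ {γ : ℝ → ℍ} {J : Set ℝ}, ContDiffOn ℝ ∞ (fun s => (γ s : ℂ)) J →
    ContDiffOn ℝ ∞ (fun s => f (γ s)) J
  exists_hasDerivWithinAt : ∀ {γ : ℝ → ℍ} {J : Set ℝ} {s : ℝ} {γ' : ℂ},
    HasDerivWithinAt (fun s => (γ s : ℂ)) γ' J s →
    ∃ p', HasDerivWithinAt (fun s => toC (L (γ s))) p' J s ∧
      HasDerivWithinAt (fun s => f (γ s)) (eta (toC (L (γ s))) p') J s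

/-- The upper half-plane in `ℂ`. -/
abbrev halfPlane : Set ℂ := {w | 0 < w.im}

theorem isOpen_halfPlane : IsOpen halfPlane := isOpen_lt continuous_const Complex.continuous_im

theorem convex_halfPlane : Convex ℝ halfPlane :=
  convex_halfSpace_gt Complex.imLm.isLinear 0

namespace FuchsianPair

theorem IsEquivariantLift.contDiffOn (hL : D.IsEquivariantLift Λ L)
    (hΛ : ContMDiff (𝓡 2) ((𝓡 2).prod (𝓡 2)) ∞ Λ) {E : Type*} [NormedAddCommGroup E]
    [NormedSpace ℝ E] {g : E → ℍ} {s : Set E} (hg : ContDiffOn ℝ ∞ (fun e => (g e : ℂ)) s) :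
    ContDiffOn ℝ ∞ (fun e => toC (L (g e))) s := by
  refine D.contDiffOn_of_cov_comp (P := fun e => L (g e)) (hL.continuous.comp_continuousOn
    (UpperHalfPlane.isEmbedding_coe.continuousOn_iff.mpr hg.continuousOn)) ?_
  simp only [hL.lifts]
  exact hΛ.comp_contMDiffOn (D.left.contMDiffOn_cov_comp hg)

theorem contDiffOn_coe_ofComplex :
    ContDiffOn ℝ ∞ (fun w : ℂ => (UpperHalfPlane.ofComplex w : ℂ)) halfPlane :=
  contDiffOn_ofComplex contDiffOn_id fun _ h => h

theorem IsEquivariantLift.omegaC_eq_zero (hL : D.IsEquivariantLift Λ L)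
    (hΛ : ContMDiff (𝓡 2) ((𝓡 2).prod (𝓡 2)) ∞ Λ)
    (hlag : ∀ (x : S) (v w : EuclideanSpace ℝ (Fin 2)), D.Omega (Λ x)
      (mfderiv (𝓡 2) ((𝓡 2).prod (𝓡 2)) Λ x v) (mfderiv (𝓡 2) ((𝓡 2).prod (𝓡 2)) Λ x w) = 0)
    {w : ℂ} (hw : w ∈ halfPlane) {P' : ℂ →L[ℝ] ℂ × ℂ}
    (hP : HasFDerivAt (fun w => toC (L (UpperHalfPlane.ofComplex w))) P' w) (a b : ℂ) :
    omegaC (toC (L (UpperHalfPlane.ofComplex w))) (P' a) (P' b) = 0 := by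
  have h1 := (D.hasMFDerivWithinAt_cov_comp (P := fun w => L (UpperHalfPlane.ofComplex w))
    hP.hasFDerivWithinAt).hasMFDerivAt Filter.univ_mem
  have h2 := (D.left.hasMFDerivWithinAt_cov_comp (g := fun w : ℂ => UpperHalfPlane.ofComplex w)
    (((contDiffOn_coe_ofComplex.differentiableOn (by simp) w hw).differentiableAt
      (isOpen_halfPlane.mem_nhds hw)).hasFDerivAt.hasFDerivWithinAt)).hasMFDerivAt Filter.univ_mem
  set z : ℍ := UpperHalfPlane.ofComplex w
  have h3 := ((hΛ.mdifferentiable (by simp) (D.left.cov z)).hasMFDerivAt).comp w h2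
  -- The coverings after `L` and `Λ` after the left covering are the same map to `S × S`, so their
  -- derivatives agree.
  have h4 := hasMFDerivAt_unique h1
    (h3.congr_of_eventuallyEq (Filter.Eventually.of_forall fun e => hL.lifts _))
  have h5 : ∀ a : ℂ, (D.left.dcov (L z).1 (P' a).1, D.right.dcov (L z).2 (P' a).2) =
      mfderiv (𝓡 2) ((𝓡 2).prod (𝓡 2)) Λ (D.left.cov z) (D.left.dcov z
        (fderiv ℝ (fun w : ℂ => (UpperHalfPlane.ofComplex w : ℂ)) w a)) := fun a =>
    congrArg (fun A : ℂ →L[ℝ] EuclideanSpace ℝ (Fin 2) × EuclideanSpace ℝ (Fin 2) => A a) h4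
  rw [← D.Omega_dcov, h5, h5, hL.lifts]
  exact hlag _ _ _

/-- The Lagrangian condition makes the pull-back of `eta` closed, and the half-plane is convex, so
the Poincaré lemma applies. -/
theorem IsEquivariantLift.exists_potential (hL : D.IsEquivariantLift Λ L)
    (hΛ : ContMDiff (𝓡 2) ((𝓡 2).prod (𝓡 2)) ∞ Λ)
    (hlag : ∀ (x : S) (v w : EuclideanSpace ℝ (Fin 2)), D.Omega (Λ x)
      (mfderiv (𝓡 2) ((𝓡 2).prod (𝓡 2)) Λ x v) (mfderiv (𝓡 2) ((𝓡 2).prod (𝓡 2)) Λ x w) = 0) :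
    ∃ f, IsPotential L f := by
  set ψ : ℂ → ℂ × ℂ := fun w => toC (L (UpperHalfPlane.ofComplex w)) with hψdef
  have hψ : ContDiffOn ℝ ∞ ψ halfPlane := hL.contDiffOn hΛ contDiffOn_coe_ofComplex
  have hd : ∀ w ∈ halfPlane, HasFDerivAt ψ (fderiv ℝ ψ w) w := fun w hw =>
    ((hψ.differentiableOn (by simp) w hw).differentiableAt (isOpen_halfPlane.mem_nhds hw)).hasFDerivAt
  have hdw : ∀ w ∈ halfPlane, fderivWithin ℝ ψ halfPlane w = fderiv ℝ ψ w := fun w hw =>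
    fderivWithin_of_isOpen isOpen_halfPlane hw
  have him1 : ∀ w, (ψ w).1.im ≠ 0 := fun w => (L (UpperHalfPlane.ofComplex w)).1.im_ne_zero
  have him2 : ∀ w, (ψ w).2.im ≠ 0 := fun w => (L (UpperHalfPlane.ofComplex w)).2.im_ne_zero
  obtain ⟨Θ', hΘ⟩ := hasFDerivWithinAt_eta_comp hψ isOpen_halfPlane.uniqueDiffOn
    (by rw [isOpen_halfPlane.interior_eq]; exact subset_closure) (fun w _ => him1 w)
    (fun w _ => him2 w)
  obtain ⟨f₀, hf₀⟩ := convex_halfPlane.exists_forall_hasFDerivWithinAt_of_hasFDerivWithinAt_symmetric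
    (fun w hw => (hΘ w hw).1) (fun w hw u _ v _ => by
      have := (hΘ w hw).2 u v
      rw [hdw w hw, hL.omegaC_eq_zero hΛ hlag hw (hd w hw), mul_zero] at this
      linarith)
  have hf₁ : ∀ w ∈ halfPlane, HasFDerivAt f₀ (eta (ψ w) ∘L fderiv ℝ ψ w) w := fun w hw => by
    have := (hf₀ w hw).hasFDerivAt (isOpen_halfPlane.mem_nhds hw)
    rwa [hdw w hw] at this
  have hsm : ContDiffOn ℝ ∞ f₀ halfPlane := by
    rw [contDiffOn_infty_iff_fderiv_of_isOpen isOpen_halfPlane]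
    refine ⟨fun w hw => (hf₁ w hw).differentiableAt.differentiableWithinAt, ?_⟩
    have h1 : ContDiffOn ℝ ∞ (fun w => eta (ψ w)) halfPlane := by
      have i1 : ContDiffOn ℝ ∞ (fun w => ((ψ w).1.im)⁻¹) halfPlane :=
        (Complex.imCLM.contDiff.comp_contDiffOn (contDiff_fst.comp_contDiffOn hψ)).inv
          fun w _ => him1 w
      have i2 : ContDiffOn ℝ ∞ (fun w => ((ψ w).2.im)⁻¹) halfPlane :=
        (Complex.imCLM.contDiff.comp_contDiffOn (contDiff_snd.comp_contDiffOn hψ)).inv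
          fun w _ => him2 w
      exact ((i1.smul (contDiffOn_const (c := Complex.reCLM ∘L ContinuousLinearMap.fst ℝ ℂ ℂ))).sub
        (i2.smul (contDiffOn_const (c := Complex.reCLM ∘L ContinuousLinearMap.snd ℝ ℂ ℂ)))).const_smul
        (1 / 2 : ℝ)
    have h2 : ContDiffOn ℝ ∞ (fderiv ℝ ψ) halfPlane :=
      hψ.fderiv_of_isOpen isOpen_halfPlane (by simp)
    exact (h1.clm_comp h2).congr fun w hw => (hf₁ w hw).fderiv
  refine ⟨fun z => f₀ z, fun hγ => hL.contDiffOn hΛ hγ,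
    fun {γ} J hγ => hsm.comp hγ fun s _ => (γ s).im_pos, fun {γ} J s γ' hγ => ?_⟩
  have hγ0 : ((γ s : ℍ) : ℂ) ∈ halfPlane := (γ s).im_pos
  have e : ∀ s, ψ (γ s) = toC (L (γ s)) := fun s => by
    simp only [hψdef, UpperHalfPlane.ofComplex_apply]
  have h1 := (hd _ hγ0).comp_hasDerivWithinAt s hγ
  have h2 := (hf₁ _ hγ0).comp_hasDerivWithinAt s hγ
  refine ⟨fderiv ℝ ψ (γ s) γ', ?_, ?_⟩
  · exact h1.congr (fun s _ => (e s).symm) (e s).symm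
  · rw [← e]; exact h2

end FuchsianPair

/-! ## Parallel curves -/

namespace IsPotential

theorem exists_parallel (hf : IsPotential L f) {γ : ℝ → ℍ}
    (hγ : ContDiffOn ℝ ∞ (fun s => (γ s : ℂ)) (Icc 0 1)) :
    ∃ c : ℝ → UnitTangent, SmoothCurveOn c (Icc 0 1) ∧
      (∀ s ∈ Icc (0 : ℝ) 1, connForm (c s) (velocity c (Icc 0 1) s) = 0) ∧
      ∀ s, proj (c s) = L (γ s) ∧ tCoord (c s) = -f (γ s) := by
  have hu := uniqueDiffOn_Icc (zero_lt_one (α := ℝ))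
  -- With `t = -f` the form `dt + η` vanishes along the curve.
  refine ⟨fun s => frame (L (γ s)).1 (L (γ s)).2 (0 - f (γ s)),
    smoothCurveOn_frame (hf.contDiffOn_lift hγ) (contDiffOn_const.sub (hf.contDiffOn hγ)),
    fun s hs => ?_, fun s => ?_⟩
  · obtain ⟨p', hp, hF⟩ := hf.exists_hasDerivWithinAt
      ((hγ.differentiableOn (by simp)) s hs).hasDerivWithinAt
    exact connForm_frame (F := fun s => f (γ s)) (hu s hs) hp hF 0
  · rw [proj, xCoord_frame, yCoord_frame, tCoord_frame, zero_sub]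
    exact ⟨rfl, rfl⟩

theorem tCoord_add_eq (hf : IsPotential L f) {γ : ℝ → ℍ}
    (hγ : ContDiffOn ℝ ∞ (fun s => (γ s : ℂ)) (Icc 0 1)) {c : ℝ → UnitTangent}
    (hc : SmoothCurveOn c (Icc 0 1))
    (h0 : ∀ s ∈ Icc (0 : ℝ) 1, connForm (c s) (velocity c (Icc 0 1) s) = 0)
    (hcL : ∀ s ∈ Icc (0 : ℝ) 1, proj (c s) = L (γ s)) :
    tCoord (c 1) + f (γ 1) = tCoord (c 0) + f (γ 0) := by
  have h1 : ∀ s ∈ Icc (0 : ℝ) 1, ∃ p', HasDerivWithinAt (fun s => toC (L (γ s))) p' (Icc 0 1) s ∧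
      HasDerivWithinAt (fun s => f (γ s)) (eta (toC (L (γ s))) p') (Icc 0 1) s := fun s hs =>
    hf.exists_hasDerivWithinAt ((hγ.differentiableOn (by simp)) s hs).hasDerivWithinAt
  choose! p' hp hF using h1
  refine hc.tCoord_add_eq h0 (p' := p') (F := fun s => f (γ s)) (fun s hs => ?_) (fun s hs => ?_)
    (right_mem_Icc.mpr zero_le_one)
  · exact (hp s hs).congr (fun s hs => by rw [hcL s hs]) (by rw [hcL s hs])
  · rw [hcL s hs]
    exact hF s hs

end IsPotential

namespace FuchsianPair

theorem contDiffOn_pslAct (D : FuchsianPair x₀) (τ : FundamentalGroup S x₀) {γ : ℝ → ℍ}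
    {J : Set ℝ} (hγ : ContDiffOn ℝ ∞ (fun s => (γ s : ℂ)) J) :
    ContDiffOn ℝ ∞ (fun s => (pslAct (D.ρl τ) (γ s) : ℂ)) J := by
  refine D.left.contDiffOn_of_cov_comp ((continuous_pslAct _).comp_continuousOn
    (UpperHalfPlane.isEmbedding_coe.continuousOn_iff.mpr hγ.continuousOn)) ?_
  simp only [D.left.invariant]
  exact D.left.contMDiffOn_cov_comp hγ

/-- The change of the fiber coordinate, corrected by the potential, under the standard lift of
`ρ(τ)`. -/
def period (D : FuchsianPair x₀) (L : ℍ → ℍ × ℍ) (f : ℍ → ℝ) (τ : FundamentalGroup S x₀)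
    (z : ℍ) : ℝ :=
  shift (D.liftElt τ) (L z).1 (L z).2 + f (pslAct (D.ρl τ) z) - f z

theorem exists_segment (z w : ℍ) : ∃ γ : ℝ → ℍ,
    ContDiffOn ℝ ∞ (fun s => (γ s : ℂ)) (Icc 0 1) ∧ γ 0 = z ∧ γ 1 = w := by
  refine ⟨fun s => UpperHalfPlane.ofComplex (AffineMap.lineMap (z : ℂ) (w : ℂ) s), ?_, ?_, ?_⟩
  · refine contDiffOn_ofComplex (g := fun s : ℝ => AffineMap.lineMap (z : ℂ) (w : ℂ) s) ?_ ?_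
    · simp only [AffineMap.lineMap_apply_module']
      fun_prop
    · intro s hs
      exact convex_halfPlane.lineMap_mem (x := z) (y := w) z.im_pos w.im_pos hs
  · simp
  · simp

theorem IsEquivariantLift.tCoord_smul (hL : D.IsEquivariantLift Λ L) {τ : FundamentalGroup S x₀}
    {z : ℍ} {v : UnitTangent} (hv : proj v = L z) :
    tCoord (D.liftElt τ • v) + f (pslAct (D.ρl τ) z) =
      tCoord v + f z + D.period L f τ z ∧
    proj (D.liftElt τ • v) = L (pslAct (D.ρl τ) z) := by
  constructor
  · have h1 : xCoord v = (L z).1 := congrArg Prod.fst hv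
    have h2 : yCoord v = (L z).2 := congrArg Prod.snd hv
    rw [AdSFlux.tCoord_smul, period, h1, h2]
    ring
  · rw [D.proj_smul (D.toPSL_liftElt τ).1 (D.toPSL_liftElt τ).2, hv, hL.equivariant]

/-- Take a parallel curve over a segment from `z` to `w`. Its image under the isometry is parallel
over the translated segment, and `t + f` is constant along both, so the change of `t + f` is the
same at the two ends. -/
theorem IsEquivariantLift.period_eq (hL : D.IsEquivariantLift Λ L) (hf : IsPotential L f)
    (τ : FundamentalGroup S x₀) (z w : ℍ) : D.period L f τ z = D.period L f τ w := by
  have hu := uniqueDiffOn_Icc (zero_lt_one (α := ℝ))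
  obtain ⟨γ, hγ, rfl, rfl⟩ := exists_segment z w
  obtain ⟨c, hc, h0, hp⟩ := hf.exists_parallel hγ
  have h1 := hf.tCoord_add_eq hγ hc h0 fun s _ => (hp s).1
  have h2 := hf.tCoord_add_eq (D.contDiffOn_pslAct τ hγ) (hc.smul (D.liftElt τ))
    (fun s hs => by rw [connForm_smul hc _ hs (hu s hs), h0 s hs])
    (fun s _ => (hL.tCoord_smul (f := f) (hp s).1).2)
  rw [(hL.tCoord_smul (hp 0).1).1, (hL.tCoord_smul (hp 1).1).1, h1] at h2
  linarith

/-- Apply the isometries over `υ` and then over `τ` to one vector and add the changes of `t + f`; by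
`period_eq` the second change may be evaluated at `z`. -/
theorem IsEquivariantLift.period_mul (hL : D.IsEquivariantLift Λ L) (hf : IsPotential L f)
    (τ υ : FundamentalGroup S x₀) (z : ℍ) :
    D.period L f (τ * υ) z = D.period L f τ z + D.period L f υ z := by
  set v := frame (L z).1 (L z).2 0
  have hv : proj v = L z := by rw [proj, xCoord_frame, yCoord_frame]
  obtain ⟨h1, h1'⟩ := hL.tCoord_smul (f := f) (τ := υ) hv
  obtain ⟨h2, -⟩ := hL.tCoord_smul (f := f) (τ := τ) h1'
  obtain ⟨h3, -⟩ := hL.tCoord_smul (f := f) (τ := τ * υ) hv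
  have e : D.liftElt (τ * υ) • v = D.liftElt τ • D.liftElt υ • v := by
    rw [← mul_smul]
    refine D.smul_eq_smul_of_mem_standardLift (D.liftElt_mem _)
      (mul_mem (D.liftElt_mem τ) (D.liftElt_mem υ)) ?_ ?_ v
    · rw [(D.toPSL_liftElt _).1, map_mul, ← (D.toPSL_liftElt τ).1, ← (D.toPSL_liftElt υ).1]; rfl
    · rw [(D.toPSL_liftElt _).2, map_mul, ← (D.toPSL_liftElt τ).2, ← (D.toPSL_liftElt υ).2]; rfl
  rw [e, map_mul, pslAct_mul, h2, h1, hL.period_eq hf τ _ z] at h3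
  linarith

/-- The holonomy homomorphism determined by a potential. -/
def IsEquivariantLift.holonomy (hL : D.IsEquivariantLift Λ L) (hf : IsPotential L f) :
    Additive (FundamentalGroup S x₀) →+ ℝ :=
  -- The sign reflects the convention of `monodromy`: the lift of a loop ends at a translate by the
  -- inverse of its class.
  AddMonoidHom.mk' (fun τ => -D.period L f τ.toMul D.left.base) fun τ υ => by
    change -D.period L f (τ.toMul * υ.toMul) _ = _
    rw [hL.period_mul hf]
    ring

/-- Conjugation is invisible in `ℝ`, and the inverse cancels the sign in the definition. This form
matches the end point of a lifted loop with an arbitrary starting point. -/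
theorem IsEquivariantLift.holonomy_eq (hL : D.IsEquivariantLift Λ L) (hf : IsPotential L f)
    (τ υ : FundamentalGroup S x₀) (z : ℍ) :
    hL.holonomy hf (Additive.ofMul τ) = D.period L f (υ * τ⁻¹ * υ⁻¹) z := by
  have h1 : hL.holonomy hf (Additive.ofMul (υ * τ⁻¹ * υ⁻¹)) =
      -hL.holonomy hf (Additive.ofMul τ) := by
    rw [ofMul_mul, ofMul_mul, map_add, map_add, ofMul_inv, ofMul_inv, map_neg, map_neg]
    ring
  have h2 : hL.holonomy hf (Additive.ofMul (υ * τ⁻¹ * υ⁻¹)) =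
    -D.period L f (υ * τ⁻¹ * υ⁻¹) D.left.base := rfl
  rw [hL.period_eq hf _ z D.left.base]
  linarith

/-- The lift of a loop through the left covering, extended to the real line. -/
theorem exists_lift_loop (D : FuchsianPair x₀) {ℓ : Path x₀ x₀} (hℓ : IsSmoothLoop ℓ) {z₀ : ℍ}
    (hz₀ : D.left.cov z₀ = x₀) :
    ∃ γ : ℝ → ℍ, Continuous γ ∧ ContDiffOn ℝ ∞ (fun s => (γ s : ℂ)) (Icc 0 1) ∧ γ 0 = z₀ ∧
      (∀ s, D.left.cov (γ s) = ℓ.extend s) ∧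
      ∃ υ, pslAct (D.ρl (υ * (loopClass ℓ)⁻¹ * υ⁻¹)) (γ 0) = γ 1 := by
  have hstart : ℓ.toContinuousMap 0 = D.left.cov z₀ := ℓ.source.trans hz₀.symm
  set c := D.left.isCoveringMap.liftPath ℓ.toContinuousMap z₀ hstart
  have hc : ∀ s, D.left.cov (c s) = ℓ s := fun s =>
    congrFun (D.left.isCoveringMap.liftPath_lifts ℓ.toContinuousMap z₀ hstart) s
  have hc0 : c 0 = z₀ := D.left.isCoveringMap.liftPath_zero _ _ _
  have h0 : projIcc 0 1 (zero_le_one (α := ℝ)) 0 = 0 := projIcc_left _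
  have h1 : projIcc 0 1 (zero_le_one (α := ℝ)) 1 = 1 := projIcc_right _
  have hcont : Continuous fun s : ℝ => c (projIcc 0 1 zero_le_one s) :=
    c.continuous.comp continuous_projIcc
  have hcov : ∀ s : ℝ, D.left.cov (c (projIcc 0 1 zero_le_one s)) = ℓ.extend s := fun s => by
    rw [hc]; rfl
  refine ⟨fun s => c (projIcc 0 1 zero_le_one s), hcont,
    D.left.contDiffOn_of_cov_comp hcont.continuousOn ?_, by simp only [h0, hc0], hcov, ?_⟩
  · simp only [hcov]
    exact hℓ
  · simp only [h0, h1]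
    exact D.left.exists_end_of_lift hc

theorem IsEquivariantLift.isHolonomy [CompactSpace S] (hL : D.IsEquivariantLift Λ L)
    (hf : IsPotential L f) : D.IsHolonomy Λ (hL.holonomy hf) := by
  intro ℓ hℓ
  constructor
  · obtain ⟨γ, -, hγ, -, hcov, -⟩ := D.exists_lift_loop hℓ D.left.cov_base
    obtain ⟨c, hc, h0, hp⟩ := hf.exists_parallel hγ
    refine ⟨fun s => D.toBundle (c s), fun s => ⟨L, hL, γ s, c s, ?_, ?_, rfl⟩, c, hc, h0,
      fun s => rfl⟩
    · rw [hcov]; simp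
    · rw [projectsTo_iff]
      exact ⟨congrArg Prod.fst (hp s).1, congrArg Prod.snd (hp s).1⟩
  · rintro p ⟨hfib, c, hc, h0, hpc⟩ t
    -- The fiber condition concerns classes only. Another representative lies over a translate of `L
    -- z`, which by equivariance is again a value of `L`.
    have hz : ∀ s : I, ∃ z, D.left.cov z = ℓ s ∧ proj (c s) = L z := by
      intro s
      obtain ⟨L', hL', z, v, hzs, hv, hvp⟩ := hfib s
      rw [hL'.unique hL] at hv
      rw [← hpc] at hvp
      obtain ⟨a, ⟨⟨τ, h1, h2⟩, -⟩, ha⟩ := D.toBundle_eq_iff.mp hvp.symm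
      have hv' : proj v = L z := Prod.ext (projectsTo_iff.mp hv).1 (projectsTo_iff.mp hv).2
      exact ⟨pslAct (D.ρl τ) z, by rw [D.left.invariant, hzs],
        by rw [← ha, D.proj_smul h1 h2, hv', hL.equivariant]⟩
    obtain ⟨z₀, hz₀, hcz₀⟩ := hz 0
    obtain ⟨γ, hγc, hγ, hγ0, hcov, υ, hυ⟩ := D.exists_lift_loop hℓ (hz₀.trans ℓ.source)
    have hΛc : ∀ s : I, (D.left.cov (proj (c s)).1, D.right.cov (proj (c s)).2) =
        (D.left.cov (L (γ s)).1, D.right.cov (L (γ s)).2) := fun s => by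
      obtain ⟨z, hz, hzL⟩ := hz s
      rw [hzL, hL.lifts, hL.lifts, hz, hcov]; simp
    have hI : Continuous fun s : I => (s : ℝ) := continuous_subtype_val
    -- In each factor the two curves have the same image in `S` and the same starting point, so
    -- uniqueness of lifts applies.
    have hproj : ∀ s : I, proj (c s) = L (γ s) := fun s => by
      refine Prod.ext ?_ ?_
      · refine D.left.eq_of_lifts (f := fun s : I => (proj (c s)).1)
          (g := fun s : I => (L (γ s)).1) ?_ ?_ (fun s => congrArg Prod.fst (hΛc s)) (a := 0) ?_ s
        · exact hc.continuousOn_xCoord.comp_continuous hI fun s => s.2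
        · exact continuous_fst.comp (hL.continuous.comp (hγc.comp hI))
        · simp only [hcz₀, Icc.coe_zero, hγ0] at *
      · refine D.right.eq_of_lifts (f := fun s : I => (proj (c s)).2)
          (g := fun s : I => (L (γ s)).2) ?_ ?_ (fun s => congrArg Prod.snd (hΛc s)) (a := 0) ?_ s
        · exact hc.continuousOn_yCoord.comp_continuous hI fun s => s.2
        · exact continuous_snd.comp (hL.continuous.comp (hγc.comp hI))
        · simp only [hcz₀, Icc.coe_zero, hγ0] at *
    have htr := hf.tCoord_add_eq hγ hc h0 fun s hs => hproj ⟨s, hs⟩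
    have hp0 : proj (c 0) = L (γ 0) := hproj 0
    have hp1 : proj (c 1) = L (γ 1) := hproj 1
    have hb0 : D.toBundle (c 0) = p 0 := hpc 0
    have hb1 : D.toBundle (c 1) = p 1 := hpc 1
    rw [hL.holonomy_eq hf (loopClass ℓ) υ (γ 0)]
    set τ := υ * (loopClass ℓ)⁻¹ * υ⁻¹
    obtain ⟨hut, hup⟩ := hL.tCoord_smul (f := f) (τ := τ) hp0
    rw [hυ] at hut hup
    -- This vector represents `p 0` and lies over the same point as `c 1`, so the flow time from `p
    -- 1` to `p 0` is a difference of fiber coordinates.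
    set u := D.liftElt τ • c 0
    have hbu : D.toBundle u = p 0 := hb0 ▸ D.toBundle_eq_iff.mpr ⟨_, D.liftElt_mem τ, rfl⟩
    have htu : tCoord u = tCoord (c 1) + D.period L f τ (γ 0) := by linarith
    have hxy : proj u = proj (c 1) := hup.trans hp1.symm
    constructor
    · rintro ⟨v, w, hv, hw, hfl⟩
      rw [geodesicFlow_iff] at hfl
      obtain ⟨a, ha, rfl⟩ := D.toBundle_eq_iff.mp (hv.trans hb1.symm)
      obtain ⟨b, hb, rfl⟩ := D.toBundle_eq_iff.mp (hw.trans hbu.symm)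
      obtain ⟨⟨τa, ha1, ha2⟩, -⟩ := id ha
      obtain ⟨⟨τb, hb1, hb2⟩, -⟩ := id hb
      have e1 : proj (b • u) = proj (a • c 1) := by
        rw [hfl, proj, xCoord_frame, yCoord_frame]; rfl
      rw [D.proj_smul ha1 ha2, D.proj_smul hb1 hb2, hxy] at e1
      -- Other representatives give the same time: since the deck groups act freely, the two
      -- isometries lie over the same element of `ρ(π₁(S))`, hence act equally and shift `t` by the
      -- same amount.
      have r1 := D.left.rep_eq_of_apply_eq (congrArg Prod.fst e1)
      have r2 := D.right.rep_eq_of_apply_eq (congrArg Prod.snd e1)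
      have e2 := D.smul_eq_smul_of_mem_standardLift hb ha (by rw [ha1, hb1, r1])
        (by rw [ha2, hb2, r2]) u
      have e3 := congrArg tCoord hfl
      have ex : xCoord u = xCoord (c 1) := congrArg Prod.fst hxy
      have ey : yCoord u = yCoord (c 1) := congrArg Prod.snd hxy
      rw [e2, tCoord_frame, AdSFlux.tCoord_smul a u, AdSFlux.tCoord_smul a (c 1), ex, ey] at e3
      linarith
    · rintro rfl
      refine ⟨c 1, u, hb1, hbu, geodesicFlow_iff.mpr ?_⟩
      have ex : xCoord u = xCoord (c 1) := congrArg Prod.fst hxy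
      have ey : yCoord u = yCoord (c 1) := congrArg Prod.snd hxy
      rw [← htu, ← ex, ← ey, frame_coords]

end FuchsianPair

end Holonomy

/-! ## Stokes' theorem on the unit square -/

/-- The unit square. -/
abbrev unitSquare : Set (ℝ × ℝ) := Icc (0 : ℝ) 1 ×ˢ Icc (0 : ℝ) 1

theorem interior_unitSquare : interior unitSquare = Ioo (0 : ℝ) 1 ×ˢ Ioo (0 : ℝ) 1 := by
  rw [interior_prod_eq, interior_Icc]

theorem uniqueDiffOn_unitSquare : UniqueDiffOn ℝ unitSquare :=
  (uniqueDiffOn_Icc zero_lt_one).prod (uniqueDiffOn_Icc zero_lt_one)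

theorem unitSquare_subset_closure : unitSquare ⊆ closure (interior unitSquare) := by
  rw [interior_unitSquare, closure_prod_eq, closure_Ioo zero_ne_one]

section Square

variable {ψ : ℝ × ℝ → ℂ × ℂ} {t s : ℝ}

theorem hasDerivWithinAt_fst_slice (hψ : ContDiffOn ℝ ∞ ψ unitSquare) (ht : t ∈ Icc (0 : ℝ) 1)
    (hs : s ∈ Icc (0 : ℝ) 1) :
    HasDerivWithinAt (fun t => ψ (t, s)) (fderivWithin ℝ ψ unitSquare (t, s) (1, 0)) (Icc 0 1) t :=
  ((hψ.differentiableOn (by simp) (t, s) ⟨ht, hs⟩).hasFDerivWithinAt).comp_hasDerivWithinAt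
    (f := fun t => (t, s)) t ((hasDerivWithinAt_id t _).prodMk (hasDerivWithinAt_const t _ s))
    fun _ h => ⟨h, hs⟩

theorem hasDerivWithinAt_snd_slice (hψ : ContDiffOn ℝ ∞ ψ unitSquare) (ht : t ∈ Icc (0 : ℝ) 1)
    (hs : s ∈ Icc (0 : ℝ) 1) :
    HasDerivWithinAt (fun s => ψ (t, s)) (fderivWithin ℝ ψ unitSquare (t, s) (0, 1)) (Icc 0 1) s :=
  ((hψ.differentiableOn (by simp) (t, s) ⟨ht, hs⟩).hasFDerivWithinAt).comp_hasDerivWithinAt s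
    ((hasDerivWithinAt_const s _ t).prodMk (hasDerivWithinAt_id s _)) fun _ h => ⟨ht, h⟩

/-- `F` is a primitive of `eta` along the curve `P`. -/
def IsPrimitive (P : ℝ → ℂ × ℂ) (F : ℝ → ℝ) : Prop :=
  ∀ s ∈ Icc (0 : ℝ) 1, ∀ p', HasDerivWithinAt P p' (Icc 0 1) s →
    HasDerivWithinAt F (eta (P s) p') (Icc 0 1) s

theorem IsPrimitive.integral_eq {P p' : ℝ → ℂ × ℂ} {F q : ℝ → ℝ} (hF : IsPrimitive P F)
    (hP : ∀ s ∈ Icc (0 : ℝ) 1, HasDerivWithinAt P (p' s) (Icc 0 1) s)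
    (hq : ContinuousOn q (Icc 0 1)) (he : ∀ s ∈ Icc (0 : ℝ) 1, q s = eta (P s) (p' s)) :
    ∫ s in (0 : ℝ)..1, q s = F 1 - F 0 := by
  refine intervalIntegral.integral_eq_sub_of_hasDerivAt_of_le zero_le_one
    (fun s hs => (hF s hs _ (hP s hs)).continuousWithinAt) (fun s hs => ?_)
    (by rw [← uIcc_of_le (zero_le_one (α := ℝ))] at hq; exact hq.intervalIntegrable)
  rw [he s (Ioo_subset_Icc_self hs)]
  exact (hF s (Ioo_subset_Icc_self hs) _ (hP s (Ioo_subset_Icc_self hs))).hasDerivAt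
    (Icc_mem_nhds hs.1 hs.2)

theorem continuousOn_eta_comp {E : Type*} [TopologicalSpace E] {φ : E → ℂ × ℂ} {A : Set E}
    (hφ : ContinuousOn φ A) (h1 : ∀ x ∈ A, (φ x).1.im ≠ 0) (h2 : ∀ x ∈ A, (φ x).2.im ≠ 0) :
    ContinuousOn (fun x => eta (φ x)) A := fun x hx =>
  (hasFDerivAt_eta (h1 x hx) (h2 x hx)).choose_spec.1.continuousAt.comp_continuousWithinAt (hφ x hx)

/-- This is Green's formula for the pull-back `θ` of `eta`. Its integrals over the four sides are
expressed by primitives, since each side will be evaluated in a different way. -/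
theorem integral_omegaC_eq (hψ : ContDiffOn ℝ ∞ ψ unitSquare)
    (h1 : ∀ x ∈ unitSquare, (ψ x).1.im ≠ 0) (h2 : ∀ x ∈ unitSquare, (ψ x).2.im ≠ 0)
    {F₀ F₁ G₀ G₁ : ℝ → ℝ} (hF₀ : IsPrimitive (fun s => ψ (0, s)) F₀)
    (hF₁ : IsPrimitive (fun s => ψ (1, s)) F₁) (hG₀ : IsPrimitive (fun t => ψ (t, 0)) G₀)
    (hG₁ : IsPrimitive (fun t => ψ (t, 1)) G₁) :
    ∫ t in (0 : ℝ)..1, ∫ s in (0 : ℝ)..1, 1 / 2 * omegaC (ψ (t, s))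
      (fderivWithin ℝ ψ unitSquare (t, s) (0, 1)) (fderivWithin ℝ ψ unitSquare (t, s) (1, 0)) =
    (G₁ 1 - G₁ 0) - (G₀ 1 - G₀ 0) - (F₁ 1 - F₁ 0) + (F₀ 1 - F₀ 0) := by
  obtain ⟨Θ', hΘ⟩ := hasFDerivWithinAt_eta_comp hψ uniqueDiffOn_unitSquare
    unitSquare_subset_closure h1 h2
  set θ : ℝ × ℝ → ℝ × ℝ →L[ℝ] ℝ := fun a => eta (ψ a) ∘L fderivWithin ℝ ψ unitSquare a with hθ
  have hdψ : ContinuousOn (fderivWithin ℝ ψ unitSquare) unitSquare :=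
    hψ.continuousOn_fderivWithin uniqueDiffOn_unitSquare (by simp)
  have hcθ : ∀ v, ContinuousOn (fun a => θ a v) unitSquare := fun v =>
    ((continuousOn_eta_comp hψ.continuousOn h1 h2).clm_comp hdψ).clm_apply continuousOn_const
  have hnhds : ∀ a ∈ Ioo (0 : ℝ) 1 ×ˢ Ioo (0 : ℝ) 1, unitSquare ∈ nhds a := fun a ha => by
    rw [← interior_unitSquare] at ha
    exact mem_interior_iff_mem_nhds.mp ha
  have hint : ∀ a ∈ Ioo (0 : ℝ) 1 ×ˢ Ioo (0 : ℝ) 1, HasFDerivAt θ (Θ' a) a := fun a ha =>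
    (hΘ a (mem_of_mem_nhds (hnhds a ha))).1.hasFDerivAt (hnhds a ha)
  have happ : ∀ (v : ℝ × ℝ), ∀ a ∈ Ioo (0 : ℝ) 1 ×ˢ Ioo (0 : ℝ) 1,
      HasFDerivAt (fun a => θ a v) (ContinuousLinearMap.apply ℝ ℝ v ∘L Θ' a) a := fun v a ha =>
    (ContinuousLinearMap.apply ℝ ℝ v).hasFDerivAt.comp a (hint a ha)
  have hdiv : ∀ a ∈ unitSquare, (-(ContinuousLinearMap.apply ℝ ℝ ((0 : ℝ), (1 : ℝ)) ∘L Θ' a)) (1, 0) +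
      (ContinuousLinearMap.apply ℝ ℝ ((1 : ℝ), (0 : ℝ)) ∘L Θ' a) (0, 1) =
      1 / 2 * omegaC (ψ a) (fderivWithin ℝ ψ unitSquare a (0, 1))
        (fderivWithin ℝ ψ unitSquare a (1, 0)) := fun a ha => by
    rw [← (hΘ a ha).2]
    simp
    ring
  have hcω : ContinuousOn (fun a => 1 / 2 * omegaC (ψ a) (fderivWithin ℝ ψ unitSquare a (0, 1))
        (fderivWithin ℝ ψ unitSquare a (1, 0))) unitSquare := by
    have c0 := hψ.continuousOn
    have c1 : ContinuousOn (fun a => fderivWithin ℝ ψ unitSquare a (0, 1)) unitSquare :=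
      hdψ.clm_apply continuousOn_const
    have c2 : ContinuousOn (fun a => fderivWithin ℝ ψ unitSquare a (1, 0)) unitSquare :=
      hdψ.clm_apply continuousOn_const
    have r : Continuous Complex.re := Complex.continuous_re
    have i : Continuous Complex.im := Complex.continuous_im
    unfold omegaC
    refine continuousOn_const.mul (ContinuousOn.sub ?_ ?_)
    · exact ((((r.comp_continuousOn c1.fst).mul (i.comp_continuousOn c2.fst)).sub
        ((i.comp_continuousOn c1.fst).mul (r.comp_continuousOn c2.fst))).div
        ((i.comp_continuousOn c0.fst).pow 2) fun a ha => pow_ne_zero 2 (h1 a ha))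
    · exact ((((r.comp_continuousOn c1.snd).mul (i.comp_continuousOn c2.snd)).sub
        ((i.comp_continuousOn c1.snd).mul (r.comp_continuousOn c2.snd))).div
        ((i.comp_continuousOn c0.snd).pow 2) fun a ha => pow_ne_zero 2 (h2 a ha))
  have hu : uIcc (0 : ℝ) 1 = Icc 0 1 := uIcc_of_le zero_le_one
  -- In the coordinates `(t, s)` the vector field `(-θ(∂s), θ(∂t))` has divergence `dθ(∂s, ∂t)`.
  have hdivint := integral2_divergence_prod_of_hasFDerivAt (fun a => -θ a (0, 1)) (fun a => θ a (1, 0))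
    (fun a => -(ContinuousLinearMap.apply ℝ ℝ ((0 : ℝ), (1 : ℝ)) ∘L Θ' a))
    (fun a => ContinuousLinearMap.apply ℝ ℝ ((1 : ℝ), (0 : ℝ)) ∘L Θ' a) 0 0 1 1
    (by rw [hu]; exact (hcθ _).neg) (by rw [hu]; exact hcθ _)
    (by
      rw [min_eq_left zero_le_one, max_eq_right zero_le_one]
      exact fun a ha => (happ _ a ha).neg)
    (by
      rw [min_eq_left zero_le_one, max_eq_right zero_le_one]
      exact fun a ha => happ _ a ha)
    (by
      rw [hu]
      refine ((hcω.integrableOn_compact (isCompact_Icc.prod isCompact_Icc)).congr_fun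
        (fun a ha => (hdiv a ha).symm) (measurableSet_Icc.prod measurableSet_Icc)))
  have hm0 : (0 : ℝ) ∈ Icc (0 : ℝ) 1 := left_mem_Icc.mpr zero_le_one
  have hm1 : (1 : ℝ) ∈ Icc (0 : ℝ) 1 := right_mem_Icc.mpr zero_le_one
  have b1 := hG₁.integral_eq (q := fun t => θ (t, 1) (1, 0))
    (fun t ht => hasDerivWithinAt_fst_slice hψ ht hm1)
    ((hcθ _).comp (by fun_prop) fun t ht => ⟨ht, hm1⟩) fun t _ => rfl
  have b0 := hG₀.integral_eq (q := fun t => θ (t, 0) (1, 0))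
    (fun t ht => hasDerivWithinAt_fst_slice hψ ht hm0)
    ((hcθ _).comp (by fun_prop) fun t ht => ⟨ht, hm0⟩) fun t _ => rfl
  have d1 := hF₁.integral_eq (q := fun s => θ (1, s) (0, 1))
    (fun s hs => hasDerivWithinAt_snd_slice hψ hm1 hs)
    ((hcθ _).comp (by fun_prop) fun s hs => ⟨hm1, hs⟩) fun s _ => rfl
  have d0 := hF₀.integral_eq (q := fun s => θ (0, s) (0, 1))
    (fun s hs => hasDerivWithinAt_snd_slice hψ hm0 hs)
    ((hcθ _).comp (by fun_prop) fun s hs => ⟨hm0, hs⟩) fun s _ => rfl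
  rw [intervalIntegral.integral_neg, intervalIntegral.integral_neg, b1, b0, d1, d0] at hdivint
  have hlhs : ∫ t in (0 : ℝ)..1, ∫ s in (0 : ℝ)..1, 1 / 2 * omegaC (ψ (t, s))
      (fderivWithin ℝ ψ unitSquare (t, s) (0, 1)) (fderivWithin ℝ ψ unitSquare (t, s) (1, 0)) =
      ∫ t in (0 : ℝ)..1, ∫ s in (0 : ℝ)..1,
        (-(ContinuousLinearMap.apply ℝ ℝ ((0 : ℝ), (1 : ℝ)) ∘L Θ' (t, s))) (1, 0) +
        (ContinuousLinearMap.apply ℝ ℝ ((1 : ℝ), (0 : ℝ)) ∘L Θ' (t, s)) (0, 1) := by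
    refine intervalIntegral.integral_congr fun t ht => intervalIntegral.integral_congr fun s hs => ?_
    rw [hu] at ht hs
    exact (hdiv (t, s) ⟨ht, hs⟩).symm
  rw [hlhs, hdivint]
  ring

/-- In dimension one no closedness is needed. This serves the sides `s = 0, 1` of the square, which
do not lie in a single Lagrangian. -/
theorem exists_isPrimitive {P : ℝ → ℍ × ℍ} (hP : ContDiffOn ℝ ∞ (fun s => toC (P s)) (Icc 0 1)) :
    ∃ G, ContDiffOn ℝ ∞ G (Icc 0 1) ∧ IsPrimitive (fun s => toC (P s)) G := by
  have hu := uniqueDiffOn_Icc (zero_lt_one (α := ℝ))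
  set p' : ℝ → ℂ × ℂ := derivWithin (fun s => toC (P s)) (Icc 0 1)
  have hp' : ContDiffOn ℝ ∞ p' (Icc 0 1) := hP.derivWithin hu (by simp)
  have hq : ContDiffOn ℝ ∞ (fun s => eta (toC (P s)) (p' s)) (Icc 0 1) := by
    have i1 : ContDiffOn ℝ ∞ (fun s => (toC (P s)).1.im) (Icc 0 1) :=
      Complex.imCLM.contDiff.comp_contDiffOn (contDiff_fst.comp_contDiffOn hP)
    have i2 : ContDiffOn ℝ ∞ (fun s => (toC (P s)).2.im) (Icc 0 1) :=
      Complex.imCLM.contDiff.comp_contDiffOn (contDiff_snd.comp_contDiffOn hP)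
    have r1 : ContDiffOn ℝ ∞ (fun s => (p' s).1.re) (Icc 0 1) :=
      Complex.reCLM.contDiff.comp_contDiffOn (contDiff_fst.comp_contDiffOn hp')
    have r2 : ContDiffOn ℝ ∞ (fun s => (p' s).2.re) (Icc 0 1) :=
      Complex.reCLM.contDiff.comp_contDiffOn (contDiff_snd.comp_contDiffOn hp')
    simp only [eta_apply]
    exact contDiffOn_const.mul ((r1.div i1 fun s _ => (P s).1.im_ne_zero).sub
      (r2.div i2 fun s _ => (P s).2.im_ne_zero))
  obtain ⟨G, hG⟩ := (convex_Icc (0 : ℝ) 1).exists_forall_hasDerivWithinAt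
    (hq.differentiableOn (by simp))
  refine ⟨G, (contDiffOn_infty_iff_derivWithin hu).mpr ⟨fun s hs => (hG s hs).differentiableWithinAt,
    hq.congr fun s hs => (hG s hs).derivWithin (hu s hs)⟩, fun s hs v hv => ?_⟩
  have := hG s hs
  rwa [show p' s = v from hv.derivWithin (hu s hs)] at this

theorem IsPotential.isPrimitive {L : ℍ → ℍ × ℍ} {f : ℍ → ℝ} (hf : IsPotential L f) {γ : ℝ → ℍ}
    (hγ : ContDiffOn ℝ ∞ (fun s => (γ s : ℂ)) (Icc 0 1)) :
    IsPrimitive (fun s => toC (L (γ s))) (fun s => f (γ s)) := fun s hs v hv => by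
  obtain ⟨p', hp, hF⟩ := hf.exists_hasDerivWithinAt
    ((hγ.differentiableOn (by simp)) s hs).hasDerivWithinAt
  rwa [(uniqueDiffOn_Icc (zero_lt_one (α := ℝ)) s hs).eq_deriv _ hp hv] at hF

/-- Primitives along a curve and along its translate differ by the change of `shift`. -/
theorem IsPrimitive.sub_eq_of_smul {P Q : ℝ → ℍ × ℍ} {G K : ℝ → ℝ} {a : SL2Tilde × SL2Tilde}
    (hP : ContDiffOn ℝ ∞ (fun s => toC (P s)) (Icc 0 1))
    (hQ : ContDiffOn ℝ ∞ (fun s => toC (Q s)) (Icc 0 1))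
    (hG : IsPrimitive (fun s => toC (P s)) G) (hGs : ContDiffOn ℝ ∞ G (Icc 0 1))
    (hK : IsPrimitive (fun s => toC (Q s)) K)
    (ha : ∀ s ∈ Icc (0 : ℝ) 1, Q s = (a.1.toSL • (P s).1, a.2.toSL • (P s).2)) :
    (K 1 - K 0) - (G 1 - G 0) = shift a (P 0).1 (P 0).2 - shift a (P 1).1 (P 1).2 := by
  have hu := uniqueDiffOn_Icc (zero_lt_one (α := ℝ))
  have hd : ∀ {R : ℝ → ℍ × ℍ}, ContDiffOn ℝ ∞ (fun s => toC (R s)) (Icc 0 1) → ∀ s ∈ Icc (0 : ℝ) 1,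
      HasDerivWithinAt (fun s => toC (R s)) (derivWithin (fun s => toC (R s)) (Icc 0 1) s) (Icc 0 1) s :=
    fun hR s hs => ((hR.differentiableOn (by simp)) s hs).hasDerivWithinAt
  -- The curve with fiber coordinate `-G` is parallel over `P`. Its image under `a` is parallel over
  -- `Q`, so there `t + K` is constant.
  obtain ⟨c, hc⟩ : ∃ c : ℝ → UnitTangent, c = fun s => frame (P s).1 (P s).2 (0 - G s) := ⟨_, rfl⟩
  have hcs : SmoothCurveOn c (Icc 0 1) := by
    rw [hc]
    exact smoothCurveOn_frame hP (contDiffOn_const.sub hGs)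
  have hc0 : ∀ s ∈ Icc (0 : ℝ) 1, connForm (c s) (velocity c (Icc 0 1) s) = 0 := fun s hs => by
    rw [hc]
    exact connForm_frame (hu s hs) (hd hP s hs) (hG s hs _ (hd hP s hs)) 0
  have hproj : ∀ s ∈ Icc (0 : ℝ) 1, proj (a • c s) = Q s := fun s hs => by
    rw [ha s hs, proj, xCoord_smul, yCoord_smul, hc, xCoord_frame, yCoord_frame]
  have ht : ∀ s, tCoord (a • c s) = 0 - G s + shift a (P s).1 (P s).2 := fun s => by
    rw [tCoord_smul, hc, tCoord_frame, xCoord_frame, yCoord_frame]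
  have key := (hcs.smul a).tCoord_add_eq
    (fun s hs => by rw [connForm_smul hcs _ hs (hu s hs), hc0 s hs])
    (p' := derivWithin (fun s => toC (Q s)) (Icc 0 1)) (F := K)
    (fun s hs => (hd hQ s hs).congr (fun s hs => by rw [hproj s hs]) (by rw [hproj s hs]))
    (fun s hs => by rw [hproj s hs]; exact hK s hs _ (hd hQ s hs))
    (right_mem_Icc.mpr zero_le_one)
  rw [ht, ht] at key
  linarith

end Square

/-! ## The flux -/

section Flux

variable {S : Type*} [TopologicalSpace S] [ChartedSpace (EuclideanSpace ℝ (Fin 2)) S]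
  {x₀ : S} {D : FuchsianPair x₀}

namespace FuchsianPair

theorem mfderivWithin_eq_dcov (D : FuchsianPair x₀) {P : ℝ → ℍ × ℍ} {Φ : ℝ → S × S} {p' : ℂ × ℂ}
    {J : Set ℝ} {s : ℝ} (hs : s ∈ J) (hJ : UniqueDiffWithinAt ℝ J s)
    (hP : HasDerivWithinAt (fun s => toC (P s)) p' J s)
    (hΦ : ∀ s ∈ J, Φ s = (D.left.cov (P s).1, D.right.cov (P s).2)) :
    (mfderivWithin 𝓘(ℝ, ℝ) ((𝓡 2).prod (𝓡 2)) Φ J s :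
      ℝ →L[ℝ] EuclideanSpace ℝ (Fin 2) × EuclideanSpace ℝ (Fin 2)) (1 : ℝ) =
      (D.left.dcov (P s).1 p'.1, D.right.dcov (P s).2 p'.2) := by
  have h1 := (D.hasMFDerivWithinAt_cov_comp hP.hasFDerivWithinAt).congr_mono hΦ (hΦ s hs)
    Subset.rfl
  have h2 := h1.mfderivWithin (uniqueMDiffWithinAt_iff_uniqueDiffWithinAt.mpr hJ)
  refine (congrArg (fun A : ℝ →L[ℝ] EuclideanSpace ℝ (Fin 2) × EuclideanSpace ℝ (Fin 2) => A 1)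
    h2).trans ?_
  change (D.left.dcov (P s).1 ((1 : ℝ) • p').1, D.right.dcov (P s).2 ((1 : ℝ) • p').2) = _
  rw [one_smul]

/-- Stokes expresses half the flux through the four sides of the lifted square. The increments of
`f₀` and `f₁`, together with the difference of shifts from the other two sides, assemble into the
difference of two periods. -/
theorem fluxIntegral_eq [CompactSpace S] {Λ : ℝ → S → S × S} (hΛ : D.IsSmoothPath Λ)
    {L₀ L₁ : ℍ → ℍ × ℍ} {f₀ f₁ : ℍ → ℝ} (hL₀ : D.IsEquivariantLift (Λ 0) L₀)
    (hL₁ : D.IsEquivariantLift (Λ 1) L₁) (hf₀ : IsPotential L₀ f₀) (hf₁ : IsPotential L₁ f₁)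
    {ℓ : Path x₀ x₀} (hℓ : IsSmoothLoop ℓ) :
    1 / 2 * D.fluxIntegral Λ ℓ = hL₀.holonomy hf₀ (Additive.ofMul (loopClass ℓ)) -
      hL₁.holonomy hf₁ (Additive.ofMul (loopClass ℓ)) := by
  have hu := uniqueDiffOn_Icc (zero_lt_one (α := ℝ))
  have hm0 : (0 : ℝ) ∈ Icc (0 : ℝ) 1 := left_mem_Icc.mpr zero_le_one
  have hm1 : (1 : ℝ) ∈ Icc (0 : ℝ) 1 := right_mem_Icc.mpr zero_le_one
  obtain ⟨M, hMc, hM0, hM⟩ := exists_equivariantLift_family hΛ.smooth.continuousOn hL₀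
  have hM1 : M 1 = L₁ := (hM 1 hm1).unique hL₁
  obtain ⟨γ, hγc, hγ, -, hcov, υ, hυ⟩ := D.exists_lift_loop hℓ D.left.cov_base
  have hlift : ∀ t ∈ Icc (0 : ℝ) 1, ∀ s,
      Λ t (ℓ.extend s) = (D.left.cov (M t (γ s)).1, D.right.cov (M t (γ s)).2) := fun t ht s => by
    rw [(hM t ht).lifts, hcov]
  set ψ : ℝ × ℝ → ℂ × ℂ := fun a => toC (M a.1 (γ a.2)) with hψdef
  have hψ : ContDiffOn ℝ ∞ ψ unitSquare := by
    refine D.contDiffOn_of_cov_comp (P := fun a : ℝ × ℝ => M a.1 (γ a.2))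
      (hMc.comp (continuous_fst.prodMk (hγc.comp continuous_snd))).continuousOn ?_
    have h1 : ContMDiffOn 𝓘(ℝ, ℝ × ℝ) (𝓡 2) ∞ (fun a : ℝ × ℝ => ℓ.extend a.2) unitSquare :=
      ContMDiffOn.comp (t := Icc (0 : ℝ) 1) hℓ contDiff_snd.contMDiff.contMDiffOn fun a ha => ha.2
    have h2 : ContMDiffOn 𝓘(ℝ, ℝ × ℝ) (𝓘(ℝ, ℝ).prod (𝓡 2)) ∞
        (fun a : ℝ × ℝ => (a.1, ℓ.extend a.2)) unitSquare :=
      ContMDiffOn.prodMk contDiff_fst.contMDiff.contMDiffOn h1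
    exact (hΛ.smooth.comp h2 fun a ha => ⟨ha.1, mem_univ _⟩).congr
      fun a ha => (hlift a.1 ha.1 a.2).symm
  have hslice : ∀ s ∈ Icc (0 : ℝ) 1, ContDiffOn ℝ ∞ (fun t => toC (M t (γ s))) (Icc 0 1) :=
    fun s hs => hψ.comp (contDiff_id.prodMk contDiff_const).contDiffOn fun t ht => ⟨ht, hs⟩
  obtain ⟨G₀, hG₀s, hG₀⟩ := exists_isPrimitive (hslice 0 hm0)
  obtain ⟨G₁, -, hG₁⟩ := exists_isPrimitive (hslice 1 hm1)
  have hF₀ : IsPrimitive (fun s => ψ (0, s)) (fun s => f₀ (γ s)) := by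
    simp only [hψdef, hM0]
    exact hf₀.isPrimitive hγ
  have hF₁ : IsPrimitive (fun s => ψ (1, s)) (fun s => f₁ (γ s)) := by
    simp only [hψdef, hM1]
    exact hf₁.isPrimitive hγ
  have hstokes := integral_omegaC_eq hψ (fun a _ => (M a.1 (γ a.2)).1.im_ne_zero)
    (fun a _ => (M a.1 (γ a.2)).2.im_ne_zero) hF₀ hF₁ hG₀ hG₁
  have hflux : D.fluxIntegral Λ ℓ = ∫ t in (0 : ℝ)..1, ∫ s in (0 : ℝ)..1, omegaC (ψ (t, s))
      (fderivWithin ℝ ψ unitSquare (t, s) (0, 1)) (fderivWithin ℝ ψ unitSquare (t, s) (1, 0)) := by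
    refine intervalIntegral.integral_congr fun t ht => intervalIntegral.integral_congr fun s hs => ?_
    rw [uIcc_of_le zero_le_one] at ht hs
    have e1 := D.mfderivWithin_eq_dcov (P := fun s => M t (γ s)) hs (hu s hs)
      (hasDerivWithinAt_snd_slice hψ ht hs) fun s _ => hlift t ht s
    have e2 := D.mfderivWithin_eq_dcov (P := fun t => M t (γ s)) ht (hu t ht)
      (hasDerivWithinAt_fst_slice hψ ht hs) fun t ht => hlift t ht s
    rw [hψdef, ← D.Omega_dcov (M t (γ s))]
    exact (congrArg₂ (D.Omega (Λ t (ℓ.extend s))) e1 e2).trans (by rw [hlift t ht s])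
  simp only [intervalIntegral.integral_const_mul] at hstokes
  rw [hflux, hstokes, hL₀.holonomy_eq hf₀ _ υ (γ 0), hL₁.holonomy_eq hf₁ _ υ (γ 0)]
  set τ := υ * (loopClass ℓ)⁻¹ * υ⁻¹
  -- As `γ 1` is the translate of `γ 0` by `ρ_l(τ)`, equivariance of every `M t` makes the side `s =
  -- 1` the image of the side `s = 0` under one isometry.
  have hshift := hG₀.sub_eq_of_smul (a := D.liftElt τ) (hslice 0 hm0) (hslice 1 hm1) hG₀s hG₁
    (fun t ht => by
      rw [← hυ, (hM t ht).equivariant, ← (D.toPSL_liftElt τ).1, ← (D.toPSL_liftElt τ).2,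
        pslAct_toPSL, pslAct_toPSL])
  rw [hshift, period, period, hM0, hM1, hυ]
  ring

/-- Lift the loop to the half-plane and replace it by the straight segment with the same end points.
The two are homotopic because `ℍ` is simply connected, and the segment projects to a smooth loop. -/
theorem exists_smoothLoop (D : FuchsianPair x₀) (τ : FundamentalGroup S x₀) :
    ∃ ℓ : Path x₀ x₀, IsSmoothLoop ℓ ∧ loopClass ℓ = τ := by
  obtain ⟨ℓ₀, rfl⟩ : ∃ ℓ : Path x₀ x₀, loopClass ℓ = τ := ⟨_, (Quotient.exists_rep τ).choose_spec⟩
  have hstart : ℓ₀.toContinuousMap 0 = D.left.cov D.left.base := ℓ₀.source.trans D.left.cov_base.symm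
  set c := D.left.isCoveringMap.liftPath ℓ₀.toContinuousMap D.left.base hstart
  have hc : ∀ s, D.left.cov (c s) = ℓ₀ s := fun s =>
    congrFun (D.left.isCoveringMap.liftPath_lifts ℓ₀.toContinuousMap D.left.base hstart) s
  have hc0 : c 0 = D.left.base := D.left.isCoveringMap.liftPath_zero _ _ _
  obtain ⟨γ, hγ, hγ0, hγ1⟩ := exists_segment D.left.base (c 1)
  have hcont : ContinuousOn γ (Icc 0 1) :=
    UpperHalfPlane.isEmbedding_coe.continuousOn_iff.mpr hγ.continuousOn
  let p : Path D.left.base (c 1) :=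
    ⟨⟨fun s : I => γ s, hcont.comp_continuous continuous_subtype_val fun s => s.2⟩,
      by simpa using hγ0, by simpa using hγ1⟩
  let q : Path D.left.base (c 1) := ⟨c, hc0, rfl⟩
  have hend : x₀ = D.left.cov (c 1) := by rw [hc, ℓ₀.target]
  let ℓ : Path x₀ x₀ := (p.map D.left.isCoveringMap.continuous).cast D.left.cov_base.symm hend
  have hpq : p.Homotopic q := SimplyConnectedSpace.paths_homotopic p q
  have hq : ℓ₀ = (q.map D.left.isCoveringMap.continuous).cast D.left.cov_base.symm hend := by
    ext s
    exact (hc s).symm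
  refine ⟨ℓ, ?_, ?_⟩
  · refine (D.left.contMDiffOn_cov_comp hγ).congr fun s hs => ?_
    rw [ℓ.extend_apply hs]; rfl
  · have : ℓ.Homotopic ℓ₀ := by
      obtain ⟨F⟩ := hpq.map ⟨D.left.cov, D.left.isCoveringMap.continuous⟩
      rw [hq]
      exact ⟨F.cast rfl rfl⟩
    exact congrArg FundamentalGroup.fromPath (Quotient.sound this)

theorem IsHolonomy.unique {Λ : S → S × S} {h h' : Additive (FundamentalGroup S x₀) →+ ℝ}
    (hh : D.IsHolonomy Λ h) (hh' : D.IsHolonomy Λ h') : h = h' := by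
  refine AddMonoidHom.ext fun τ => ?_
  obtain ⟨ℓ, hℓ, hτ⟩ := D.exists_smoothLoop (Additive.toMul τ)
  obtain rfl : Additive.ofMul (loopClass ℓ) = τ := congrArg Additive.ofMul hτ
  obtain ⟨⟨p, hp⟩, h1⟩ := hh ℓ hℓ
  exact ((hh' ℓ hℓ).2 p hp _).mp ((h1 p hp _).mpr rfl)

theorem IsFlux.unique {Λ : ℝ → S → S × S} {f f' : Additive (FundamentalGroup S x₀) →+ ℝ}
    (hf : D.IsFlux Λ f) (hf' : D.IsFlux Λ f') : f = f' := by
  refine AddMonoidHom.ext fun τ => ?_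
  obtain ⟨ℓ, hℓ, hτ⟩ := D.exists_smoothLoop (Additive.toMul τ)
  obtain rfl : Additive.ofMul (loopClass ℓ) = τ := congrArg Additive.ofMul hτ
  exact (hf ℓ hℓ).trans (hf' ℓ hℓ).symm

end FuchsianPair

end Flux

end AdSFlux

end

/-! ### Comparison of the holonomies with the flux. -/

theorem mainTheorem4 {S : Type*} [TopologicalSpace S] [T2Space S] [CompactSpace S]
    [ConnectedSpace S] [ChartedSpace (EuclideanSpace ℝ (Fin 2)) S] [IsManifold (𝓡 2) ∞ S]
    (x₀ : S) (D : AdSFlux.FuchsianPair x₀) (Λ : ℝ → S → S × S) (hΛ : D.IsSmoothPath Λ) :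
    (∃! h₀, D.IsHolonomy (Λ 0) h₀) ∧ (∃! h₁, D.IsHolonomy (Λ 1) h₁) ∧ (∃! f, D.IsFlux Λ f) ∧
    ∀ h₀ h₁ f, D.IsHolonomy (Λ 0) h₀ → D.IsHolonomy (Λ 1) h₁ → D.IsFlux Λ f →
      h₁ = h₀ - (1 / 2 : ℝ) • f := by
  have hΛ₀ := hΛ.mem 0 (left_mem_Icc.mpr zero_le_one)
  have hΛ₁ := hΛ.mem 1 (right_mem_Icc.mpr zero_le_one)
  obtain ⟨L₀, hL₀⟩ := AdSFlux.FuchsianPair.exists_equivariantLift (D := D) hΛ₀.isotopic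
  obtain ⟨L₁, hL₁⟩ := AdSFlux.FuchsianPair.exists_equivariantLift (D := D) hΛ₁.isotopic
  obtain ⟨f₀, hf₀⟩ := hL₀.exists_potential hΛ₀.embedding.contMDiff hΛ₀.lagrangian
  obtain ⟨f₁, hf₁⟩ := hL₁.exists_potential hΛ₁.embedding.contMDiff hΛ₁.lagrangian
  have hh₀ := hL₀.isHolonomy hf₀
  have hh₁ := hL₁.isHolonomy hf₁
  -- Well-definedness of the flux comes with the formula: twice the difference of the holonomies is
  -- a homomorphism taking the required values on smooth loops.
  have hflux : D.IsFlux Λ ((2 : ℝ) • (hL₀.holonomy hf₀ - hL₁.holonomy hf₁)) := fun ℓ hℓ => by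
    have := AdSFlux.FuchsianPair.fluxIntegral_eq hΛ hL₀ hL₁ hf₀ hf₁ hℓ
    rw [AddMonoidHom.smul_apply, AddMonoidHom.sub_apply, ← this, smul_eq_mul]
    ring
  refine ⟨⟨_, hh₀, fun _ h => h.unique hh₀⟩, ⟨_, hh₁, fun _ h => h.unique hh₁⟩,
    ⟨_, hflux, fun _ h => h.unique hflux⟩, ?_⟩
  intro h₀ h₁ f h₀h h₁h hf
  rw [h₀h.unique hh₀, h₁h.unique hh₁, hf.unique hflux, smul_smul]
  norm_num
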